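/- **Formulas.** A quantifier-free Presburger (PA) specification $\varphi(\bar x,\bar y)$ with inputs $\bar x=(x_1,\dots,x_n)$ and outputs $\bar y=(y_1,\dots,y_m)$ ranging over $\mathbb Z$ is a formula in negation normal form: a tree with inner nodes labelled $\wedge,\vee$ and leaves labelled by linear inequalities $\sum_k a_kz_k+b\ge 0$ or modulo constraints $\sum_k a_kz_k\equiv r\pmod N$, $\sum_k a_kz_k\not\equiv r\pmod N$ with integer constants, $0\le r<N$. Its size $|\varphi|$ is the number of nodes plus the number of variables plus the number of bits of all constants (in binary). A *maximal conjunctive subformula* is a node not labelled $\vee$ all of whose proper ancestors are labelled $\vee$. The formula is *$y_i$-modulo-tame* if for each maximal conjunctive subformula there is one modulus $M$ such that every modulo constraint in it that involves $y_i$ has the form $y_i\equiv r\pmod M$. **Normal form.** For $0\le i<m$ put $\bar x^i=(x_1,\dots,x_n,y_1,\dots,y_i)$ and $\bar y^i=(y_{i+1},\dots,y_m)$. The formula $\varphi(\bar x,\bar y)$ is in $\mathsf{PSySyNF}$ if it is $y_i$-modulo-tame for every $i\in\{1,\dots,m\}$ and for each maximal conjunctive subformula $\chi$ there are an integer $M\ge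 1$, a vector $(\bar r,\bar s)\in[0,M-1]^{n+m}$, and affine maps $A_i:\mathbb Q^{n+i}\to\mathbb Q^{m-i}$ ($0\le i<m$), all of whose coefficients have denominators dividing $M$ and with $A_i(\bar r^i)\in\mathbb Z^{m-i}$, where $\bar r^i=(\bar r,s_1,\dots,s_i)$, such that $\chi$ is a positive Boolean combination of formulas $$\Bigl(\psi(\bar x,\bar y)\vee\bigvee_{i=0}^{m-1}\bar y^i=A_i(\bar x^i)\Bigr)\wedge\bigwedge_{i=0}^{m-1}\psi(\bar x^i,A_i(\bar x^i))\wedge(\bar x,\bar y)\equiv(\bar r,\bar s)\pmod M$$ with $\psi$ a leaf formula (literal) as above. (Subformulas containing $A_i(\bar x^i)$ are written with integer coefficients by multiplying through by $M$; equalities are pairs of inequalities.) **Theorem.** There are an algorithm and a polynomial $p$ such that, for all $n,m\ge 0$ and every quantifier-free PA specification $\varphi(\bar x,\bar y)$ with $n$ inputs and $m$ outputs, the algorithm computes from $\varphi$, in time at most $2^{p(|\varphi|)}$, a formula $\psi(\bar x,\bar y)$ in $\mathsf{PSySyNF}$ that is equivalent to $\varphi$ over $\mathbb Z$. Moreover,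 for every maximal conjunctive subformula $\chi$ of $\psi$, the data $M,(\bar r,\bar s),(A_i)_i$ above can be chosen such that the numerators and denominators of all coefficients of the maps $A_i$ have at most $p(|\varphi|)$ bits, and the $A_i$ are solution maps for $\varphi$: whenever $\chi(\bar x,\bar y)$ holds at an integer point, then for each $0\le i<m$ the vector $A_i(\bar x^i)$ is integral and $\varphi(\bar x^i,A_i(\bar x^i))$ holds. Running time is measured for while programs on binary trees in which each step costs the size of the tree it acts on; this model is polynomially equivalent to Turing machines. -/

import Mathlib

namespace PresburgerSynthesis

/-! ### Quantifier-free Presburger formulas in negation normal form -/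

/-- Literals over `k` integer variables: a linear inequality `∑ a v * z v + b ≥ 0`, a modulo
constraint `∑ a v * z v ≡ r (mod N)` with `0 ≤ r < N`, or a negated modulo constraint. -/
inductive Literal (k : ℕ) : Type
  | ge (a : Fin k → ℤ) (b : ℤ) : Literal k
  | cong (a : Fin k → ℤ) (r N : ℕ) (h : r < N) : Literal k
  | ncong (a : Fin k → ℤ) (r N : ℕ) (h : r < N) : Literal k

/-- Formulas in negation normal form, as trees. -/
inductive Formula (k : ℕ) : Type
  | lit (l : Literal k) : Formula k
  | and (φ ψ : Formula k) : Formula k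
  | or (φ ψ : Formula k) : Formula k

def Literal.Sat {k : ℕ} (z : Fin k → ℤ) : Literal k → Prop
  | .ge a b => 0 ≤ ∑ v, a v * z v + b
  | .cong a r N _ => (∑ v, a v * z v) ≡ (r : ℤ) [ZMOD (N : ℤ)]
  | .ncong a r N _ => ¬ (∑ v, a v * z v) ≡ (r : ℤ) [ZMOD (N : ℤ)]

def Formula.Sat {k : ℕ} (z : Fin k → ℤ) : Formula k → Prop
  | .lit l => l.Sat z
  | .and φ ψ => φ.Sat z ∧ ψ.Sat z
  | .or φ ψ => φ.Sat z ∨ ψ.Sat z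

/-- Number of bits of an integer in binary, including a sign bit. -/
def bitLength (a : ℤ) : ℕ := 1 + a.natAbs.size

def Literal.bits {k : ℕ} : Literal k → ℕ
  | .ge a b => ∑ v, bitLength (a v) + bitLength b
  | .cong a r N _ => ∑ v, bitLength (a v) + bitLength r + bitLength N
  | .ncong a r N _ => ∑ v, bitLength (a v) + bitLength r + bitLength N

/-- Number of nodes of the tree, plus the number of bits of all constants in the leaves. -/
def Formula.nodesAndBits {k : ℕ} : Formula k → ℕ
  | .lit l => 1 + l.bits
  | .and φ ψ => 1 + φ.nodesAndBits + ψ.nodesAndBits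
  | .or φ ψ => 1 + φ.nodesAndBits + ψ.nodesAndBits

/-- The size `|φ|`: number of nodes, number of variables, number of bits of all constants. -/
def Formula.size {k : ℕ} (φ : Formula k) : ℕ := k + φ.nodesAndBits

def Formula.literals {k : ℕ} : Formula k → List (Literal k)
  | .lit l => [l]
  | .and φ ψ => φ.literals ++ ψ.literals
  | .or φ ψ => φ.literals ++ ψ.literals

/-- The maximal conjunctive subformulas: the nodes that are not labelled `∨` and all of whose
proper ancestors are labelled `∨`. A leaf counts as a conjunction with one conjunct. -/
def Formula.maxConjunctive {k : ℕ} : Formula k → List (Formula k)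
  | .lit l => [.lit l]
  | .and φ ψ => [.and φ ψ]
  | .or φ ψ => φ.maxConjunctive ++ ψ.maxConjunctive

/-- `0 ≥ 0`. -/
def Formula.verum {k : ℕ} : Formula k := .lit (.ge (fun _ => 0) 0)

/-- `-1 ≥ 0`. -/
def Formula.falsum {k : ℕ} : Formula k := .lit (.ge (fun _ => 0) (-1))

def bigAnd {k : ℕ} : List (Formula k) → Formula k
  | [] => .verum
  | [φ] => φ
  | φ :: ψ :: l => .and φ (bigAnd (ψ :: l))

def bigOr {k : ℕ} : List (Formula k) → Formula k
  | [] => .falsum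
  | [φ] => φ
  | φ :: ψ :: l => .or φ (bigOr (ψ :: l))

/-! ### Modulo-tameness and the syntactic normal form -/

/-- `l` is a (possibly negated) modulo constraint in which the variable `v` occurs. -/
def Literal.ModuloInvolves {k : ℕ} (v : Fin k) : Literal k → Prop
  | .ge _ _ => False
  | .cong a _ _ _ => a v ≠ 0
  | .ncong a _ _ _ => a v ≠ 0

/-- `v`-modulo-tameness: in every maximal conjunctive subformula there is one modulus `M` such
that all modulo constraints involving `v` are of the form `v ≡ r (mod M)`. -/
def Formula.IsModuloTame {k : ℕ} (φ : Formula k) (v : Fin k) : Prop :=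
  ∀ χ ∈ φ.maxConjunctive, ∃ M : ℕ, ∀ l ∈ χ.literals, l.ModuloInvolves v →
    ∃ (r : ℕ) (h : r < M), l = .cong (Pi.single v 1) r M h

/-- Affine maps `ℚ^k → ℚ^l`, given by their coefficients. -/
structure RatAffine (k l : ℕ) : Type where
  lin : Matrix (Fin l) (Fin k) ℚ
  const : Fin l → ℚ

def RatAffine.eval {k l : ℕ} (A : RatAffine k l) (u : Fin k → ℤ) (j : Fin l) : ℚ :=
  ∑ w, A.lin j w * (u w : ℚ) + A.const j

/-- The position in `(x, y)` of the `w`-th entry of `x^i = (x_1, …, x_n, y_1, …, y_i)`. -/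
def headVar {n m : ℕ} (i : Fin m) (w : Fin (n + i)) : Fin (n + m) :=
  ⟨w, by have := w.2; have := i.2; omega⟩

/-- The position in `(x, y)` of the `j`-th entry of `y^i = (y_{i+1}, …, y_m)`. -/
def tailVar {n m : ℕ} (i : Fin m) (j : Fin (m - i)) : Fin (n + m) :=
  ⟨n + i + j, by have := j.2; have := i.2; omega⟩

/-- The data shared by the building blocks of one maximal conjunctive subformula, for `n` inputs
`x` and `m` outputs `y`: a modulus `M`, residues of `(x, y)` modulo `M`, and for `0 ≤ i < m` an
affine map `A i : ℚ^(n+i) → ℚ^(m-i)`, all of whose denominators divide `M` and which is integral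
on (the first `n + i`) residues. -/
structure BlockData (n m : ℕ) : Type where
  M : ℕ
  M_pos : 0 < M
  res : Fin (n + m) → ℕ
  res_lt : ∀ v, res v < M
  A : (i : Fin m) → RatAffine (n + i) (m - i)
  den_lin : ∀ i j w, ((A i).lin j w).den ∣ M
  den_const : ∀ i j, ((A i).const j).den ∣ M
  integral : ∀ i j, ∃ c : ℤ, (A i).eval (fun w => (res (headVar i w) : ℤ)) j = c

namespace BlockData

variable {n m : ℕ} (P : BlockData n m)

/-- The integer `M * q`, for a rational `q` whose denominator divides `M`. -/
def clear (q : ℚ) : ℤ := ((P.M : ℚ) * q).num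

/-- In `(x^i, A_i(x^i))`, multiplied by `M`: the coefficient of the variable `w` in the entry at
position `v`. -/
def substCoeff (i : Fin m) (v w : Fin (n + m)) : ℤ :=
  if hv : (v : ℕ) < n + i then
    if v = w then P.M else 0
  else
    if hw : (w : ℕ) < n + i then
      P.clear ((P.A i).lin ⟨v - (n + i), by have := v.2; omega⟩ ⟨w, hw⟩)
    else 0

/-- In `(x^i, A_i(x^i))`, multiplied by `M`: the constant term of the entry at position `v`. -/
def substConst (i : Fin m) (v : Fin (n + m)) : ℤ :=
  if hv : (v : ℕ) < n + i then 0
  else P.clear ((P.A i).const ⟨v - (n + i), by have := v.2; omega⟩)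

theorem residue_lt (M N : ℕ) (hM : 0 < M) (hN : 0 < N) (c : ℤ) :
    (c % ((M * N : ℕ) : ℤ)).toNat < M * N := by
  have h : (0 : ℤ) < ((M * N : ℕ) : ℤ) := by exact_mod_cast Nat.mul_pos hM hN
  have h1 := Int.emod_nonneg c h.ne'
  have h2 := Int.emod_lt_of_pos c h
  omega

/-- The literal `l(x^i, A_i(x^i))` in the variables `x^i`, with its denominators cleared through
multiplication by `M` (of both sides and, in modulo constraints, of the modulus). -/
def subst (i : Fin m) : Literal (n + m) → Literal (n + m)
  | .ge a b => .ge (fun w => ∑ v, a v * P.substCoeff i v w)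
      ((P.M : ℤ) * b + ∑ v, a v * P.substConst i v)
  | .cong a r N h => .cong (fun w => ∑ v, a v * P.substCoeff i v w)
      ((((P.M : ℤ) * r - ∑ v, a v * P.substConst i v) % ((P.M * N : ℕ) : ℤ)).toNat) (P.M * N)
      (residue_lt P.M N P.M_pos (Nat.zero_lt_of_lt h) _)
  | .ncong a r N h => .ncong (fun w => ∑ v, a v * P.substCoeff i v w)
      ((((P.M : ℤ) * r - ∑ v, a v * P.substConst i v) % ((P.M * N : ℕ) : ℤ)).toNat) (P.M * N)
      (residue_lt P.M N P.M_pos (Nat.zero_lt_of_lt h) _)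

/-- The formula `y^i = A_i(x^i)`: for each entry of `y^i`, two inequalities with denominators
cleared through multiplication by `M`. -/
def graph (i : Fin m) : Formula (n + m) :=
  bigAnd
    (List.ofFn (fun j : Fin (m - i) => Formula.lit (.ge
        (fun w => (if w = tailVar i j then (P.M : ℤ) else 0) - P.substCoeff i (tailVar i j) w)
        (- P.substConst i (tailVar i j)))) ++
     List.ofFn (fun j : Fin (m - i) => Formula.lit (.ge
        (fun w => P.substCoeff i (tailVar i j) w - (if w = tailVar i j then (P.M : ℤ) else 0))
        (P.substConst i (tailVar i j)))))

/-- The building block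
`(l(x, y) ∨ ⋁_i y^i = A_i(x^i)) ∧ ⋀_i l(x^i, A_i(x^i)) ∧ (x, y) ≡ res (mod M)`. -/
def block (l : Literal (n + m)) : Formula (n + m) :=
  bigAnd
    (bigOr (.lit l :: List.ofFn (fun i : Fin m => P.graph i)) ::
      (List.ofFn (fun i : Fin m => Formula.lit (P.subst i l)) ++
       List.ofFn (fun v : Fin (n + m) =>
        Formula.lit (.cong (Pi.single v 1) (P.res v) P.M (P.res_lt v)))))

/-- Positive Boolean combinations of building blocks with the data `P`. -/
inductive IsCombination : Formula (n + m) → Prop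
  | block (l : Literal (n + m)) : IsCombination (P.block l)
  | and (φ ψ : Formula (n + m)) : IsCombination φ → IsCombination ψ → IsCombination (.and φ ψ)
  | or (φ ψ : Formula (n + m)) : IsCombination φ → IsCombination ψ → IsCombination (.or φ ψ)

/-- All coefficients of the affine maps have numerators and denominators of at most `B` bits. -/
def CoeffBitsLE (B : ℕ) : Prop :=
  ∀ i j, (∀ w, bitLength ((P.A i).lin j w).num ≤ B ∧ bitLength ((P.A i).lin j w).den ≤ B) ∧
    bitLength ((P.A i).const j).num ≤ B ∧ bitLength ((P.A i).const j).den ≤ B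

/-- The affine maps are solution maps for `φ` on the set defined by `χ`: if `χ` holds at `(x, y)`
then, for every `i`, the vector `A_i(x^i)` is integral and `φ` holds at `(x^i, A_i(x^i))`. -/
def AreSolutionMaps (φ χ : Formula (n + m)) : Prop :=
  ∀ z : Fin (n + m) → ℤ, χ.Sat z → ∀ i : Fin m, ∃ z' : Fin (n + m) → ℤ,
    (∀ w : Fin (n + i), z' (headVar i w) = z (headVar i w)) ∧
    (∀ j : Fin (m - i), (z' (tailVar i j) : ℚ) = (P.A i).eval (fun w => z (headVar i w)) j) ∧
    φ.Sat z'

end BlockData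

/-- The syntactic normal form, for formulas with `n` inputs and `m` outputs. -/
def IsPSySyNF (n m : ℕ) (φ : Formula (n + m)) : Prop :=
  (∀ i : Fin m, φ.IsModuloTame (Fin.natAdd n i)) ∧
    ∀ χ ∈ φ.maxConjunctive, ∃ P : BlockData n m, P.IsCombination χ

/-! ### Programs and running time

While programs on binary trees (LISP-style lists without atoms). Every step is charged the full
size of the tree it acts on, so that the running time also pays for copying. A Turing machine
simulates a program with polynomial overhead, and conversely. -/

inductive BinTree : Type
  | nil : BinTree
  | cons (a b : BinTree) : BinTree

namespace BinTree

def size : BinTree → ℕ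
  | nil => 1
  | cons a b => 1 + a.size + b.size

def fst : BinTree → BinTree
  | nil => nil
  | cons a _ => a

def snd : BinTree → BinTree
  | nil => nil
  | cons _ b => b

end BinTree

inductive Program : Type
  | id : Program
  | nil : Program
  | fst : Program
  | snd : Program
  | pair (p q : Program) : Program
  | seq (p q : Program) : Program
  | cond (c p q : Program) : Program
  | loop (c p : Program) : Program

/-- `Runs p x y t`: on input `x`, the program `p` halts with output `y` in time `t`.
`seq p q` runs `p` and then `q`; `cond c p q` runs `p` if the result of `c` is not `nil`, else `q`;
`loop c p` repeats `p` as long as the result of `c` is not `nil`. -/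
inductive Runs : Program → BinTree → BinTree → ℕ → Prop
  | id (x : BinTree) : Runs .id x x x.size
  | nil (x : BinTree) : Runs .nil x .nil x.size
  | fst (x : BinTree) : Runs .fst x x.fst x.size
  | snd (x : BinTree) : Runs .snd x x.snd x.size
  | pair {p q : Program} {x a b : BinTree} {s t : ℕ} :
      Runs p x a s → Runs q x b t → Runs (.pair p q) x (.cons a b) (x.size + s + t)
  | seq {p q : Program} {x a b : BinTree} {s t : ℕ} :
      Runs p x a s → Runs q a b t → Runs (.seq p q) x b (s + t)
  | cond_true {c p q : Program} {x b y : BinTree} {s t : ℕ} :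
      Runs c x b s → b ≠ .nil → Runs p x y t → Runs (.cond c p q) x y (x.size + s + t)
  | cond_false {c p q : Program} {x y : BinTree} {s t : ℕ} :
      Runs c x .nil s → Runs q x y t → Runs (.cond c p q) x y (x.size + s + t)
  | loop_stop {c p : Program} {x : BinTree} {s : ℕ} :
      Runs c x .nil s → Runs (.loop c p) x x (x.size + s)
  | loop_step {c p : Program} {x b y z : BinTree} {s t u : ℕ} :
      Runs c x b s → b ≠ .nil → Runs p x y t → Runs (.loop c p) y z u →
      Runs (.loop c p) x z (x.size + s + t + u)

/-! ### Encoding of formulas, with constants in binary -/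

def encodeList : List BinTree → BinTree
  | [] => .nil
  | a :: l => .cons a (encodeList l)

def encodeBool : Bool → BinTree
  | false => .nil
  | true => .cons .nil .nil

/-- Unary, used only for the numbers of variables. -/
def encodeUnary (n : ℕ) : BinTree := encodeList (List.replicate n .nil)

/-- Binary, least significant bit first. -/
def encodeNat (n : ℕ) : BinTree := encodeList (n.bits.map encodeBool)

/-- Sign and absolute value. -/
def encodeInt (a : ℤ) : BinTree := .cons (encodeBool (decide (a < 0))) (encodeNat a.natAbs)

def encodeCoeffs {k : ℕ} (a : Fin k → ℤ) : BinTree :=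
  encodeList (List.ofFn (fun v => encodeInt (a v)))

def encodeLiteral {k : ℕ} : Literal k → BinTree
  | .ge a b => .cons (encodeUnary 0) (.cons (encodeCoeffs a) (encodeInt b))
  | .cong a r N _ =>
      .cons (encodeUnary 1) (.cons (encodeCoeffs a) (.cons (encodeNat r) (encodeNat N)))
  | .ncong a r N _ =>
      .cons (encodeUnary 2) (.cons (encodeCoeffs a) (.cons (encodeNat r) (encodeNat N)))

def encodeFormula {k : ℕ} : Formula k → BinTree
  | .lit l => .cons (encodeUnary 0) (encodeLiteral l)
  | .and φ ψ => .cons (encodeUnary 1) (.cons (encodeFormula φ) (encodeFormula ψ))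
  | .or φ ψ => .cons (encodeUnary 2) (.cons (encodeFormula φ) (encodeFormula ψ))

/-- A specification: the numbers of inputs and of outputs, and the formula. -/
def encodeSpec (n m : ℕ) (φ : Formula (n + m)) : BinTree :=
  .cons (encodeUnary n) (.cons (encodeUnary m) (encodeFormula φ))

end PresburgerSynthesis

open PresburgerSynthesis

/-!
The normal form of `φ` is a disjunction over all families of small parameters, where each disjunct
arises from `φ` by replacing every literal by its building block for these parameters (`Choice.conv`,
`normalForm`). The work lies in showing that small parameters suffice.

*Parameters.* A family of parameters (`Choice`) has a modulus `M = D * N`, residues `r` modulo `M`,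
and affine maps whose entries are `r v + N * c i v + ∑ w, a i v w * (x w - r w) / D`. On the residue
class of `r` such an entry is an integer congruent to `r v` modulo `N`. Integrality and the congruences
modulo `N` therefore hold for all values of the parameters, and every number is the code of a valid
family (`Choice.ofIndex`): there is nothing to check in the enumeration. A modulo constraint whose
modulus divides `N` has a constant truth value on the residue class, and is replaced by that truth
value; other modulo constraints are replaced by a false inequality. Hence a building block never
contains a modulo constraint other than those that fix the residues, and modulo-tameness is clear.

*Soundness.* Suppose that a disjunct holds at `(x, y)`. The building blocks of the literals that hold
there assert that `φ` holds at every point `(x^i, A_i(x^i))`; and `φ` holds at `(x, y)` itself, since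
either `(x, y)` is one of these points, or all those literals hold at `(x, y)`
(`Choice.sat_of_conv_sat`). So `φ` is implied, and the `A_i` are solution maps.

*Completeness.* Suppose that `φ` holds at `(x, y)`. Let `N` be the product of the moduli in `φ`. For
each `i`, the inequalities of `φ` that hold at `(x, y)` form a system in the unknowns `y^i`, with the
sign conditions on `y^i` added so that the columns are independent. By Siegel's lemma
(`exists_small_kernel_vector`) there are small integral directions along which given rows are
constant; moving along `N` times such a direction until an inequality is about to fail makes one more
row almost tight. After as many steps as there are unknowns (`exists_small_slack`), Cramer's rule
expresses the solution, which has stayed in its residue class modulo `N`, as an affine function of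
`x^i` with coefficients of polynomially many bits (`exists_small_affine_solution`). With the residues
of `(x, y)`, and with the product of the determinants for `D`, this is a family of small parameters
for which all literals that hold at `(x, y)` hold at the points `(x^i, A_i(x^i))` as well
(`exists_choice`), so that the corresponding disjunct holds at `(x, y)`.

*Running time.* There are exponentially many disjuncts. Given the bound `Q` for the digits and the
number `R` of disjuncts in unary, the conversion takes polynomial time (`polyTime_specTree`), with
all arithmetic done in unary. The class `PolyTime` is closed under composition, pairing, case
distinction, and folds whose state grows by a bounded amount per step. As `Q` and `R` are powers of
two with polynomial exponents, they are computed in exponential time (`exists_padded_program`).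
-/

namespace PresburgerSynthesis

/-! ### Polynomially bounded functions -/

/-- `f : ℕ → ℕ` is bounded by a polynomial; the base `n + 2 ≥ 2` absorbs constant factors. -/
def PolyBdd (f : ℕ → ℕ) : Prop := ∃ k, ∀ n, f n ≤ (n + 2) ^ k

namespace PolyBdd

theorem const (c : ℕ) : PolyBdd fun _ => c :=
  ⟨c, fun n => (Nat.lt_two_pow_self (n := c)).le.trans (Nat.pow_le_pow_left (by omega) c)⟩

theorem id : PolyBdd fun n => n := ⟨1, fun n => by simp⟩

theorem linear (c : ℕ) : PolyBdd fun n => c * n :=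
  let ⟨k, hk⟩ := const c
  ⟨k + 1, fun n => by rw [pow_succ]; exact Nat.mul_le_mul (hk n) (by omega)⟩

theorem pow_add_two (k : ℕ) : PolyBdd fun n => (n + 2) ^ k := ⟨k, fun _ => le_rfl⟩

theorem mul {f g : ℕ → ℕ} (hf : PolyBdd f) (hg : PolyBdd g) : PolyBdd fun n => f n * g n :=
  let ⟨k, hk⟩ := hf; let ⟨l, hl⟩ := hg
  ⟨k + l, fun n => by rw [pow_add]; exact Nat.mul_le_mul (hk n) (hl n)⟩

theorem add {f g : ℕ → ℕ} (hf : PolyBdd f) (hg : PolyBdd g) : PolyBdd fun n => f n + g n := by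
  obtain ⟨k, hk⟩ := hf
  obtain ⟨l, hl⟩ := hg
  refine ⟨max k l + 1, fun n => ?_⟩
  have h1 : (n + 2) ^ k ≤ (n + 2) ^ max k l := Nat.pow_le_pow_right (by omega) (le_max_left _ _)
  have h2 : (n + 2) ^ l ≤ (n + 2) ^ max k l := Nat.pow_le_pow_right (by omega) (le_max_right _ _)
  have h3 : (n + 2) ^ (max k l + 1) = (n + 2) ^ max k l * n + 2 * (n + 2) ^ max k l := by ring
  have := hk n
  have := hl n
  show f n + g n ≤ _
  rw [h3]
  have : 0 ≤ (n + 2) ^ max k l * n := Nat.zero_le _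
  omega

theorem pow {f : ℕ → ℕ} (hf : PolyBdd f) (j : ℕ) : PolyBdd fun n => f n ^ j :=
  let ⟨k, hk⟩ := hf
  ⟨k * j, fun n => by rw [pow_mul]; exact Nat.pow_le_pow_left (hk n) j⟩

end PolyBdd

/-! ### Encodings and polynomial-time functions -/

theorem BinTree.size_pos (x : BinTree) : 0 < x.size := by cases x <;> simp [BinTree.size]

theorem BinTree.size_fst_le (x : BinTree) : x.fst.size ≤ x.size := by
  cases x <;> simp [BinTree.size, BinTree.fst]; omega

theorem BinTree.size_snd_le (x : BinTree) : x.snd.size ≤ x.size := by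
  cases x <;> simp [BinTree.size, BinTree.snd]

/-- The output of a program is paid for by its running time. -/
theorem Runs.size_le {p : Program} {x y : BinTree} {t : ℕ} (h : Runs p x y t) : y.size ≤ t := by
  induction h with
  | id x => exact le_rfl
  | nil x => exact x.size_pos
  | fst x => exact x.size_fst_le
  | snd x => exact x.size_snd_le
  | @pair p q x a b s t _ _ h1 h2 =>
    have := x.size_pos
    simp only [BinTree.size]; omega
  | _ => omega

/-- A representation of the elements of `α` by trees. It need not be injective. Natural numbers are
represented in unary: the conversion pays for its exponential running time by working on inputs
that are padded with unary numbers of exponential size, so that it can be treated as a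
polynomial-time computation. -/
class Enc (α : Type) where
  toTree : α → BinTree

/-- The tree that represents `a`. -/
abbrev enc {α : Type} [Enc α] (a : α) : BinTree := Enc.toTree a

/-- The size of the tree that represents `a`. -/
def sz {α : Type} [Enc α] (a : α) : ℕ := (enc a).size

instance : Enc BinTree := ⟨fun x => x⟩
instance : Enc Unit := ⟨fun _ => .nil⟩
instance : Enc Bool := ⟨encodeBool⟩
instance {α β : Type} [Enc α] [Enc β] : Enc (α × β) := ⟨fun p => .cons (enc p.1) (enc p.2)⟩
instance {α : Type} [Enc α] : Enc (List α) := ⟨fun l => encodeList (l.map enc)⟩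

instance : Enc ℕ := ⟨encodeUnary⟩

/-- The positive and the negative part, both in unary. -/
instance : Enc ℤ := ⟨fun z => .cons (encodeUnary z.toNat) (encodeUnary (-z).toNat)⟩

section sizes

variable {α β : Type} [Enc α] [Enc β]

theorem sz_nil : sz ([] : List α) = 1 := rfl

theorem sz_prod (p : α × β) : sz p = 1 + sz p.1 + sz p.2 := rfl

theorem sz_cons (a : α) (l : List α) : sz (a :: l) = 1 + sz a + sz l := rfl

theorem length_lt_sz (l : List α) : l.length < sz l := by
  induction l with
  | nil => exact Nat.zero_lt_one
  | cons a l ih => rw [sz_cons, List.length_cons]; omega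

theorem sz_le_of_mem {a : α} {l : List α} (h : a ∈ l) : sz a ≤ sz l := by
  induction l with
  | nil => simp at h
  | cons b l ih =>
    rw [sz_cons]
    rcases List.mem_cons.1 h with rfl | h
    · omega
    · have := ih h; omega

theorem encodeUnary_size (n : ℕ) : (encodeUnary n).size = 2 * n + 1 := by
  induction n with
  | zero => rfl
  | succ n ih =>
    have : (encodeUnary (n + 1)).size = 1 + 1 + (encodeUnary n).size := rfl
    omega

theorem sz_nat (n : ℕ) : sz n = 2 * n + 1 := encodeUnary_size n

theorem sz_int (z : ℤ) : sz z = 2 * z.natAbs + 3 := by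
  have : sz z = 1 + (encodeUnary z.toNat).size + (encodeUnary (-z).toNat).size := rfl
  rw [this, encodeUnary_size, encodeUnary_size]
  omega

theorem sz_bool_le (b : Bool) : sz b ≤ 3 := by cases b <;> decide

end sizes

/-- `f` is computed by a program in polynomial time with respect to the size of the encodings. -/
@[fun_prop]
def PolyTime {α β : Type} [Enc α] [Enc β] (f : α → β) : Prop :=
  ∃ (p : Program) (B : ℕ → ℕ), PolyBdd B ∧
    ∀ a, ∃ t, Runs p (enc a) (enc (f a)) t ∧ t ≤ B (sz a)

namespace PolyTime

variable {α β γ δ σ : Type} [Enc α] [Enc β] [Enc γ] [Enc δ] [Enc σ]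

theorem exists_pow {f : α → β} (hf : PolyTime f) : ∃ (p : Program) (k : ℕ),
    ∀ a, ∃ t, Runs p (enc a) (enc (f a)) t ∧ t ≤ (sz a + 2) ^ k := by
  obtain ⟨p, B, ⟨k, hk⟩, h⟩ := hf
  exact ⟨p, k, fun a => let ⟨t, h1, h2⟩ := h a; ⟨t, h1, h2.trans (hk _)⟩⟩

/-- The result of a polynomial-time computation has polynomial size. -/
theorem sz_le {f : α → β} (hf : PolyTime f) : ∃ B, PolyBdd B ∧ ∀ a, sz (f a) ≤ B (sz a) := by
  obtain ⟨p, B, hB, h⟩ := hf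
  exact ⟨B, hB, fun a => let ⟨t, h1, h2⟩ := h a; h1.size_le.trans h2⟩

/-- A change of type that does not change the encoding. -/
theorem of_enc_eq {f : α → β} (h : ∀ a, enc (f a) = enc a) : PolyTime f :=
  ⟨.id, _, .id, fun a => ⟨_, by rw [h a]; exact .id _, le_rfl⟩⟩

theorem congr_enc {f : α → β} {g : α → γ} (hf : PolyTime f) (h : ∀ a, enc (g a) = enc (f a)) :
    PolyTime g := by
  obtain ⟨p, B, hB, hp⟩ := hf
  exact ⟨p, B, hB, fun a => by rw [h a]; exact hp a⟩

@[fun_prop]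
theorem id : PolyTime fun a : α => a := of_enc_eq fun _ => rfl

@[fun_prop]
theorem comp {g : β → γ} {f : α → β} (hg : PolyTime g) (hf : PolyTime f) :
    PolyTime fun a => g (f a) := by
  obtain ⟨p, k, hp⟩ := hf.exists_pow
  obtain ⟨q, l, hq⟩ := hg.exists_pow
  refine ⟨.seq p q, fun n => (n + 2) ^ k + ((n + 2) ^ k + 2) ^ l,
    .add (.pow_add_two k) (.pow (.add (.pow_add_two k) (.const 2)) l), fun a => ?_⟩
  obtain ⟨t, h1, h2⟩ := hp a
  obtain ⟨u, h3, h4⟩ := hq (f a)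
  refine ⟨t + u, .seq h1 h3, Nat.add_le_add h2 (h4.trans (Nat.pow_le_pow_left ?_ l))⟩
  exact Nat.add_le_add_right (h1.size_le.trans h2) 2

theorem exists_const_program (c : BinTree) :
    ∃ p : Program, ∀ x, ∃ t, Runs p x c t ∧ t ≤ c.size * x.size := by
  induction c with
  | nil => exact ⟨.nil, fun x => ⟨_, .nil x, by simp [BinTree.size]⟩⟩
  | cons a b iha ihb =>
    obtain ⟨p, hp⟩ := iha
    obtain ⟨q, hq⟩ := ihb
    refine ⟨.pair p q, fun x => ?_⟩
    obtain ⟨s, h1, h2⟩ := hp x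
    obtain ⟨t, h3, h4⟩ := hq x
    refine ⟨_, .pair h1 h3, ?_⟩
    have : (BinTree.cons a b).size * x.size = x.size + a.size * x.size + b.size * x.size := by
      simp only [BinTree.size]; ring
    omega

@[fun_prop]
theorem const (c : β) : PolyTime fun _ : α => c := by
  obtain ⟨p, hp⟩ := exists_const_program (enc c)
  exact ⟨p, fun n => (enc c).size * n, .mul (.const _) .id, fun a => hp (enc a)⟩

@[fun_prop]
theorem prodMk {f : α → β} {g : α → γ} (hf : PolyTime f) (hg : PolyTime g) :
    PolyTime fun a => (f a, g a) := by
  obtain ⟨p, B, hB, hp⟩ := hf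
  obtain ⟨q, C, hC, hq⟩ := hg
  refine ⟨.pair p q, fun n => n + B n + C n, (PolyBdd.id.add hB).add hC, fun a => ?_⟩
  obtain ⟨s, h1, h2⟩ := hp a
  obtain ⟨t, h3, h4⟩ := hq a
  exact ⟨_, .pair h1 h3, by dsimp only; unfold sz at *; omega⟩

@[fun_prop]
theorem fst {f : α → β × γ} (hf : PolyTime f) : PolyTime fun a => (f a).1 :=
  comp (g := Prod.fst) ⟨.fst, _, .id, fun _ => ⟨_, .fst _, le_rfl⟩⟩ hf

@[fun_prop]
theorem snd {f : α → β × γ} (hf : PolyTime f) : PolyTime fun a => (f a).2 :=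
  comp (g := Prod.snd) ⟨.snd, _, .id, fun _ => ⟨_, .snd _, le_rfl⟩⟩ hf

@[fun_prop]
theorem cond {b : α → Bool} {f g : α → β} (hb : PolyTime b) (hf : PolyTime f) (hg : PolyTime g) :
    PolyTime fun a => bif b a then f a else g a := by
  obtain ⟨c, A, hA, hc⟩ := hb
  obtain ⟨p, B, hB, hp⟩ := hf
  obtain ⟨q, C, hC, hq⟩ := hg
  refine ⟨.cond c p q, fun n => n + A n + B n + C n, ((PolyBdd.id.add hA).add hB).add hC,
    fun a => ?_⟩
  obtain ⟨r, h1, h2⟩ := hc a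
  obtain ⟨s, h3, h4⟩ := hp a
  obtain ⟨t, h5, h6⟩ := hq a
  dsimp only
  cases h : b a with
  | true =>
    rw [h] at h1
    exact ⟨_, .cond_true h1 (fun h => BinTree.noConfusion h) h3, by unfold sz at *; omega⟩
  | false =>
    rw [h] at h1
    exact ⟨_, .cond_false h1 h5, by unfold sz at *; omega⟩

end PolyTime

/-! ### Loops over lists -/

theorem sz_foldl_le {σ β : Type} [Enc σ] {f : σ → β → σ} {K : ℕ} (l : List β) (s : σ)
    (h : ∀ u, ∀ b ∈ l, sz (f u b) ≤ sz u + K) : sz (l.foldl f s) ≤ sz s + l.length * K := by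
  induction l generalizing s with
  | nil => simp
  | cons b l ih =>
    have h1 := ih (f s b) fun u b hb => h u b (List.mem_cons_of_mem _ hb)
    have h2 := h s b List.mem_cons_self
    have h3 : (b :: l).length * K = l.length * K + K := by rw [List.length_cons]; ring
    rw [List.foldl_cons]
    omega

/-- One pass of the loop that folds a step function over a list: the state `(x, (a :: l, s))`
becomes `(x, (l, s'))`, where `step` computes `s'` from `(x, (s, a))`. -/
def foldBody (step : Program) : Program :=
  .pair .fst (.pair (.seq .snd (.seq .fst .snd))
    (.seq (.pair .fst (.pair (.seq .snd .snd) (.seq .snd (.seq .fst .fst)))) step))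

/-- The loop that folds a step function over a list, on states `(x, (l, s))`. -/
def foldLoop (step : Program) : Program :=
  .loop (.seq .snd .fst) (foldBody step)

theorem foldBody_runs {step : Program} {x a l s s' : BinTree} {t : ℕ}
    (h : Runs step (.cons x (.cons s a)) s' t) :
    ∃ u, Runs (foldBody step) (.cons x (.cons (.cons a l) s)) (.cons x (.cons l s')) u ∧
      u ≤ t + 20 * (x.size + a.size + l.size + s.size + 3) := by
  refine ⟨_, .pair (.fst _) (.pair (.seq (.snd _) (.seq (.fst _) (.snd _)))
    (.seq (.pair (.fst _) (.pair (.seq (.snd _) (.snd _))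
      (.seq (.snd _) (.seq (.fst _) (.fst _))))) h)), ?_⟩
  simp only [BinTree.size, BinTree.fst, BinTree.snd]
  omega

/-- If every step of a fold takes time at most `T`, and every intermediate result has size at most
`W`, then the loop takes time `O(length * (T + size of the state))`. -/
theorem foldLoop_runs {σ β : Type} [Enc σ] [Enc β] {f : σ → β → σ} {step : Program} {x : BinTree}
    {T W : ℕ} (l : List β) (s : σ)
    (hT : ∀ l₁ b l₂, l = l₁ ++ b :: l₂ → ∃ t ≤ T,
      Runs step (.cons x (.cons (enc (l₁.foldl f s)) (enc b))) (enc ((l₁ ++ [b]).foldl f s)) t)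
    (hW : ∀ l₁ l₂, l = l₁ ++ l₂ → sz (l₁.foldl f s) ≤ W) :
    ∃ t ≤ (l.length + 1) * (T + 30 * (x.size + sz l + W + 3)),
      Runs (foldLoop step) (.cons x (.cons (enc l) (enc s)))
        (.cons x (.cons .nil (enc (l.foldl f s)))) t := by
  induction l generalizing s with
  | nil =>
    refine ⟨_, ?_, Runs.loop_stop (.seq (.snd _) (.fst _))⟩
    have h1 := hW [] [] rfl
    simp only [sz, BinTree.size, BinTree.snd, List.foldl_nil, List.length_nil, zero_add,
      one_mul] at *
    have : (enc ([] : List β)).size = 1 := rfl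
    omega
  | cons b l ih =>
    obtain ⟨t, ht, hr⟩ := hT [] b l rfl
    obtain ⟨u, hu, hr'⟩ := ih (f s b)
      (fun l₁ b' l₂ h => by
        have := hT (b :: l₁) b' l₂ (by rw [h]; rfl)
        simpa using this)
      (fun l₁ l₂ h => hW (b :: l₁) l₂ (by rw [h]; rfl))
    obtain ⟨v, hv', hv⟩ := foldBody_runs (l := enc l) hr
    change ∃ t ≤ _, Runs _ (.cons x (.cons (.cons (enc b) (enc l)) (enc s))) _ t
    refine ⟨_, ?_, .loop_step (c := .seq .snd .fst) (.seq (.snd _) (.fst _)) ?_ hv' hr'⟩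
    · have h1 := hW [] (b :: l) rfl
      have h2 : sz (b :: l) = 1 + sz b + sz l := sz_cons b l
      have h4 : (l.length + 1) * (T + 30 * (x.size + sz l + W + 3)) ≤
          (l.length + 1) * (T + 30 * (x.size + sz (b :: l) + W + 3)) :=
        Nat.mul_le_mul_left _ (by omega)
      have h5 : ((b :: l).length + 1) * (T + 30 * (x.size + sz (b :: l) + W + 3)) =
          (l.length + 1) * (T + 30 * (x.size + sz (b :: l) + W + 3)) +
            (T + 30 * (x.size + sz (b :: l) + W + 3)) := by
        rw [List.length_cons]; ring
      have e : ∀ {α : Type} [Enc α] (a : α), (enc a).size = sz a := fun _ => rfl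
      rw [List.foldl_nil] at h1
      replace hv : v ≤ t + 20 * (x.size + sz b + sz l + sz s + 3) := hv
      simp only [BinTree.size, BinTree.snd, e]
      omega
    · exact fun h => BinTree.noConfusion h

namespace PolyTime

variable {α β γ δ σ : Type} [Enc α] [Enc β] [Enc γ] [Enc δ] [Enc σ]

/-- Folds are computable in polynomial time if each step is, and if it makes the intermediate
result grow only by a summand that does not depend on that intermediate result. -/
theorem foldl {l : α → List β} {s : α → σ} {f : α → σ → β → σ} (hl : PolyTime l) (hs : PolyTime s)
    (hf : PolyTime fun p : α × σ × β => f p.1 p.2.1 p.2.2)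
    (hb : ∃ B, PolyBdd B ∧ ∀ a u b, sz (f a u b) ≤ sz u + B (sz (a, b))) :
    PolyTime fun a => (l a).foldl (f a) (s a) := by
  obtain ⟨p, i, hp⟩ := hl.exists_pow
  obtain ⟨q, j, hq⟩ := hs.exists_pow
  obtain ⟨r, k, hr⟩ := hf.exists_pow
  obtain ⟨B, ⟨e, hB⟩, hb⟩ := hb
  have he : ∀ a u b, sz (f a u b) ≤ sz u + (sz a + sz b + 3) ^ e := fun a u b => by
    refine (hb a u b).trans (Nat.add_le_add_left ((hB _).trans ?_) _)
    rw [sz_prod]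
    exact Nat.pow_le_pow_left (by dsimp only; omega) e
  have hbL : PolyBdd fun n => (n + 2) ^ i := .pow_add_two i
  have hbS : PolyBdd fun n => (n + 2) ^ j := .pow_add_two j
  have hbW : PolyBdd fun n => (n + 2) ^ j + (n + 2) ^ i * (n + (n + 2) ^ i + 3) ^ e :=
    hbS.add (hbL.mul (((PolyBdd.id.add hbL).add (.const 3)).pow e))
  set W : ℕ → ℕ := fun n => (n + 2) ^ j + (n + 2) ^ i * (n + (n + 2) ^ i + 3) ^ e with hW
  have hbT : PolyBdd fun n => (n + W n + (n + 2) ^ i + 4) ^ k :=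
    (((PolyBdd.id.add hbW).add hbL).add (.const 4)).pow k
  set T : ℕ → ℕ := fun n => (n + W n + (n + 2) ^ i + 4) ^ k with hT
  refine ⟨.seq (.pair .id (.pair p q)) (.seq (foldLoop r) (.seq .snd .snd)),
    fun n => (n + n + (n + (n + 2) ^ i + (n + 2) ^ j)) +
      (((n + 2) ^ i + 1) * (T n + 30 * (n + (n + 2) ^ i + W n + 3)) +
      2 * (n + W n + 3)), ?_, fun a => ?_⟩
  · exact ((PolyBdd.id.add .id).add ((PolyBdd.id.add hbL).add hbS)).add
      ((((hbL.add (.const 1)).mul (hbT.add ((PolyBdd.const 30).mul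
        (((PolyBdd.id.add hbL).add hbW).add (.const 3)))))).add
        ((PolyBdd.const 2).mul ((PolyBdd.id.add hbW).add (.const 3))))
  · obtain ⟨t₁, h1, h1'⟩ := hp a
    obtain ⟨t₂, h2, h2'⟩ := hq a
    have hsL : sz (l a) ≤ (sz a + 2) ^ i := h1.size_le.trans h1'
    have hsS : sz (s a) ≤ (sz a + 2) ^ j := h2.size_le.trans h2'
    have hlen : (l a).length ≤ (sz a + 2) ^ i := (length_lt_sz _).le.trans hsL
    have hWb : ∀ l₁ l₂, l a = l₁ ++ l₂ → sz (l₁.foldl (f a) (s a)) ≤ W (sz a) := by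
      intro l₁ l₂ h
      refine (sz_foldl_le (K := (sz a + (sz a + 2) ^ i + 3) ^ e) _ _ fun u b hb' => ?_).trans ?_
      · refine (he a u b).trans (Nat.add_le_add_left (Nat.pow_le_pow_left ?_ e) _)
        have : sz b ≤ sz (l a) := sz_le_of_mem (by rw [h]; exact List.mem_append_left _ hb')
        omega
      · refine Nat.add_le_add hsS (Nat.mul_le_mul_right _ (le_trans ?_ hlen))
        rw [h, List.length_append]
        omega
    obtain ⟨t₃, h3, h3'⟩ := foldLoop_runs (f := f a) (step := r) (x := enc a) (T := T (sz a))
      (W := W (sz a)) (l a) (s a) (fun l₁ b l₂ h => by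
        obtain ⟨t, ht, ht'⟩ := hr (a, l₁.foldl (f a) (s a), b)
        refine ⟨t, ht'.trans (Nat.pow_le_pow_left ?_ k), by rw [List.foldl_append]; exact ht⟩
        have h4 := hWb l₁ _ h
        have h5 : sz b ≤ sz (l a) := sz_le_of_mem (by rw [h]; simp)
        simp only [sz_prod]
        omega) hWb
    refine ⟨_, .seq (.pair (.id _) (.pair h1 h2)) (.seq h3' (.seq (.snd _) (.snd _))), ?_⟩
    have h6 := hWb (l a) [] (by simp)
    have h7 : ((l a).length + 1) * (T (sz a) + 30 * (sz a + sz (l a) + W (sz a) + 3)) ≤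
        ((sz a + 2) ^ i + 1) * (T (sz a) + 30 * (sz a + (sz a + 2) ^ i + W (sz a) + 3)) :=
      Nat.mul_le_mul (by omega) (by omega)
    simp only [BinTree.size, BinTree.snd]
    have h8 : (enc a).size = sz a := rfl
    have h9 : (enc ((l a).foldl (f a) (s a))).size = sz ((l a).foldl (f a) (s a)) := rfl
    rw [h8] at h3 ⊢
    rw [h9]
    omega

end PolyTime

/-! ### Basic polynomial-time functions -/

namespace PolyTime

variable {α β γ σ : Type} [Enc α] [Enc β] [Enc γ] [Enc σ]

@[fun_prop]
theorem cons {f : α → β} {g : α → List β} (hf : PolyTime f) (hg : PolyTime g) :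
    PolyTime fun a => f a :: g a :=
  comp (g := fun p : β × List β => p.1 :: p.2) (of_enc_eq fun _ => rfl) (prodMk hf hg)

@[fun_prop]
theorem tail {f : α → List β} (hf : PolyTime f) : PolyTime fun a => (f a).tail :=
  comp (g := List.tail) ⟨.snd, _, .id, fun l => ⟨_, by
    have : enc l.tail = (enc l).snd := by cases l <;> rfl
    rw [this]
    exact .snd _, le_rfl⟩⟩ hf

@[fun_prop]
theorem treeCons {f g : α → BinTree} (hf : PolyTime f) (hg : PolyTime g) :
    PolyTime fun a => BinTree.cons (f a) (g a) :=
  comp (g := fun p : BinTree × BinTree => BinTree.cons p.1 p.2) (of_enc_eq fun _ => rfl)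
    (prodMk hf hg)

@[fun_prop]
theorem treeFst {f : α → BinTree} (hf : PolyTime f) : PolyTime fun a => (f a).fst :=
  comp (g := BinTree.fst) ⟨.fst, _, .id, fun _ => ⟨_, .fst _, le_rfl⟩⟩ hf

@[fun_prop]
theorem treeSnd {f : α → BinTree} (hf : PolyTime f) : PolyTime fun a => (f a).snd :=
  comp (g := BinTree.snd) ⟨.snd, _, .id, fun _ => ⟨_, .snd _, le_rfl⟩⟩ hf

end PolyTime

/-- Whether a tree is not a leaf. -/
def BinTree.isCons : BinTree → Bool
  | .nil => false
  | .cons _ _ => true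

/-- The entries of a tree that is read as a list. -/
def BinTree.toList : BinTree → List BinTree
  | .nil => []
  | .cons a b => a :: b.toList

theorem toList_encodeList (l : List BinTree) : (encodeList l).toList = l := by
  induction l with
  | nil => rfl
  | cons a l ih => rw [encodeList, BinTree.toList, ih]

theorem encodeList_toList (t : BinTree) : encodeList t.toList = t := by
  induction t with
  | nil => rfl
  | cons a b _ ih => rw [BinTree.toList, encodeList, ih]

namespace PolyTime

variable {α β γ σ : Type} [Enc α] [Enc β] [Enc γ] [Enc σ]

@[fun_prop]
theorem isCons {f : α → BinTree} (hf : PolyTime f) : PolyTime fun a => (f a).isCons := by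
  refine comp (g := BinTree.isCons) ?_ hf
  have ht : PolyTime fun _ : BinTree => true := const true
  obtain ⟨p, B, hB, hp⟩ := ht
  refine ⟨.cond .id p .nil, fun n => 3 * n + B n, (PolyBdd.linear 3).add hB, fun t => ?_⟩
  obtain ⟨u, h1, h2⟩ := hp t
  cases t with
  | nil =>
    refine ⟨_, .cond_false (.id _) (.nil _), ?_⟩
    change 1 + 1 + 1 ≤ 3 * 1 + _
    omega
  | cons a b =>
    refine ⟨_, .cond_true (.id (.cons a b)) (fun h => BinTree.noConfusion h) h1, ?_⟩
    change BinTree.size (.cons a b) + BinTree.size (.cons a b) + u ≤ 3 * sz (BinTree.cons a b) + _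
    have : sz (BinTree.cons a b) = (BinTree.cons a b).size := rfl
    omega

@[fun_prop]
theorem toList {f : α → BinTree} (hf : PolyTime f) : PolyTime fun a => (f a).toList :=
  comp (g := BinTree.toList) (of_enc_eq fun t => by
    have : t.toList.map enc = t.toList := List.map_id _
    change encodeList (t.toList.map enc) = t
    rw [this, encodeList_toList]) hf

@[fun_prop]
theorem encodeList {f : α → List BinTree} (hf : PolyTime f) :
    PolyTime fun a => encodeList (f a) :=
  comp (g := PresburgerSynthesis.encodeList) (of_enc_eq fun l => by
    have : l.map enc = l := List.map_id _
    change _ = PresburgerSynthesis.encodeList (l.map enc)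
    rw [this]; rfl) hf

@[fun_prop]
theorem not {f : α → Bool} (hf : PolyTime f) : PolyTime fun a => !f a := by
  have h : PolyTime fun a => bif f a then false else true := by fun_prop
  have e : ∀ b : Bool, (!b) = bif b then false else true := by decide
  simpa only [e] using h

@[fun_prop]
theorem and {f g : α → Bool} (hf : PolyTime f) (hg : PolyTime g) :
    PolyTime fun a => f a && g a := by
  have h : PolyTime fun a => bif f a then g a else false := by fun_prop
  have e : ∀ b c : Bool, (b && c) = bif b then c else false := by decide
  simpa only [e] using h

@[fun_prop]
theorem reverse {l : α → List β} (hl : PolyTime l) : PolyTime fun a => (l a).reverse := by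
  have h : PolyTime fun a => (l a).foldl (fun s b => b :: s) [] :=
    foldl (f := fun _ s b => b :: s) hl (const []) (by fun_prop)
      ⟨_, .linear 1, fun a u b => by rw [sz_cons, sz_prod]; dsimp only; omega⟩
  have e : ∀ (l s : List β), l.foldl (fun s b => b :: s) s = l.reverse ++ s := fun l => by
    induction l with
    | nil => simp
    | cons b l ih => intro s; simp [ih]
  simpa only [e, List.append_nil] using h

/-- Right folds, under the same condition as left folds. -/
theorem foldr {l : α → List β} {s : α → σ} {f : α → β → σ → σ} (hl : PolyTime l) (hs : PolyTime s)
    (hf : PolyTime fun p : α × σ × β => f p.1 p.2.2 p.2.1)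
    (hb : ∃ B, PolyBdd B ∧ ∀ a u b, sz (f a b u) ≤ sz u + B (sz (a, b))) :
    PolyTime fun a => (l a).foldr (f a) (s a) := by
  have h := foldl (f := fun a u b => f a b u) (reverse hl) hs hf hb
  simpa only [List.foldl_reverse] using h

@[fun_prop]
theorem append {f g : α → List β} (hf : PolyTime f) (hg : PolyTime g) :
    PolyTime fun a => f a ++ g a := by
  have h : PolyTime fun a => (f a).foldr (fun b s => b :: s) (g a) :=
    foldr (f := fun _ b s => b :: s) hf hg (by fun_prop)
      ⟨_, .linear 1, fun a u b => by rw [sz_cons, sz_prod]; dsimp only; omega⟩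
  simpa using h

@[fun_prop]
theorem map {l : α → List β} {f : α → β → γ} (hl : PolyTime l)
    (hf : PolyTime fun p : α × β => f p.1 p.2) : PolyTime fun a => (l a).map (f a) := by
  obtain ⟨B, hB, hb⟩ := hf.sz_le
  have h : PolyTime fun a => (l a).foldr (fun b s => f a b :: s) [] :=
    foldr (f := fun a b s => f a b :: s) hl (const [])
      (cons (comp (g := fun p : α × β => f p.1 p.2) (f := fun p : α × List γ × β => (p.1, p.2.2)) hf
        (by fun_prop)) (by fun_prop)) ⟨_, hB.add (.const 1), fun a u b => by
        have h1 := hb (a, b)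
        rw [sz_cons]
        dsimp only at h1 ⊢
        omega⟩
  simpa only [← List.map_eq_foldr] using h

@[fun_prop]
theorem headD {l : α → List β} {d : α → β} (hl : PolyTime l) (hd : PolyTime d) :
    PolyTime fun a => (l a).headD (d a) := by
  have h : PolyTime fun a => (l a).foldr (fun b _ => b) (d a) :=
    foldr (f := fun _ b _ => b) hl hd (by fun_prop)
      ⟨_, .linear 1, fun a u b => by rw [sz_prod]; dsimp only; omega⟩
  have e : ∀ a, (l a).headD (d a) = (l a).foldr (fun b _ => b) (d a) := fun a => by
    cases l a <;> rfl
  simpa only [e] using h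

/-! ### Arithmetic in unary -/

/-- Iterates of functions that increase the size by a bounded amount only. -/
theorem iterate {n : α → ℕ} {s : α → σ} {f : α → σ → σ} (hn : PolyTime n) (hs : PolyTime s)
    (hf : PolyTime fun p : α × σ => f p.1 p.2)
    (hb : ∃ B, PolyBdd B ∧ ∀ a u, sz (f a u) ≤ sz u + B (sz a)) :
    PolyTime fun a => (f a)^[n a] (s a) := by
  obtain ⟨B, ⟨k, hB⟩, hb⟩ := hb
  have hl : PolyTime fun a => List.replicate (n a) () :=
    comp (g := fun n => List.replicate n ()) (of_enc_eq fun n => by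
      change PresburgerSynthesis.encodeList ((List.replicate n ()).map enc) =
        PresburgerSynthesis.encodeList (List.replicate n .nil)
      rw [List.map_replicate]; rfl) hn
  have h := foldl (f := fun a u (_ : Unit) => f a u) hl hs
    (comp (g := fun p : α × σ => f p.1 p.2) (f := fun p : α × σ × Unit => (p.1, p.2.1)) hf
      (by fun_prop)) ⟨_, .pow_add_two k, fun a u b => (hb a u).trans (Nat.add_le_add_left
        ((hB _).trans (Nat.pow_le_pow_left (by rw [sz_prod]; dsimp only; omega) k)) _)⟩
  have e : ∀ (g : σ → σ) (n : ℕ) (u : σ), (List.replicate n ()).foldl (fun u _ => g u) u = g^[n] u :=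
    fun g n => by
      induction n with
      | zero => intro u; rfl
      | succ n ih => intro u; rw [List.replicate_succ, List.foldl_cons, ih, Function.iterate_succ_apply]
  simpa only [e] using h

@[fun_prop]
theorem natSucc {f : α → ℕ} (hf : PolyTime f) : PolyTime fun a => (f a).succ :=
  comp (g := fun p : Unit × ℕ => p.2.succ) (of_enc_eq fun _ => rfl) (prodMk (const ()) hf)

@[fun_prop]
theorem natPred {f : α → ℕ} (hf : PolyTime f) : PolyTime fun a => (f a).pred :=
  comp (g := Nat.pred) ⟨.snd, _, .id, fun n => ⟨_, by
    have : enc n.pred = (enc n).snd := by cases n <;> rfl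
    rw [this]
    exact .snd _, le_rfl⟩⟩ hf

@[fun_prop]
theorem natAdd {f g : α → ℕ} (hf : PolyTime f) (hg : PolyTime g) :
    PolyTime fun a => f a + g a := by
  have h := iterate (f := fun _ => Nat.succ) hg hf (by fun_prop)
    ⟨_, .const 2, fun a u => by rw [sz_nat, sz_nat]; omega⟩
  simpa only [Nat.succ_iterate] using h

@[fun_prop]
theorem natSub {f g : α → ℕ} (hf : PolyTime f) (hg : PolyTime g) :
    PolyTime fun a => f a - g a := by
  have h := iterate (f := fun _ => Nat.pred) hg hf (by fun_prop)
    ⟨_, .const 2, fun a u => by rw [sz_nat, sz_nat, Nat.pred_eq_sub_one]; omega⟩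
  simpa only [Nat.pred_iterate] using h

@[fun_prop]
theorem natMul {f g : α → ℕ} (hf : PolyTime f) (hg : PolyTime g) :
    PolyTime fun a => f a * g a := by
  obtain ⟨B, hB, hb⟩ := hg.sz_le
  have h := iterate (f := fun a x => x + g a) hf (const 0) (by fun_prop)
    ⟨_, hB, fun a u => by
      have := hb a
      rw [sz_nat] at this ⊢
      rw [sz_nat]
      omega⟩
  simpa only [add_right_iterate, zero_add, smul_eq_mul] using h

theorem natIsZero {f : α → ℕ} (hf : PolyTime f) : PolyTime fun a => decide (f a = 0) := by
  have h : PolyTime fun a => !(encodeUnary (f a)).isCons :=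
    not (isCons (comp (g := encodeUnary) (of_enc_eq fun _ => rfl) hf))
  have e : ∀ n, decide (n = 0) = !(encodeUnary n).isCons := fun n => by cases n <;> rfl
  simpa only [e] using h

@[fun_prop]
theorem natLe {f g : α → ℕ} (hf : PolyTime f) (hg : PolyTime g) :
    PolyTime fun a => decide (f a ≤ g a) := by
  have h := natIsZero (natSub hf hg)
  simpa only [Nat.sub_eq_zero_iff_le] using h

@[fun_prop]
theorem natEq {f g : α → ℕ} (hf : PolyTime f) (hg : PolyTime g) :
    PolyTime fun a => decide (f a = g a) := by
  have h : PolyTime fun a => decide (f a ≤ g a) && decide (g a ≤ f a) := by fun_prop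
  simpa only [← Bool.decide_and, ← Nat.le_antisymm_iff] using h

@[fun_prop]
theorem natMin {f g : α → ℕ} (hf : PolyTime f) (hg : PolyTime g) :
    PolyTime fun a => min (f a) (g a) := by
  have h : PolyTime fun a => bif decide (f a ≤ g a) then f a else g a := by fun_prop
  have e : ∀ m n : ℕ, min m n = bif decide (m ≤ n) then m else n := fun m n => by
    rw [Bool.cond_decide, min_def]
  simpa only [e] using h

/-- One step of counting up while keeping track of quotient and remainder modulo `b`. -/
def divModStep (b : ℕ) (p : ℕ × ℕ) : ℕ × ℕ :=
  bif decide (p.2 + 1 = b) then (p.1 + 1, 0) else (p.1, p.2 + 1)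

theorem iterate_divModStep (b n : ℕ) : (divModStep b)^[n] (0, 0) = (n / b, n % b) := by
  induction n with
  | zero => simp
  | succ n ih =>
    rw [Function.iterate_succ_apply', ih, divModStep, Bool.cond_decide]
    dsimp only
    rcases Nat.eq_zero_or_pos b with rfl | hb
    · simp
    · have h1 := Nat.div_add_mod n b
      have h2 := Nat.mod_lt n hb
      split_ifs with h
      · have : (n + 1) / b = n / b + 1 ∧ (n + 1) % b = 0 :=
          (Nat.div_mod_unique hb).2 ⟨by rw [Nat.mul_add]; omega, hb⟩
        rw [this.1, this.2]
      · have : (n + 1) / b = n / b ∧ (n + 1) % b = n % b + 1 :=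
          (Nat.div_mod_unique hb).2 ⟨by omega, by omega⟩
        rw [this.1, this.2]

theorem natDivMod {f g : α → ℕ} (hf : PolyTime f) (hg : PolyTime g) :
    PolyTime fun a => (f a / g a, f a % g a) := by
  have h : PolyTime fun a => (divModStep (g a))^[f a] (0, 0) := by
    refine iterate (f := fun a => divModStep (g a)) hf (by fun_prop) ?_
      ⟨_, .const 4, fun a u => ?_⟩
    · unfold divModStep
      fun_prop
    · rw [divModStep, Bool.cond_decide]
      split_ifs <;> simp only [sz_prod, sz_nat] <;> omega
  simpa only [iterate_divModStep] using h

@[fun_prop]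
theorem natDiv {f g : α → ℕ} (hf : PolyTime f) (hg : PolyTime g) :
    PolyTime fun a => f a / g a := (natDivMod hf hg).fst

@[fun_prop]
theorem natMod {f g : α → ℕ} (hf : PolyTime f) (hg : PolyTime g) :
    PolyTime fun a => f a % g a := (natDivMod hf hg).snd

@[fun_prop]
theorem natPair {f g : α → ℕ} (hf : PolyTime f) (hg : PolyTime g) :
    PolyTime fun a => Nat.pair (f a) (g a) := by
  have h : PolyTime fun a =>
      bif decide (f a < g a) then g a * g a + f a else f a * f a + f a + g a := by fun_prop
  simpa only [Bool.cond_decide, ← Nat.pair.eq_1] using h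

@[fun_prop]
theorem range {f : α → ℕ} (hf : PolyTime f) : PolyTime fun a => List.range (f a) := by
  -- The counter never exceeds the bound `f a`; the minimum makes this visible.
  have h : PolyTime fun a =>
      ((fun p : ℕ × List ℕ => (p.1 + 1, min p.1 (f a) :: p.2))^[f a] (0, [])).2.reverse := by
    refine reverse (snd (iterate (f := fun a (p : ℕ × List ℕ) => (p.1 + 1, min p.1 (f a) :: p.2))
      hf (by fun_prop) (by fun_prop) ?_))
    obtain ⟨B, hB, hb⟩ := hf.sz_le
    refine ⟨_, hB.add (.const 3), fun a u => ?_⟩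
    have := hb a
    simp only [sz_prod, sz_nat, sz_cons] at this ⊢
    omega
  have e : ∀ n j, j ≤ n → (fun p : ℕ × List ℕ => (p.1 + 1, min p.1 n :: p.2))^[j] (0, []) =
      (j, (List.range j).reverse) := fun n j => by
    induction j with
    | zero => intro; rfl
    | succ j ih =>
      intro hj
      rw [Function.iterate_succ_apply', ih (by omega), List.range_succ, List.reverse_append]
      simp only [List.reverse_singleton, List.singleton_append]
      rw [min_eq_left (by omega)]
  simpa only [fun n => e n n le_rfl, List.reverse_reverse] using h

@[fun_prop]
theorem getD {l : α → List β} {i : α → ℕ} {d : α → β} (hl : PolyTime l) (hi : PolyTime i)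
    (hd : PolyTime d) : PolyTime fun a => (l a).getD (i a) (d a) := by
  have h1 : PolyTime fun a => List.tail^[i a] (l a) :=
    iterate (f := fun _ => List.tail) hi hl (by fun_prop) ⟨_, .const 0, fun a u => by
      cases u with
      | nil => exact le_rfl
      | cons b u => rw [sz_cons, List.tail_cons]; omega⟩
  have h : PolyTime fun a => (List.tail^[i a] (l a)).headD (d a) := by fun_prop
  have e : ∀ (l : List β) i d, l.getD i d = (List.tail^[i] l).headD d := fun l i d => by
    rw [List.tail_iterate, List.headD_eq_getD]
    simp [List.getD]
  simpa only [e] using h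

/-! ### Integers -/

@[fun_prop]
theorem natCast {f : α → ℕ} (hf : PolyTime f) : PolyTime fun a => (f a : ℤ) :=
  congr_enc (f := fun a => (f a, 0)) (by fun_prop) fun a => by
    change BinTree.cons _ _ = BinTree.cons _ _
    rw [Int.toNat_natCast, Int.toNat_neg_natCast]
    rfl

@[fun_prop]
theorem intToNat {f : α → ℤ} (hf : PolyTime f) : PolyTime fun a => (f a).toNat :=
  fst (f := fun a => ((f a).toNat, (-f a).toNat)) (congr_enc hf fun _ => rfl)

theorem intNegToNat {f : α → ℤ} (hf : PolyTime f) : PolyTime fun a => (-f a).toNat :=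
  snd (f := fun a => ((f a).toNat, (-f a).toNat)) (congr_enc hf fun _ => rfl)

theorem natCastSub {f g : α → ℕ} (hf : PolyTime f) (hg : PolyTime g) :
    PolyTime fun a => (f a : ℤ) - (g a : ℤ) :=
  congr_enc (f := fun a => (f a - g a, g a - f a)) (by fun_prop) fun a => by
    change BinTree.cons (encodeUnary _) (encodeUnary _) =
      BinTree.cons (encodeUnary _) (encodeUnary _)
    congr 2 <;> omega

@[fun_prop]
theorem intNatAbs {f : α → ℤ} (hf : PolyTime f) : PolyTime fun a => (f a).natAbs := by
  have h := natAdd (intToNat hf) (intNegToNat hf)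
  have e : ∀ z : ℤ, z.toNat + (-z).toNat = z.natAbs := fun z => by omega
  simpa only [e] using h

@[fun_prop]
theorem intNeg {f : α → ℤ} (hf : PolyTime f) : PolyTime fun a => -f a := by
  have h := natCastSub (intNegToNat hf) (intToNat hf)
  have e : ∀ z : ℤ, ((-z).toNat : ℤ) - (z.toNat : ℤ) = -z := fun z => by omega
  simpa only [e] using h

@[fun_prop]
theorem intAdd {f g : α → ℤ} (hf : PolyTime f) (hg : PolyTime g) :
    PolyTime fun a => f a + g a := by
  have h := natCastSub (natAdd (intToNat hf) (intToNat hg))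
    (natAdd (intNegToNat hf) (intNegToNat hg))
  have e : ∀ z w : ℤ, ((z.toNat + w.toNat : ℕ) : ℤ) - (((-z).toNat + (-w).toNat : ℕ) : ℤ) = z + w :=
    fun z w => by omega
  simpa only [e] using h

@[fun_prop]
theorem intSub {f g : α → ℤ} (hf : PolyTime f) (hg : PolyTime g) :
    PolyTime fun a => f a - g a := by
  simpa only [sub_eq_add_neg] using intAdd hf (intNeg hg)

@[fun_prop]
theorem intMul {f g : α → ℤ} (hf : PolyTime f) (hg : PolyTime g) :
    PolyTime fun a => f a * g a := by
  have h := natCastSub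
    (natAdd (natMul (intToNat hf) (intToNat hg)) (natMul (intNegToNat hf) (intNegToNat hg)))
    (natAdd (natMul (intToNat hf) (intNegToNat hg)) (natMul (intNegToNat hf) (intToNat hg)))
  have e : ∀ z w : ℤ, ((z.toNat * w.toNat + (-z).toNat * (-w).toNat : ℕ) : ℤ) -
      ((z.toNat * (-w).toNat + (-z).toNat * w.toNat : ℕ) : ℤ) = z * w := fun z w => by
    have h1 : z = z.toNat - (-z).toNat := by omega
    have h2 : w = w.toNat - (-w).toNat := by omega
    conv_rhs => rw [h1, h2]
    push_cast
    ring
  simpa only [e] using h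

@[fun_prop]
theorem intSum {l : α → List ℤ} (hl : PolyTime l) : PolyTime fun a => (l a).sum := by
  have h : PolyTime fun a => (l a).foldr (fun z s => z + s) 0 :=
    foldr (f := fun _ z s => z + s) hl (const 0) (by fun_prop)
      ⟨_, .id, fun a u b => by
        simp only [sz_int, sz_prod]
        have := Int.natAbs_add_le b u
        omega⟩
  exact h

/-! ### Conversion between unary and binary -/

@[fun_prop]
theorem natBits {f : α → ℕ} (hf : PolyTime f) : PolyTime fun a => (f a).bits := by
  let step : ℕ × List Bool → ℕ × List Bool := fun p =>
    bif decide (p.1 = 0) then p else (p.1 / 2, decide (p.1 % 2 = 1) :: p.2)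
  have h : PolyTime fun a => (step^[f a] (f a, [])).2.reverse := by
    refine reverse (snd (iterate (f := fun _ => step) hf (by fun_prop)
      (by dsimp only [step]; fun_prop) ⟨_, .const 4, fun a u => ?_⟩))
    dsimp only [step]
    rw [Bool.cond_decide]
    split_ifs
    · omega
    · have := sz_bool_le (decide (u.1 % 2 = 1))
      simp only [sz_prod, sz_nat, sz_cons]
      omega
  have e : ∀ j n l, n ≤ j → step^[j] (n, l) = (0, n.bits.reverse ++ l) := fun j => by
    induction j with
    | zero =>
      intro n l hn
      obtain rfl : n = 0 := by omega
      simp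
    | succ j ih =>
      intro n l hn
      rw [Function.iterate_succ_apply]
      dsimp only [step]
      rw [Bool.cond_decide]
      split_ifs with h0
      · subst h0
        rw [ih 0 l (by omega)]
      · rw [ih _ _ (by omega)]
        have h1 : n.bits = decide (n % 2 = 1) :: (n / 2).bits := by
          have h2 : Nat.bit (decide (n % 2 = 1)) (n / 2) = n := by
            rw [Nat.bit_val]
            rcases Nat.mod_two_eq_zero_or_one n with h | h <;> simp [h] <;> omega
          conv_lhs => rw [← h2]
          refine Nat.bits_append_bit _ _ fun h3 => ?_
          simp only [decide_eq_true_eq]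
          omega
        rw [h1]
        simp
  simpa only [fun n => e n n [] le_rfl, List.append_nil, List.reverse_reverse] using h

@[fun_prop]
theorem encodeBool {f : α → Bool} (hf : PolyTime f) : PolyTime fun a => encodeBool (f a) :=
  congr_enc hf fun _ => rfl

@[fun_prop]
theorem encodeNat {f : α → ℕ} (hf : PolyTime f) : PolyTime fun a => encodeNat (f a) :=
  congr_enc (natBits hf) fun _ => rfl

@[fun_prop]
theorem encodeInt {f : α → ℤ} (hf : PolyTime f) : PolyTime fun a => encodeInt (f a) := by
  have h : PolyTime fun a => BinTree.cons
      (PresburgerSynthesis.encodeBool (decide (0 < (-f a).toNat)))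
      (PresburgerSynthesis.encodeNat (f a).natAbs) := by
    fun_prop
  have e : ∀ z : ℤ, decide (0 < (-z).toNat) = decide (z < 0) := fun z =>
    decide_eq_decide.2 (by omega)
  simp only [e] at h
  exact h

end PolyTime

/-- The number with binary digits `l`, least significant digit first, capped at `R`. -/
def ofBitsCapped (R : ℕ) (l : List BinTree) : ℕ :=
  l.foldr (fun b s => min R (2 * s + bif b.isCons then 1 else 0)) 0

theorem ofBitsCapped_bits {R n : ℕ} (h : n ≤ R) :
    ofBitsCapped R (n.bits.map encodeBool) = n := by
  induction n using Nat.binaryRec' with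
  | zero => simp [ofBitsCapped]
  | bit b n hn ih =>
    rw [Nat.bits_append_bit n b hn]
    have h1 : Nat.bit b n = 2 * n + b.toNat := Nat.bit_val b n
    have h2 : (bif (encodeBool b).isCons then 1 else 0) = b.toNat := by cases b <;> rfl
    have h3 : ofBitsCapped R ((b :: n.bits).map encodeBool) =
        min R (2 * ofBitsCapped R (n.bits.map encodeBool) + b.toNat) := by rw [← h2]; rfl
    rw [h3, ih (by omega), min_eq_right (by omega), h1]

@[fun_prop]
theorem PolyTime.ofBitsCapped {α : Type} [Enc α] {R : α → ℕ} {l : α → List BinTree}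
    (hR : PolyTime R) (hl : PolyTime l) : PolyTime fun a => ofBitsCapped (R a) (l a) := by
  obtain ⟨B, ⟨k, hB⟩, hb⟩ := hR.sz_le
  refine foldr (f := fun a b s => min (R a) (2 * s + bif b.isCons then 1 else 0)) hl (const 0)
    (by fun_prop) ⟨_, .pow_add_two k, fun a u b => ?_⟩
  have h1 := hb a
  have h2 : B (sz a) ≤ (sz (a, b) + 2) ^ k :=
    (hB _).trans (Nat.pow_le_pow_left (by rw [sz_prod]; dsimp only; omega) k)
  rw [sz_nat] at h1 ⊢
  omega

/-! ### Parameters of building blocks -/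

/-- Parameters of building blocks: positive integers `N` and `D`, residues `r v` modulo `M = D * N`,
and integers `a i v w`, `c i v`. They describe the affine maps whose entry at position `v` is
`r v + N * c i v + ∑ w, a i v w * (x w - r w) / D`. On integer points that are congruent to `r`
modulo `M`, such an entry is an integer congruent to `r v` modulo `N`, whatever the parameters. -/
structure Choice : Type where
  N : ℕ
  D : ℕ
  N_pos : 0 < N
  D_pos : 0 < D
  r : ℕ → ℕ
  r_lt : ∀ v, r v < D * N
  a : ℕ → ℕ → ℕ → ℤ
  c : ℕ → ℕ → ℤ

namespace Choice

variable (P : Choice) (n m : ℕ)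

def M : ℕ := P.D * P.N

theorem M_pos : 0 < P.M := Nat.mul_pos P.D_pos P.N_pos

/-- `M` times the coefficient of the variable `w` in the entry of `(x^i, A_i(x^i))` at `v`. -/
def coef (i v w : ℕ) : ℤ :=
  if v < n + i then (if v = w then (P.M : ℤ) else 0)
  else if w < n + i then P.N * P.a i v w else 0

/-- `M` times the constant term of the entry of `(x^i, A_i(x^i))` at `v`. -/
def cst (i v : ℕ) : ℤ :=
  if v < n + i then 0
  else P.N * (P.D * (P.r v + P.N * P.c i v) -
    ((List.range (n + i)).map fun w => P.a i v w * P.r w).sum)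

/-- The truth value of a modulo constraint at the residues. -/
def congHolds (k : ℕ) (a : List ℤ) (r N : ℕ) : Bool :=
  decide ((((List.range k).map fun v => a.getD v 0 * P.r v).sum - r).natAbs % N = 0)

end Choice

/-- The parameter with key `(kind, i, v, w)` of the family with number `e.2`: a digit of this number
in base `e.1`. -/
def digit (e : ℕ × ℕ) (kind i v w : ℕ) : ℕ :=
  (fun s => s / e.1)^[Nat.pair (Nat.pair kind i) (Nat.pair v w)] e.2 % e.1

/-- The parameters that are described by the digits of `e.2` in base `e.1`. Integers are
differences of two digits. -/
def Choice.ofIndex (e : ℕ × ℕ) : Choice where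
  N := digit e 0 0 0 0 + 1
  D := digit e 1 0 0 0 + 1
  N_pos := Nat.succ_pos _
  D_pos := Nat.succ_pos _
  r v := digit e 2 0 v 0 % ((digit e 1 0 0 0 + 1) * (digit e 0 0 0 0 + 1))
  r_lt _ := Nat.mod_lt _ (Nat.mul_pos (Nat.succ_pos _) (Nat.succ_pos _))
  a i v w := (digit e 3 i v w : ℤ) - digit e 4 i v w
  c i v := (digit e 5 i v 0 : ℤ) - digit e 6 i v 0

/-! ### The conversion on trees -/

/-- Decodes an integer whose absolute value is at most `R`. -/
def intOfTree (R : ℕ) (t : BinTree) : ℤ :=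
  if t.fst.isCons then -(ofBitsCapped R t.snd.toList : ℤ) else (ofBitsCapped R t.snd.toList : ℤ)

/-- The tree of the literal `∑ v, a v * z v + b ≥ 0`. -/
def geTree (a : List ℤ) (b : ℤ) : BinTree :=
  .cons .nil (.cons .nil (.cons (encodeList (a.map encodeInt)) (encodeInt b)))

/-- The tree of the literal `∑ v, a v * z v ≡ r (mod N)`. -/
def congTree (a : List ℤ) (r N : ℕ) : BinTree :=
  .cons .nil (.cons (.cons .nil .nil)
    (.cons (encodeList (a.map encodeInt)) (.cons (encodeNat r) (encodeNat N))))

def andTree (s t : BinTree) : BinTree := .cons (.cons .nil .nil) (.cons s t)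

def orTree (s t : BinTree) : BinTree := .cons (.cons .nil (.cons .nil .nil)) (.cons s t)

/-- Joins the trees in a list by a binary operation, associating to the right. -/
def joinTree (f : BinTree → BinTree → BinTree) (l : List BinTree) : BinTree :=
  l.reverse.tail.foldl (fun s t => f t s) (l.reverse.headD .nil)

namespace Choice

variable (P : Choice) (n m : ℕ)

/-- The inequality that replaces a literal, as a pair of coefficients and constant term.
Inequalities stay; modulo constraints become true or false, according to their truth value at the
residues, and count as false if their modulus does not divide `N`. -/
def normLit (R k : ℕ) (t : BinTree) : List ℤ × ℤ :=
  if t.fst.isCons then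
    (if (decide (P.N % ofBitsCapped R t.snd.snd.snd.toList = 0) &&
        bif t.fst.snd.isCons then
          !P.congHolds k (t.snd.fst.toList.map (intOfTree R))
            (ofBitsCapped R t.snd.snd.fst.toList) (ofBitsCapped R t.snd.snd.snd.toList)
        else P.congHolds k (t.snd.fst.toList.map (intOfTree R))
            (ofBitsCapped R t.snd.snd.fst.toList) (ofBitsCapped R t.snd.snd.snd.toList)) then
      ([], 0) else ([], -1))
  else (t.snd.fst.toList.map (intOfTree R), intOfTree R t.snd.snd)

/-- The tree of `BlockData.graph`. -/
def graphTree (i : ℕ) : BinTree :=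
  joinTree andTree
    (((List.range (m - i)).map fun j => geTree
        ((List.range (n + m)).map fun w =>
          (if w = n + i + j then (P.M : ℤ) else 0) - P.coef n i (n + i + j) w)
        (-P.cst n i (n + i + j))) ++
      ((List.range (m - i)).map fun j => geTree
        ((List.range (n + m)).map fun w =>
          P.coef n i (n + i + j) w - (if w = n + i + j then (P.M : ℤ) else 0))
        (P.cst n i (n + i + j))))

/-- The tree of `BlockData.subst`, for an inequality with coefficients `l.1` and constant `l.2`. -/
def substTree (l : List ℤ × ℤ) (i : ℕ) : BinTree :=
  geTree
    ((List.range (n + m)).map fun w =>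
      ((List.range (n + m)).map fun v => l.1.getD v 0 * P.coef n i v w).sum)
    (P.M * l.2 + ((List.range (n + m)).map fun v => l.1.getD v 0 * P.cst n i v).sum)

/-- The tree of the constraint that fixes the residue of the variable `v`. -/
def residueTree (v : ℕ) : BinTree :=
  congTree ((List.range (n + m)).map fun w => if w = v then 1 else 0) (P.r v) P.M

/-- The tree of `BlockData.block`, for an inequality with coefficients `l.1` and constant `l.2`. -/
def blockTree (l : List ℤ × ℤ) : BinTree :=
  joinTree andTree
    (joinTree orTree (geTree ((List.range (n + m)).map fun v => l.1.getD v 0) l.2 ::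
        (List.range m).map fun i => P.graphTree n m i) ::
      ((List.range m).map (fun i => P.substTree n m l i) ++
        (List.range (n + m)).map fun v => P.residueTree n m v))

end Choice

/-- One step of listing the nodes of a formula in preorder. The state consists of the list of
subformulas that are still to be visited and the list of nodes visited so far, last one first. -/
def visitStep (p : List BinTree × List BinTree) : List BinTree × List BinTree :=
  if (p.1.headD .nil).isCons then
    (if (p.1.headD .nil).fst.isCons then
      ((p.1.headD .nil).snd.fst :: (p.1.headD .nil).snd.snd :: p.1.tail,
        .cons (p.1.headD .nil).fst .nil :: p.2)
    else (p.1.tail, p.1.headD .nil :: p.2))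
  else p

/-- One step of the evaluation of a list of nodes, last one first, on a stack of results. -/
def Choice.evalStep (P : Choice) (n m R : ℕ) (s : List BinTree) (t : BinTree) : List BinTree :=
  if t.fst.isCons then .cons t.fst (.cons (s.headD .nil) (s.tail.headD .nil)) :: s.tail.tail
  else P.blockTree n m (P.normLit R (n + m) t.snd) :: s

/-- Replaces the literals of a formula by building blocks. -/
def Choice.convTree (P : Choice) (n m R : ℕ) (f : BinTree) : BinTree :=
  ((visitStep^[R] ([f], [])).2.foldl (P.evalStep n m R) []).headD .nil

/-- The conversion of a specification `p.1`, given a bound `p.2.1` for all parameters and a number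
`p.2.2` of families of parameters to consider. -/
def specTree (p : BinTree × ℕ × ℕ) : BinTree :=
  joinTree orTree ((List.range p.2.2).map fun j =>
    (Choice.ofIndex (p.2.1, j)).convTree p.1.fst.toList.length p.1.snd.fst.toList.length p.2.2
      p.1.snd.snd)

/-! ### The conversion takes polynomial time -/

namespace PolyTime

variable {α β γ σ : Type} [Enc α] [Enc β] [Enc γ] [Enc σ]

@[fun_prop]
theorem ite {p : α → Prop} [DecidablePred p] {f g : α → β} (hp : PolyTime fun a => decide (p a))
    (hf : PolyTime f) (hg : PolyTime g) : PolyTime fun a => if p a then f a else g a := by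
  simpa only [Bool.cond_decide] using cond hp hf hg

@[fun_prop]
theorem decideEqTrue {f : α → Bool} (hf : PolyTime f) : PolyTime fun a => decide (f a = true) := by
  simpa only [Bool.decide_eq_true] using hf

@[fun_prop]
theorem length {l : α → List β} (hl : PolyTime l) : PolyTime fun a => (l a).length := by
  have h : PolyTime fun a => (l a).foldr (fun _ s => s.succ) 0 :=
    foldr (f := fun _ _ s => s.succ) hl (const 0) (by fun_prop)
      ⟨_, .const 2, fun a u b => by simp only [sz_nat]; omega⟩
  have e : ∀ l : List β, l.length = l.foldr (fun _ s => s.succ) 0 := fun l => by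
    induction l with
    | nil => rfl
    | cons b l ih => rw [List.length_cons, ih]; rfl
  simpa only [e] using h

@[fun_prop]
theorem digit {e : α → ℕ × ℕ} {k i v w : α → ℕ} (he : PolyTime e) (hk : PolyTime k)
    (hi : PolyTime i) (hv : PolyTime v) (hw : PolyTime w) :
    PolyTime fun a => digit (e a) (k a) (i a) (v a) (w a) := by
  have h : PolyTime fun a =>
      (fun s => s / (e a).1)^[Nat.pair (Nat.pair (k a) (i a)) (Nat.pair (v a) (w a))] (e a).2 :=
    iterate (f := fun a s => s / (e a).1) (by fun_prop) (by fun_prop) (by fun_prop)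
      ⟨_, .const 0, fun a u => by
        have := Nat.div_le_self u (e a).1
        simp only [sz_nat]
        omega⟩
  exact natMod h he.fst

variable {e : α → ℕ × ℕ} {n m R i v w : α → ℕ} {l : α → List ℤ × ℤ} {s t : α → BinTree}

@[fun_prop]
theorem choiceN (he : PolyTime e) : PolyTime fun a => (Choice.ofIndex (e a)).N := by
  dsimp only [Choice.ofIndex]; fun_prop

@[fun_prop]
theorem choiceM (he : PolyTime e) : PolyTime fun a => (Choice.ofIndex (e a)).M := by
  dsimp only [Choice.ofIndex, Choice.M]; fun_prop

@[fun_prop]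
theorem choiceR (he : PolyTime e) (hv : PolyTime v) :
    PolyTime fun a => (Choice.ofIndex (e a)).r (v a) := by
  dsimp only [Choice.ofIndex]; fun_prop

@[fun_prop]
theorem choiceCoef (he : PolyTime e) (hn : PolyTime n) (hi : PolyTime i) (hv : PolyTime v)
    (hw : PolyTime w) :
    PolyTime fun a => (Choice.ofIndex (e a)).coef (n a) (i a) (v a) (w a) := by
  unfold Choice.coef
  dsimp only [Choice.ofIndex, Choice.M]; fun_prop

@[fun_prop]
theorem choiceCst (he : PolyTime e) (hn : PolyTime n) (hi : PolyTime i) (hv : PolyTime v) :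
    PolyTime fun a => (Choice.ofIndex (e a)).cst (n a) (i a) (v a) := by
  unfold Choice.cst
  dsimp only [Choice.ofIndex, Choice.M]; fun_prop

@[fun_prop]
theorem congHolds (he : PolyTime e) {k r N : α → ℕ} {l : α → List ℤ} (hk : PolyTime k)
    (hl : PolyTime l) (hr : PolyTime r) (hN : PolyTime N) :
    PolyTime fun a => (Choice.ofIndex (e a)).congHolds (k a) (l a) (r a) (N a) := by
  unfold Choice.congHolds; fun_prop

@[fun_prop]
theorem intOfTree (hR : PolyTime R) (ht : PolyTime t) :
    PolyTime fun a => intOfTree (R a) (t a) := by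
  unfold PresburgerSynthesis.intOfTree; fun_prop

@[fun_prop]
theorem geTree {l : α → List ℤ} {b : α → ℤ} (hl : PolyTime l) (hb : PolyTime b) :
    PolyTime fun a => geTree (l a) (b a) := by
  unfold PresburgerSynthesis.geTree; fun_prop

@[fun_prop]
theorem congTree {l : α → List ℤ} {r N : α → ℕ} (hl : PolyTime l) (hr : PolyTime r)
    (hN : PolyTime N) : PolyTime fun a => congTree (l a) (r a) (N a) := by
  unfold PresburgerSynthesis.congTree; fun_prop

theorem joinTree {l : α → List BinTree} (hl : PolyTime l) (c : BinTree) :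
    PolyTime fun a => joinTree (fun s t => .cons c (.cons s t)) (l a) :=
  foldl (f := fun _ s t => BinTree.cons c (.cons t s)) (tail (reverse hl)) (by fun_prop)
    (by fun_prop) ⟨_, .linear (c.size + 2), fun a u b => by
      change 1 + c.size + (1 + BinTree.size b + BinTree.size u) ≤
        BinTree.size u + (c.size + 2) * (1 + sz a + BinTree.size b)
      nlinarith [Nat.zero_le (c.size * (sz a + BinTree.size b))]⟩

@[fun_prop]
theorem joinAnd {l : α → List BinTree} (hl : PolyTime l) :
    PolyTime fun a => PresburgerSynthesis.joinTree andTree (l a) := joinTree hl _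

@[fun_prop]
theorem joinOr {l : α → List BinTree} (hl : PolyTime l) :
    PolyTime fun a => PresburgerSynthesis.joinTree orTree (l a) := joinTree hl _

@[fun_prop]
theorem normLit (he : PolyTime e) {k : α → ℕ} (hR : PolyTime R) (hk : PolyTime k)
    (ht : PolyTime t) :
    PolyTime fun a => (Choice.ofIndex (e a)).normLit (R a) (k a) (t a) := by
  unfold Choice.normLit; fun_prop

@[fun_prop]
theorem graphTree (he : PolyTime e) (hn : PolyTime n) (hm : PolyTime m) (hi : PolyTime i) :
    PolyTime fun a => (Choice.ofIndex (e a)).graphTree (n a) (m a) (i a) := by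
  unfold Choice.graphTree; fun_prop

@[fun_prop]
theorem substTree (he : PolyTime e) (hn : PolyTime n) (hm : PolyTime m) (hl : PolyTime l)
    (hi : PolyTime i) :
    PolyTime fun a => (Choice.ofIndex (e a)).substTree (n a) (m a) (l a) (i a) := by
  unfold Choice.substTree; fun_prop

@[fun_prop]
theorem residueTree (he : PolyTime e) (hn : PolyTime n) (hm : PolyTime m) (hv : PolyTime v) :
    PolyTime fun a => (Choice.ofIndex (e a)).residueTree (n a) (m a) (v a) := by
  unfold Choice.residueTree; fun_prop

@[fun_prop]
theorem blockTree (he : PolyTime e) (hn : PolyTime n) (hm : PolyTime m) (hl : PolyTime l) :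
    PolyTime fun a => (Choice.ofIndex (e a)).blockTree (n a) (m a) (l a) := by
  unfold Choice.blockTree; fun_prop

/-- A step of the traversal copies no subtree, so that the state grows only by the new labels. -/
theorem sz_visitStep_le (p : List BinTree × List BinTree) : sz (visitStep p) ≤ sz p + 6 := by
  obtain ⟨l, q⟩ := p
  have h : ∀ t : BinTree, t.fst.size + t.snd.fst.size + t.snd.snd.size ≤ t.size + 2 := fun t => by
    rcases t with _ | ⟨a, _ | ⟨b, c⟩⟩ <;> simp only [BinTree.fst, BinTree.snd, BinTree.size] <;> omega
  cases l with
  | nil => exact Nat.le_add_right _ _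
  | cons t l =>
    have e : ∀ t : BinTree, sz t = t.size := fun _ => rfl
    have := h t
    unfold visitStep
    split_ifs <;>
      simp only [sz_prod, sz_cons, List.headD_cons, List.tail_cons, e, BinTree.size] <;> omega

theorem visited (hR : PolyTime R) (ht : PolyTime t) :
    PolyTime fun a => visitStep^[R a] ([t a], []) :=
  iterate (f := fun _ => visitStep) hR (by fun_prop) (by unfold visitStep; fun_prop)
    ⟨_, .const 6, fun _ => sz_visitStep_le⟩

@[fun_prop]
theorem convTree (he : PolyTime e) (hn : PolyTime n) (hm : PolyTime m) (hR : PolyTime R)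
    (ht : PolyTime t) :
    PolyTime fun a => (Choice.ofIndex (e a)).convTree (n a) (m a) (R a) (t a) := by
  refine headD (foldl (f := fun a s t => (Choice.ofIndex (e a)).evalStep (n a) (m a) (R a) s t)
    (visited hR ht).snd (const []) (by unfold Choice.evalStep; fun_prop) ?_) (const BinTree.nil)
  have h : PolyTime fun p : α × BinTree => (Choice.ofIndex (e p.1)).blockTree (n p.1) (m p.1)
      ((Choice.ofIndex (e p.1)).normLit (R p.1) (n p.1 + m p.1) p.2.snd) := by fun_prop
  obtain ⟨B, hB, hb⟩ := h.sz_le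
  refine ⟨_, (hB.add .id).add (.const 6), fun a u t => ?_⟩
  have h1 := hb (a, t)
  unfold Choice.evalStep
  split_ifs
  · have h2 := t.size_fst_le
    have e : ∀ t : BinTree, sz t = t.size := fun _ => rfl
    rcases u with _ | ⟨x, _ | ⟨y, u⟩⟩ <;>
      simp only [sz_prod, sz_cons, sz_nil, List.headD_cons, List.headD_nil, List.tail_cons,
        List.tail_nil, e, BinTree.size] <;> omega
  · rw [sz_cons]
    dsimp only at h1 ⊢
    omega

end PolyTime

theorem polyTime_specTree : PolyTime specTree := by
  unfold specTree; fun_prop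

/-! ### Exponential padding -/

/-- `f : ℕ → ℕ` is bounded by an exponential of a polynomial. -/
def ExpBdd (f : ℕ → ℕ) : Prop := ∃ k, ∀ n, f n ≤ 2 ^ (n + 2) ^ k

namespace ExpBdd

theorem of_le {f B : ℕ → ℕ} (hB : PolyBdd B) (h : ∀ n, f n ≤ 2 ^ B n) : ExpBdd f :=
  let ⟨k, hk⟩ := hB; ⟨k, fun n => (h n).trans (Nat.pow_le_pow_right (by omega) (hk n))⟩

theorem of_polyBdd {f : ℕ → ℕ} (hf : PolyBdd f) : ExpBdd f :=
  of_le hf fun _ => Nat.lt_two_pow_self.le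

theorem mul {f g : ℕ → ℕ} (hf : ExpBdd f) (hg : ExpBdd g) : ExpBdd fun n => f n * g n :=
  let ⟨k, hk⟩ := hf; let ⟨l, hl⟩ := hg
  of_le ((PolyBdd.pow_add_two k).add (.pow_add_two l)) fun n => by
    rw [pow_add]; exact Nat.mul_le_mul (hk n) (hl n)

theorem add {f g : ℕ → ℕ} (hf : ExpBdd f) (hg : ExpBdd g) : ExpBdd fun n => f n + g n :=
  let ⟨k, hk⟩ := hf; let ⟨l, hl⟩ := hg
  of_le (((PolyBdd.pow_add_two k).add (.pow_add_two l)).add (.const 1)) fun n => by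
    have h1 := hk n
    have h2 := hl n
    have h3 : 2 ^ (n + 2) ^ k ≤ 2 ^ ((n + 2) ^ k + (n + 2) ^ l) :=
      Nat.pow_le_pow_right (by omega) (by omega)
    have h4 : 2 ^ (n + 2) ^ l ≤ 2 ^ ((n + 2) ^ k + (n + 2) ^ l) :=
      Nat.pow_le_pow_right (by omega) (by omega)
    rw [pow_succ]
    omega

theorem pow {f : ℕ → ℕ} (hf : ExpBdd f) (j : ℕ) : ExpBdd fun n => f n ^ j :=
  let ⟨k, hk⟩ := hf
  of_le ((PolyBdd.pow_add_two k).mul (.const j)) fun n => by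
    rw [pow_mul]; exact Nat.pow_le_pow_left (hk n) j

end ExpBdd

/-- One step of counting the nodes of the trees on a stack: the first tree is removed, its two
subtrees are pushed, and the counter is increased. -/
def countBody : Program :=
  .pair (.cond (.seq .fst .fst)
      (.pair (.seq .fst (.seq .fst .fst)) (.pair (.seq .fst (.seq .fst .snd)) (.seq .fst .snd)))
      (.seq .fst .snd))
    (.pair .nil .snd)

theorem size_encodeList (l : List BinTree) :
    (encodeList l).size = (l.map BinTree.size).sum + l.length + 1 := by
  induction l with
  | nil => rfl
  | cons a l ih => simp only [encodeList, BinTree.size, ih, List.map_cons, List.sum_cons,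
      List.length_cons]; omega

theorem length_le_sum_size (l : List BinTree) : l.length ≤ (l.map BinTree.size).sum := by
  induction l with
  | nil => simp
  | cons a l ih =>
    have := a.size_pos
    simp only [List.map_cons, List.sum_cons, List.length_cons]; omega

/-- The loop empties the stack in one pass per node; the sum of the sizes of the trees on the stack
decreases by one in each pass. -/
theorem countLoop_runs (N : ℕ) (l : List BinTree) (c : ℕ) (h : (l.map BinTree.size).sum = N) :
    ∃ t ≤ (N + 1) * (50 * (N + c + 5)), Runs (.loop .fst countBody)
      (.cons (encodeList l) (encodeUnary c)) (.cons .nil (encodeUnary (c + N))) t := by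
  induction N generalizing l c with
  | zero =>
    cases l with
    | nil =>
      refine ⟨_, ?_, Runs.loop_stop (.fst _)⟩
      simp only [BinTree.size, encodeList, encodeUnary_size]
      omega
    | cons a l =>
      have := a.size_pos
      simp only [List.map_cons, List.sum_cons] at h
      omega
  | succ N ih =>
    have e2 : encodeUnary (c + 1) = .cons .nil (encodeUnary c) := rfl
    have e3 : (N + 1 + 1) * (50 * (N + 1 + c + 5)) =
        (N + 1) * (50 * (N + (c + 1) + 5)) + 50 * (N + 1 + c + 5) := by ring
    rcases l with _ | ⟨_ | ⟨a, b⟩, l⟩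
    · simp at h
    · have h1 : (l.map BinTree.size).sum = N := by
        simp only [List.map_cons, List.sum_cons, BinTree.size] at h
        omega
      obtain ⟨t, ht, hr⟩ := ih l (c + 1) h1
      have h2 := length_le_sum_size l
      rw [add_assoc, add_comm 1 N] at hr
      refine ⟨_, ?_, .loop_step (.fst _) (fun h => BinTree.noConfusion h)
        (.pair (.cond_false (.seq (.fst _) (.fst _)) (.seq (.fst _) (.snd _)))
          (.pair (.nil _) (.snd _))) hr⟩
      rw [e3]
      simp only [BinTree.size, encodeList, encodeUnary_size, BinTree.fst, size_encodeList]
      omega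
    · have h1 : ((a :: b :: l).map BinTree.size).sum = N := by
        simp only [List.map_cons, List.sum_cons, BinTree.size] at h ⊢
        omega
      obtain ⟨t, ht, hr⟩ := ih (a :: b :: l) (c + 1) h1
      have h2 := length_le_sum_size l
      rw [add_assoc, add_comm 1 N] at hr
      simp only [List.map_cons, List.sum_cons] at h1
      refine ⟨_, ?_, .loop_step (.fst _) (fun h => BinTree.noConfusion h)
        (.pair (.cond_true (.seq (.fst _) (.fst _)) (fun h => BinTree.noConfusion h)
          (.pair (.seq (.fst _) (.seq (.fst _) (.fst _)))
            (.pair (.seq (.fst _) (.seq (.fst _) (.snd _))) (.seq (.fst _) (.snd _)))))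
          (.pair (.nil _) (.snd _))) hr⟩
      rw [e3]
      simp only [BinTree.size, encodeList, encodeUnary_size, BinTree.fst, size_encodeList]
      omega

theorem polyTime_size : PolyTime BinTree.size := by
  refine ⟨.seq (.pair (.pair .id .nil) .nil) (.seq (.loop .fst countBody) .snd),
    fun n => (n + 1) * (50 * (n + 5)) + 20 * (n + 5), ?_, fun x => ?_⟩
  · exact ((PolyBdd.id.add (.const 1)).mul ((PolyBdd.const 50).mul (PolyBdd.id.add (.const 5)))).add
      ((PolyBdd.const 20).mul (PolyBdd.id.add (.const 5)))
  · obtain ⟨t, ht, hr⟩ := countLoop_runs x.size [x] 0 (by simp)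
    rw [zero_add] at hr
    refine ⟨_, .seq (.pair (.pair (.id _) (.nil _)) (.nil _)) (.seq hr (.snd _)), ?_⟩
    have e : (enc x).size = x.size := rfl
    have e' : sz x = x.size := rfl
    simp only [e, e', BinTree.size, encodeUnary_size]
    rw [add_zero] at ht
    omega

theorem PolyTime.natPow {α : Type} [Enc α] {f : α → ℕ} (hf : PolyTime f) (k : ℕ) :
    PolyTime fun a => f a ^ k := by
  induction k with
  | zero => simpa only [pow_zero] using PolyTime.const 1
  | succ k ih => simpa only [pow_succ] using PolyTime.natMul ih hf

/-- Powers of two can be computed in unary in exponential time, by repeated doubling. -/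
theorem exists_twoPow_program {f : BinTree → ℕ} (hf : PolyTime f) : ∃ (p : Program) (B : ℕ → ℕ),
    ExpBdd B ∧ ∀ x : BinTree, ∃ t, Runs p x (encodeUnary (2 ^ f x)) t ∧ t ≤ B x.size := by
  obtain ⟨p, i, hp⟩ := hf.exists_pow
  obtain ⟨q, B₁, hB₁, hq⟩ := PolyTime.const (α := BinTree) (1 : ℕ)
  have hstep : PolyTime fun a : BinTree × ℕ × Unit => a.2.1 + a.2.1 := by fun_prop
  obtain ⟨r, k, hr⟩ := hstep.exists_pow
  let W : ℕ → ℕ := fun n => 2 * 2 ^ (n + 2) ^ i + 1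
  have hW : ExpBdd W := ((ExpBdd.of_polyBdd (.const 2)).mul ⟨i, fun _ => le_rfl⟩).add
    (.of_polyBdd (.const 1))
  have hL : ExpBdd fun n => (n + 2) ^ i := .of_polyBdd (.pow_add_two i)
  have hid : ExpBdd fun n => n := .of_polyBdd .id
  have hc : ∀ c : ℕ, ExpBdd fun _ => c := fun c => .of_polyBdd (.const c)
  refine ⟨.seq (.pair .id (.pair p q)) (.seq (foldLoop r) (.seq .snd .snd)),
    fun n => (n + n + (n + (n + 2) ^ i + B₁ n)) +
      (((n + 2) ^ i + 1) * ((n + W n + 5) ^ k + 30 * (n + (n + 2) ^ i + W n + 3)) +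
      2 * (n + W n + 3)), ?_, fun x => ?_⟩
  · exact ((hid.add hid).add ((hid.add hL).add (.of_polyBdd hB₁))).add
      (((hL.add (hc 1)).mul ((((hid.add hW).add (hc 5)).pow k).add
        ((hc 30).mul (((hid.add hL).add hW).add (hc 3))))).add
        ((hc 2).mul ((hid.add hW).add (hc 3))))
  · obtain ⟨t₁, h1, h1'⟩ := hp x
    obtain ⟨t₂, h2, h2'⟩ := hq x
    have e : sz x = x.size := rfl
    rw [e] at h1' h2'
    have hlen : sz (f x) ≤ (x.size + 2) ^ i := h1.size_le.trans h1'
    rw [sz_nat] at hlen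
    let l : List Unit := List.replicate (f x) ()
    have hl : enc (f x) = enc l := by
      change encodeUnary (f x) = encodeList ((List.replicate (f x) ()).map enc)
      rw [List.map_replicate]; rfl
    have hsl : sz l ≤ (x.size + 2) ^ i := by
      have : sz l = sz (f x) := by unfold sz; rw [hl]
      rw [this, sz_nat]; exact hlen
    rw [hl] at h1
    have hfold : ∀ l₁ : List Unit, l₁.foldl (fun s _ => s + s) 1 = 2 ^ l₁.length := fun l₁ => by
      induction l₁ using List.reverseRecOn with
      | nil => rfl
      | append_singleton l₁ _ ih => rw [List.foldl_append, ih]; simp [pow_succ, mul_two]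
    have hWb : ∀ l₁ l₂, l = l₁ ++ l₂ → sz (l₁.foldl (fun s _ => s + s) 1) ≤ W x.size := by
      intro l₁ l₂ h
      rw [hfold, sz_nat]
      refine Nat.add_le_add_right (Nat.mul_le_mul_left 2 (Nat.pow_le_pow_right (by omega) ?_)) 1
      have : l.length = f x := List.length_replicate
      rw [h, List.length_append] at this
      omega
    obtain ⟨t₃, h3, h3'⟩ := foldLoop_runs (f := fun s _ => s + s) (step := r) (x := x)
      (T := (x.size + W x.size + 5) ^ k) (W := W x.size) l 1 (fun l₁ b l₂ h => by
        obtain ⟨t, ht, ht'⟩ := hr (x, l₁.foldl (fun s _ => s + s) 1, b)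
        refine ⟨t, ht'.trans (Nat.pow_le_pow_left ?_ k), by rw [List.foldl_append]; exact ht⟩
        have h4 := hWb l₁ _ h
        have h5 : sz b = 1 := rfl
        simp only [sz_prod, e, h5]
        omega) hWb
    rw [hfold, List.length_replicate] at h3'
    refine ⟨_, .seq (.pair (.id _) (.pair h1 h2)) (.seq h3' (.seq (.snd _) (.snd _))), ?_⟩
    have h6 := hWb l [] (by simp)
    rw [hfold, List.length_replicate] at h6
    have h7 : (l.length + 1) * ((x.size + W x.size + 5) ^ k + 30 * (x.size + sz l + W x.size + 3)) ≤
        ((x.size + 2) ^ i + 1) * ((x.size + W x.size + 5) ^ k +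
          30 * (x.size + (x.size + 2) ^ i + W x.size + 3)) := by
      refine Nat.mul_le_mul ?_ (by omega)
      rw [List.length_replicate]
      omega
    simp only [BinTree.size, BinTree.snd]
    have h9 : (enc (2 ^ f x)).size = sz (2 ^ f x) := rfl
    rw [h9]
    omega

/-- A polynomial-time computation that starts from an input and two unary numbers of exponential
size takes exponential time. -/
theorem exists_padded_program {f g : BinTree → ℕ} (hf : PolyTime f) (hg : PolyTime g)
    {F : BinTree × ℕ × ℕ → BinTree} (hF : PolyTime F) : ∃ (p : Program) (B : ℕ → ℕ), ExpBdd B ∧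
      ∀ x : BinTree, ∃ t, Runs p x (F (x, 2 ^ f x, 2 ^ g x)) t ∧ t ≤ B x.size := by
  obtain ⟨p, B, hB, hp⟩ := exists_twoPow_program hf
  obtain ⟨q, C, hC, hq⟩ := exists_twoPow_program hg
  obtain ⟨r, k, hr⟩ := hF.exists_pow
  have hid : ExpBdd fun n => n := .of_polyBdd .id
  have hc : ∀ c : ℕ, ExpBdd fun _ => c := fun c => .of_polyBdd (.const c)
  refine ⟨.seq (.pair .id (.pair p q)) r,
    fun n => (n + n + (n + B n + C n)) + (n + B n + C n + 5) ^ k,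
    ((hid.add hid).add ((hid.add hB).add hC)).add
      ((((hid.add hB).add hC).add (hc 5)).pow k), fun x => ?_⟩
  obtain ⟨t₁, h1, h1'⟩ := hp x
  obtain ⟨t₂, h2, h2'⟩ := hq x
  obtain ⟨t₃, h3, h3'⟩ := hr (x, 2 ^ f x, 2 ^ g x)
  refine ⟨_, .seq (.pair (.id _) (.pair h1 h2)) h3, ?_⟩
  have h4 : t₃ ≤ (x.size + B x.size + C x.size + 5) ^ k := by
    refine h3'.trans (Nat.pow_le_pow_left ?_ k)
    have e1 : sz (2 ^ f x) = (encodeUnary (2 ^ f x)).size := rfl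
    have e2 : sz (2 ^ g x) = (encodeUnary (2 ^ g x)).size := rfl
    have e3 : sz x = x.size := rfl
    have := h1.size_le
    have := h2.size_le
    simp only [sz_prod, e1, e2, e3]
    omega
  dsimp only
  omega

/-! ### The building blocks of a choice of parameters -/

theorem map_range_eq_ofFn {α : Type} (k : ℕ) (f : ℕ → α) :
    (List.range k).map f = List.ofFn fun v : Fin k => f v :=
  List.ext_getElem (by simp) fun i h1 h2 => by simp

theorem sum_map_range (k : ℕ) (f : ℕ → ℤ) : ((List.range k).map f).sum = ∑ v : Fin k, f v := by
  rw [map_range_eq_ofFn, List.sum_ofFn]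

theorem sum_fin_eq_sum_ite {k l : ℕ} (h : k ≤ l) (f : ℕ → ℤ) :
    ∑ v : Fin k, f v = ∑ v : Fin l, if (v : ℕ) < k then f v else 0 := by
  rw [Fin.sum_univ_eq_sum_range, Fin.sum_univ_eq_sum_range (fun v => if v < k then f v else 0) l,
    ← Finset.sum_filter]
  congr 1
  ext v
  simp only [Finset.mem_range, Finset.mem_filter]
  omega

namespace Choice

variable (P : Choice) (n m : ℕ)

theorem coef_head {i v : ℕ} (hv : v < n + i) (w : ℕ) :
    P.coef n i v w = if v = w then (P.M : ℤ) else 0 := if_pos hv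

theorem coef_tail {i v : ℕ} (hv : ¬ v < n + i) (w : ℕ) :
    P.coef n i v w = if w < n + i then P.N * P.a i v w else 0 := if_neg hv

theorem cst_head {i v : ℕ} (hv : v < n + i) : P.cst n i v = 0 := if_pos hv

theorem cst_tail {i v : ℕ} (hv : ¬ v < n + i) : P.cst n i v =
    P.N * (P.D * (P.r v + P.N * P.c i v) - ∑ w : Fin (n + i), P.a i v w * P.r w) := by
  rw [cst, if_neg hv, sum_map_range]

theorem r_lt_M (v : ℕ) : P.r v < P.M := P.r_lt v

theorem M_ne_zero : (P.M : ℚ) ≠ 0 := by exact_mod_cast P.M_pos.ne'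

theorem den_dvd (z : ℤ) : ((z : ℚ) / P.M).den ∣ P.M := by
  have h := Rat.den_dvd z P.M
  rw [Rat.divInt_eq_div, Int.cast_natCast] at h
  exact_mod_cast h

/-- The data of the building blocks that are described by a choice of parameters. -/
def blockData : BlockData n m where
  M := P.M
  M_pos := P.M_pos
  res v := P.r v
  res_lt v := P.r_lt_M v
  A i :=
    { lin := fun j w => (P.coef n i (n + i + j) w : ℚ) / P.M
      const := fun j => (P.cst n i (n + i + j) : ℚ) / P.M }
  den_lin _ _ _ := P.den_dvd _
  den_const _ _ := P.den_dvd _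
  integral i j := by
    refine ⟨P.r (n + i + j) + P.N * P.c i (n + i + j), ?_⟩
    have hv : ¬ n + i + j < n + (i : ℕ) := by omega
    have hM := P.M_ne_zero
    have hM' : (P.M : ℚ) = P.D * P.N := by rw [M]; push_cast; rfl
    have hw : ∀ w : Fin (n + i), (headVar i w : ℕ) = w := fun _ => rfl
    simp only [RatAffine.eval, P.coef_tail n hv, P.cst_tail n hv, Fin.is_lt, if_true, hw]
    have : ∑ w : Fin (n + i), ((P.N * P.a i (n + i + j) w : ℤ) : ℚ) / P.M * ((P.r w : ℤ) : ℚ) =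
        (P.N * ∑ w : Fin (n + i), (P.a i (n + i + j) w : ℚ) * P.r w) / P.M := by
      rw [Finset.mul_sum, Finset.sum_div]
      refine Finset.sum_congr rfl fun w _ => ?_
      push_cast
      ring
    rw [this, ← add_div, div_eq_iff hM]
    push_cast
    rw [hM']
    ring

theorem clear_blockData (z : ℤ) : (P.blockData n m).clear ((z : ℚ) / P.M) = z := by
  change ((P.M : ℚ) * ((z : ℚ) / P.M)).num = z
  rw [mul_div_cancel₀ _ P.M_ne_zero, Rat.num_intCast]

theorem substCoeff_blockData (i : Fin m) (v w : Fin (n + m)) :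
    (P.blockData n m).substCoeff i v w = P.coef n i v w := by
  unfold BlockData.substCoeff
  by_cases hv : (v : ℕ) < n + i
  · rw [dif_pos hv, P.coef_head n hv]
    simp only [Fin.ext_iff]
    rfl
  · have e : n + i + (v - (n + i)) = (v : ℕ) := by omega
    rw [dif_neg hv, P.coef_tail n hv]
    split_ifs with hw
    · refine (P.clear_blockData n m (P.coef n i (n + i + (v - (n + i))) w)).trans ?_
      rw [e, P.coef_tail n hv, if_pos hw]
    · rfl

theorem substConst_blockData (i : Fin m) (v : Fin (n + m)) :
    (P.blockData n m).substConst i v = P.cst n i v := by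
  unfold BlockData.substConst
  by_cases hv : (v : ℕ) < n + i
  · rw [dif_pos hv, P.cst_head n hv]
  · have e : n + i + (v - (n + i)) = (v : ℕ) := by omega
    rw [dif_neg hv]
    refine (P.clear_blockData n m (P.cst n i (n + i + (v - (n + i))))).trans ?_
    rw [e]

/-- The inequality that replaces a literal: inequalities stay, and modulo constraints become true
or false. -/
def norm {k : ℕ} : Literal k → (Fin k → ℤ) × ℤ
  | .ge a b => (a, b)
  | .cong a r N _ =>
    (0, if P.N % N = 0 ∧ P.congHolds k (List.ofFn a) r N = true then 0 else -1)
  | .ncong a r N _ =>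
    (0, if P.N % N = 0 ∧ P.congHolds k (List.ofFn a) r N = false then 0 else -1)

end Choice

/-- The replacement of all literals of a formula by formulas. -/
def Formula.bind {k l : ℕ} (f : Literal k → Formula l) : Formula k → Formula l
  | .lit l => f l
  | .and φ ψ => .and (φ.bind f) (ψ.bind f)
  | .or φ ψ => .or (φ.bind f) (ψ.bind f)

/-- The formula in which every literal is replaced by its building block. -/
def Choice.conv (P : Choice) (n m : ℕ) (φ : Formula (n + m)) : Formula (n + m) :=
  φ.bind fun l => (P.blockData n m).block (.ge (P.norm l).1 (P.norm l).2)

/-! ### The conversion on trees is the conversion of formulas -/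

theorem joinTree_cons_cons (f : BinTree → BinTree → BinTree) (s t : BinTree) (l : List BinTree) :
    joinTree f (s :: t :: l) = f s (joinTree f (t :: l)) := by
  unfold joinTree
  have h : (t :: l).reverse ≠ [] := by simp
  obtain ⟨x, l', hl⟩ := List.exists_cons_of_ne_nil h
  rw [List.reverse_cons (a := s), hl]
  simp

theorem joinTree_and {k : ℕ} (φ : Formula k) (l : List (Formula k)) :
    joinTree andTree (encodeFormula φ :: l.map encodeFormula) = encodeFormula (bigAnd (φ :: l)) := by
  induction l generalizing φ with
  | nil => rfl
  | cons ψ l ih => rw [List.map_cons, joinTree_cons_cons, ih]; rfl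

theorem joinTree_or {k : ℕ} (φ : Formula k) (l : List (Formula k)) :
    joinTree orTree (encodeFormula φ :: l.map encodeFormula) = encodeFormula (bigOr (φ :: l)) := by
  induction l generalizing φ with
  | nil => rfl
  | cons ψ l ih => rw [List.map_cons, joinTree_cons_cons, ih]; rfl

theorem joinTree_and_of_ne_nil {k : ℕ} {l : List (Formula k)} (hl : l ≠ []) :
    joinTree andTree (l.map encodeFormula) = encodeFormula (bigAnd l) := by
  obtain ⟨φ, l, rfl⟩ := List.exists_cons_of_ne_nil hl
  exact joinTree_and φ l

theorem geTree_ofFn {k : ℕ} (a : Fin k → ℤ) (b : ℤ) :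
    geTree (List.ofFn a) b = encodeFormula (.lit (.ge a b)) := by
  simp only [geTree, encodeFormula, encodeLiteral, encodeCoeffs, List.map_ofFn]
  rfl

theorem congTree_ofFn {k : ℕ} (a : Fin k → ℤ) {r N : ℕ} (h : r < N) :
    congTree (List.ofFn a) r N = encodeFormula (.lit (.cong a r N h)) := by
  simp only [congTree, encodeFormula, encodeLiteral, encodeCoeffs, List.map_ofFn]
  rfl

namespace Choice

variable (P : Choice) {n m : ℕ}

theorem graphTree_eq (i : Fin m) :
    P.graphTree n m i = encodeFormula ((P.blockData n m).graph i) := by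
  have hm : 0 < m - (i : ℕ) := by omega
  unfold graphTree BlockData.graph
  rw [← joinTree_and_of_ne_nil]
  · rw [List.map_append]
    simp only [map_range_eq_ofFn, geTree_ofFn, List.map_ofFn, Function.comp_def,
      substCoeff_blockData, substConst_blockData, Fin.ext_iff]
    rfl
  · intro h
    have := congrArg List.length h
    rw [List.length_append, List.length_ofFn, List.length_ofFn, List.length_nil] at this
    omega

theorem substTree_eq {l : List ℤ × ℤ} {a : Fin (n + m) → ℤ} {b : ℤ}
    (ha : ∀ v : Fin (n + m), l.1.getD v 0 = a v) (hb : l.2 = b) (i : Fin m) :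
    P.substTree n m l i = encodeFormula (.lit ((P.blockData n m).subst i (.ge a b))) := by
  subst hb
  simp only [substTree, BlockData.subst, map_range_eq_ofFn, List.sum_ofFn, geTree_ofFn, ha,
    substCoeff_blockData, substConst_blockData]
  rfl

theorem residueTree_eq (v : Fin (n + m)) : P.residueTree n m v = encodeFormula
    (.lit (.cong (Pi.single v 1) (P.r v) P.M (P.r_lt_M v))) := by
  have h : (fun w : Fin (n + m) => if (w : ℕ) = v then 1 else 0) = (Pi.single v 1 : _ → ℤ) := by
    ext w
    simp only [Pi.single_apply, Fin.ext_iff]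
  rw [residueTree, map_range_eq_ofFn, congTree_ofFn _ (P.r_lt_M v), h]

theorem blockTree_eq {l : List ℤ × ℤ} {a : Fin (n + m) → ℤ} {b : ℤ}
    (ha : ∀ v : Fin (n + m), l.1.getD v 0 = a v) (hb : l.2 = b) :
    P.blockTree n m l = encodeFormula ((P.blockData n m).block (.ge a b)) := by
  unfold blockTree BlockData.block
  rw [← joinTree_and, ← joinTree_or, List.map_append]
  simp only [map_range_eq_ofFn, List.map_ofFn, Function.comp_def, ha, hb, geTree_ofFn,
    graphTree_eq, P.substTree_eq ha hb, residueTree_eq]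
  rfl

end Choice

theorem lt_two_pow_of_bitLength_le {a : ℤ} {s : ℕ} (h : bitLength a ≤ s) : a.natAbs < 2 ^ s :=
  Nat.lt_size_self _ |>.trans_le (Nat.pow_le_pow_right (by omega) (by unfold bitLength at h; omega))

theorem intOfTree_encodeInt {R : ℕ} {a : ℤ} (h : a.natAbs ≤ R) : intOfTree R (encodeInt a) = a := by
  have h1 : ofBitsCapped R (encodeNat a.natAbs).toList = a.natAbs := by
    rw [encodeNat, toList_encodeList, ofBitsCapped_bits h]
  simp only [intOfTree, encodeInt, BinTree.fst, BinTree.snd, h1]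
  by_cases ha : a < 0
  · simp only [ha, decide_true, encodeBool, BinTree.isCons, if_true]
    omega
  · simp only [ha, decide_false, encodeBool, BinTree.isCons]
    rw [if_neg (by decide)]
    omega

theorem map_intOfTree {R k : ℕ} {a : Fin k → ℤ} (h : ∀ v, (a v).natAbs ≤ R) :
    (encodeCoeffs a).toList.map (intOfTree R) = List.ofFn a := by
  rw [encodeCoeffs, toList_encodeList, List.map_ofFn]
  exact congrArg List.ofFn (funext fun v => intOfTree_encodeInt (h v))

namespace Choice

variable (P : Choice)

theorem normLit_encodeLiteral {R k : ℕ} {l : Literal k} (hR : 2 ^ l.bits ≤ R) :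
    (∀ v : Fin k, (P.normLit R k (encodeLiteral l)).1.getD v 0 = (P.norm l).1 v) ∧
      (P.normLit R k (encodeLiteral l)).2 = (P.norm l).2 := by
  have key : ∀ (a : Fin k → ℤ) (s : ℕ), ∑ v, bitLength (a v) ≤ s → 2 ^ s ≤ R →
      ∀ v, (a v).natAbs ≤ R := fun a s h h' v => by
    have : bitLength (a v) ≤ ∑ v, bitLength (a v) :=
      Finset.single_le_sum (f := fun v => bitLength (a v)) (fun _ _ => Nat.zero_le _)
        (Finset.mem_univ v)
    exact ((lt_two_pow_of_bitLength_le (this.trans h)).trans_le h').le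
  have key2 : ∀ (b : ℤ) (s : ℕ), bitLength b ≤ s → 2 ^ s ≤ R → b.natAbs ≤ R := fun b s h h' =>
    ((lt_two_pow_of_bitLength_le h).trans_le h').le
  have key3 : ∀ (b s : ℕ), bitLength b ≤ s → 2 ^ s ≤ R →
      ofBitsCapped R (encodeNat b).toList = b := fun b s h h' => by
    rw [encodeNat, toList_encodeList, ofBitsCapped_bits (by simpa using key2 b s h h')]
  cases l with
  | ge a b =>
    have h1 := map_intOfTree (key a _ (Nat.le_add_right _ _) hR)
    have h2 := intOfTree_encodeInt (key2 b _ (Nat.le_add_left _ _) hR)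
    simp only [normLit, encodeLiteral, norm, BinTree.fst, BinTree.snd, h1, h2]
    rw [if_neg (by decide)]
    exact ⟨fun v => by simp, rfl⟩
  | cong a r N h =>
    simp only [Literal.bits] at hR
    have h1 := map_intOfTree (key a _ (by omega) hR)
    have h2 := key3 r _ (by omega) hR
    have h3 := key3 N _ (by omega) hR
    have h4 : P.normLit R k (encodeLiteral (.cong a r N h)) =
        if (decide (P.N % N = 0) && P.congHolds k (List.ofFn a) r N) then ([], 0) else ([], -1) := by
      change (if (decide (P.N % ofBitsCapped R (encodeNat N).toList = 0) && P.congHolds k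
        ((encodeCoeffs a).toList.map (intOfTree R)) (ofBitsCapped R (encodeNat r).toList)
        (ofBitsCapped R (encodeNat N).toList)) then _ else _) = _
      rw [h1, h2, h3]
    rw [h4]
    by_cases h5 : P.N % N = 0 ∧ P.congHolds k (List.ofFn a) r N = true <;>
      simp [norm, h5]
  | ncong a r N h =>
    simp only [Literal.bits] at hR
    have h1 := map_intOfTree (key a _ (by omega) hR)
    have h2 := key3 r _ (by omega) hR
    have h3 := key3 N _ (by omega) hR
    have h4 : P.normLit R k (encodeLiteral (.ncong a r N h)) =
        if (decide (P.N % N = 0) && !P.congHolds k (List.ofFn a) r N) then ([], 0) else ([], -1) := by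
      change (if (decide (P.N % ofBitsCapped R (encodeNat N).toList = 0) && !P.congHolds k
        ((encodeCoeffs a).toList.map (intOfTree R)) (ofBitsCapped R (encodeNat r).toList)
        (ofBitsCapped R (encodeNat N).toList)) then _ else _) = _
      rw [h1, h2, h3]
    rw [h4]
    by_cases h5 : P.N % N = 0 ∧ P.congHolds k (List.ofFn a) r N = false <;>
      simp [norm, h5]

end Choice

/-- The nodes of a formula in preorder. Inner nodes are represented by their labels. -/
def Formula.nodes {k : ℕ} : Formula k → List BinTree
  | .lit l => [encodeFormula (.lit l)]
  | .and φ ψ => .cons (encodeUnary 1) .nil :: (φ.nodes ++ ψ.nodes)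
  | .or φ ψ => .cons (encodeUnary 2) .nil :: (φ.nodes ++ ψ.nodes)

/-- The traversal of a formula on top of the stack takes one step per node and leaves the rest of the
stack untouched. -/
theorem iterate_visitStep {k : ℕ} (φ : Formula k) (st out : List BinTree) :
    visitStep^[φ.nodes.length] (encodeFormula φ :: st, out) = (st, φ.nodes.reverse ++ out) := by
  induction φ generalizing st out with
  | lit l => rfl
  | and φ ψ ih1 ih2 =>
    rw [Formula.nodes, List.length_cons, List.length_append, Function.iterate_succ_apply, add_comm,
      Function.iterate_add_apply]
    change visitStep^[_] (visitStep^[_] (encodeFormula φ :: encodeFormula ψ :: st,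
      .cons (encodeUnary 1) .nil :: out)) = _
    rw [ih1, ih2]
    simp
  | or φ ψ ih1 ih2 =>
    rw [Formula.nodes, List.length_cons, List.length_append, Function.iterate_succ_apply, add_comm,
      Function.iterate_add_apply]
    change visitStep^[_] (visitStep^[_] (encodeFormula φ :: encodeFormula ψ :: st,
      .cons (encodeUnary 2) .nil :: out)) = _
    rw [ih1, ih2]
    simp

theorem iterate_visitStep_of_le {k R : ℕ} {φ : Formula k} (h : φ.nodes.length ≤ R) :
    visitStep^[R] ([encodeFormula φ], []) = ([], φ.nodes.reverse) := by
  obtain ⟨j, rfl⟩ := Nat.exists_eq_add_of_le' h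
  rw [Function.iterate_add_apply, iterate_visitStep, List.append_nil]
  exact Function.iterate_fixed rfl j

namespace Choice

variable (P : Choice) {n m R : ℕ}

/-- The nodes in reverse preorder are a program in postfix notation for the converted formula. -/
theorem foldl_evalStep (φ : Formula (n + m)) (s : List BinTree)
    (hR : ∀ l ∈ φ.literals, 2 ^ l.bits ≤ R) :
    φ.nodes.reverse.foldl (P.evalStep n m R) s = encodeFormula (P.conv n m φ) :: s := by
  induction φ generalizing s with
  | lit l =>
    have h := P.normLit_encodeLiteral (hR l (by simp [Formula.literals]))
    change P.evalStep n m R s (encodeFormula (.lit l)) = _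
    rw [evalStep, if_neg (show ¬ (encodeFormula (.lit l)).fst.isCons = true from Bool.false_ne_true)]
    exact congrArg (· :: s) (P.blockTree_eq h.1 h.2)
  | and φ ψ ih1 ih2 =>
    simp only [Formula.literals, List.mem_append] at hR
    rw [Formula.nodes, List.reverse_cons, List.reverse_append, List.foldl_append,
      List.foldl_append, ih2 _ fun l hl => hR l (.inr hl), ih1 _ fun l hl => hR l (.inl hl)]
    rfl
  | or φ ψ ih1 ih2 =>
    simp only [Formula.literals, List.mem_append] at hR
    rw [Formula.nodes, List.reverse_cons, List.reverse_append, List.foldl_append,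
      List.foldl_append, ih2 _ fun l hl => hR l (.inr hl), ih1 _ fun l hl => hR l (.inl hl)]
    rfl

theorem convTree_encodeFormula (φ : Formula (n + m)) (hR : ∀ l ∈ φ.literals, 2 ^ l.bits ≤ R)
    (hR' : φ.nodes.length ≤ R) :
    P.convTree n m R (encodeFormula φ) = encodeFormula (P.conv n m φ) := by
  rw [convTree, iterate_visitStep_of_le hR', P.foldl_evalStep φ [] hR]
  rfl

end Choice

theorem Formula.length_nodes_le {k : ℕ} (φ : Formula k) : φ.nodes.length ≤ φ.nodesAndBits := by
  induction φ with
  | lit l => exact Nat.le_add_right _ _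
  | and φ ψ ih1 ih2 =>
    simp only [Formula.nodes, Formula.nodesAndBits, List.length_cons, List.length_append]; omega
  | or φ ψ ih1 ih2 =>
    simp only [Formula.nodes, Formula.nodesAndBits, List.length_cons, List.length_append]; omega

theorem Formula.bits_le {k : ℕ} {φ : Formula k} {l : Literal k} (h : l ∈ φ.literals) :
    l.bits ≤ φ.nodesAndBits := by
  induction φ with
  | lit l' =>
    obtain rfl := List.mem_singleton.1 h
    exact Nat.le_add_left _ _
  | and φ ψ ih1 ih2 =>
    rw [Formula.nodesAndBits]
    rcases List.mem_append.1 h with h | h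
    · have := ih1 h; omega
    · have := ih2 h; omega
  | or φ ψ ih1 ih2 =>
    rw [Formula.nodesAndBits]
    rcases List.mem_append.1 h with h | h
    · have := ih1 h; omega
    · have := ih2 h; omega

/-- The disjunction over the first `R` families of parameters with digits below `Q`. -/
def normalForm (n m Q R : ℕ) (φ : Formula (n + m)) : Formula (n + m) :=
  bigOr ((List.range R).map fun j => (Choice.ofIndex (Q, j)).conv n m φ)

theorem length_toList_encodeUnary (n : ℕ) : (encodeUnary n).toList.length = n := by
  rw [encodeUnary, toList_encodeList, List.length_replicate]

/-- The bound `R` serves three purposes: it exceeds all constants of the formula, so that decoding is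
not affected by the cap; it exceeds the number of nodes, so that the traversal ends; and it is the
number of disjuncts. -/
theorem specTree_encodeSpec {n m Q R : ℕ} {φ : Formula (n + m)} (hR : 2 ^ φ.nodesAndBits ≤ R) :
    specTree (encodeSpec n m φ, Q, R) = encodeFormula (normalForm n m Q R φ) := by
  have h : ∀ P : Choice, P.convTree n m R (encodeFormula φ) = encodeFormula (P.conv n m φ) :=
    fun P => P.convTree_encodeFormula φ
      (fun l hl => (Nat.pow_le_pow_right (by omega) (Formula.bits_le hl)).trans hR)
      (φ.length_nodes_le.trans (Nat.lt_two_pow_self.le.trans hR))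
  obtain ⟨S, rfl⟩ := Nat.exists_eq_add_of_le' ((Nat.one_le_two_pow).trans hR)
  simp only [specTree, encodeSpec, BinTree.fst, BinTree.snd, length_toList_encodeUnary, h,
    normalForm, List.range_succ_eq_map, List.map_cons, ← joinTree_or, List.map_map]
  rfl

/-! ### Semantics of building blocks -/

theorem bigAnd_sat {k : ℕ} {z : Fin k → ℤ} {l : List (Formula k)} :
    (bigAnd l).Sat z ↔ ∀ φ ∈ l, φ.Sat z := by
  induction l with
  | nil => simp [bigAnd, Formula.verum, Formula.Sat, Literal.Sat]
  | cons φ l ih =>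
    cases l with
    | nil => simp [bigAnd]
    | cons ψ l => rw [bigAnd, Formula.Sat, ih, List.forall_mem_cons (a := φ)]

theorem bigOr_sat {k : ℕ} {z : Fin k → ℤ} {l : List (Formula k)} :
    (bigOr l).Sat z ↔ ∃ φ ∈ l, φ.Sat z := by
  induction l with
  | nil => simp [bigOr, Formula.falsum, Formula.Sat, Literal.Sat]
  | cons φ l ih =>
    cases l with
    | nil => simp [bigOr]
    | cons ψ l => simp only [bigOr, Formula.Sat, ih, List.mem_cons (b := φ), exists_eq_or_imp]

theorem maxConjunctive_sat {k : ℕ} {z : Fin k → ℤ} {φ χ : Formula k} (h : χ ∈ φ.maxConjunctive)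
    (hχ : χ.Sat z) : φ.Sat z := by
  induction φ with
  | lit l => rwa [List.mem_singleton.1 h] at hχ
  | and φ ψ => rwa [List.mem_singleton.1 h] at hχ
  | or φ ψ ih1 ih2 => exact (List.mem_append.1 h).imp (fun h => ih1 h) fun h => ih2 h

theorem literals_subset_of_mem_maxConjunctive {k : ℕ} {φ χ : Formula k}
    (h : χ ∈ φ.maxConjunctive) : χ.literals ⊆ φ.literals := by
  induction φ with
  | lit l => rw [List.mem_singleton.1 h]; exact List.Subset.refl _
  | and φ ψ => rw [List.mem_singleton.1 h]; exact List.Subset.refl _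
  | or φ ψ ih1 ih2 =>
    rcases List.mem_append.1 h with h | h
    · exact List.subset_append_of_subset_left _ (ih1 h)
    · exact List.subset_append_of_subset_right _ (ih2 h)

theorem mem_maxConjunctive_bigOr {k : ℕ} {χ : Formula k} {l : List (Formula k)} (hl : l ≠ [])
    (h : χ ∈ (bigOr l).maxConjunctive) : ∃ φ ∈ l, χ ∈ φ.maxConjunctive := by
  induction l with
  | nil => exact absurd rfl hl
  | cons φ l ih =>
    cases l with
    | nil => exact ⟨φ, List.mem_singleton_self φ, h⟩
    | cons ψ l =>
      rcases List.mem_append.1 h with h | h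
      · exact ⟨φ, List.mem_cons_self, h⟩
      · obtain ⟨φ', h1, h2⟩ := ih (by simp) h
        exact ⟨φ', List.mem_cons_of_mem _ h1, h2⟩

theorem mem_literals_bigAnd {k : ℕ} {l : Literal k} {L : List (Formula k)}
    (h : l ∈ (bigAnd L).literals) : l ∈ Formula.verum.literals ∨ ∃ φ ∈ L, l ∈ φ.literals := by
  induction L with
  | nil => exact .inl h
  | cons φ L ih =>
    cases L with
    | nil => exact .inr ⟨φ, List.mem_singleton_self φ, h⟩
    | cons ψ L =>
      rcases List.mem_append.1 h with h | h
      · exact .inr ⟨φ, List.mem_cons_self, h⟩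
      · exact (ih h).imp id fun ⟨φ', h1, h2⟩ => ⟨φ', List.mem_cons_of_mem _ h1, h2⟩

theorem mem_literals_bigOr {k : ℕ} {l : Literal k} {L : List (Formula k)}
    (h : l ∈ (bigOr L).literals) : l ∈ Formula.falsum.literals ∨ ∃ φ ∈ L, l ∈ φ.literals := by
  induction L with
  | nil => exact .inl h
  | cons φ L ih =>
    cases L with
    | nil => exact .inr ⟨φ, List.mem_singleton_self φ, h⟩
    | cons ψ L =>
      rcases List.mem_append.1 h with h | h
      · exact .inr ⟨φ, List.mem_cons_self, h⟩
      · exact (ih h).imp id fun ⟨φ', h1, h2⟩ => ⟨φ', List.mem_cons_of_mem _ h1, h2⟩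

/-- The modulus of a literal, and `1` for inequalities. -/
def Literal.modulus {k : ℕ} : Literal k → ℕ
  | .ge _ _ => 1
  | .cong _ _ N _ => N
  | .ncong _ _ N _ => N

namespace Choice

variable (P : Choice) {n m : ℕ}

theorem congHolds_iff {k r N : ℕ} {a z : Fin k → ℤ} (hN : N ∣ P.N)
    (hz : ∀ v, z v ≡ P.r v [ZMOD P.N]) :
    P.congHolds k (List.ofFn a) r N = true ↔ ∑ v, a v * z v ≡ r [ZMOD N] := by
  have h : ∑ v : Fin k, a v * P.r v ≡ ∑ v, a v * z v [ZMOD N] := by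
    refine Int.ModEq.symm (Int.ModEq.of_dvd (Int.natCast_dvd_natCast.2 hN) ?_)
    exact Int.ModEq.sum fun v _ => (hz v).mul_left _
  have h2 : ((List.range k).map fun v => (List.ofFn a).getD v 0 * (P.r v : ℤ)).sum =
      ∑ v : Fin k, a v * P.r v := by
    rw [sum_map_range]
    exact Finset.sum_congr rfl fun v _ => by simp
  rw [congHolds, h2, decide_eq_true_iff, ← Nat.dvd_iff_mod_eq_zero, ← Int.natCast_dvd]
  rw [← Int.modEq_iff_dvd, Int.modEq_comm]
  exact ⟨h.symm.trans, h.trans⟩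

/-- On points that are congruent to the residues, the inequality that replaces a literal is
equivalent to it, provided that the modulus divides `N`. -/
theorem norm_sat {k : ℕ} {z : Fin k → ℤ} (hz : ∀ v, z v ≡ P.r v [ZMOD P.N]) (l : Literal k) :
    (Literal.ge (P.norm l).1 (P.norm l).2).Sat z ↔ l.modulus ∣ P.N ∧ l.Sat z := by
  have h0 : ∀ b : ℤ, (Literal.ge (0 : Fin k → ℤ) b).Sat z ↔ 0 ≤ b := fun b => by
    simp [Literal.Sat]
  have h1 : ∀ p : Prop, ∀ [Decidable p], 0 ≤ (if p then (0 : ℤ) else -1) ↔ p := fun p _ => by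
    split_ifs <;> simp [*]
  cases l with
  | ge a b => simp [norm, Literal.modulus]
  | cong a r N h =>
    refine (h0 _).trans ((h1 _).trans ?_)
    rw [← Nat.dvd_iff_mod_eq_zero]
    exact and_congr_right fun hN => P.congHolds_iff hN hz
  | ncong a r N h =>
    refine (h0 _).trans ((h1 _).trans ?_)
    rw [← Nat.dvd_iff_mod_eq_zero]
    refine and_congr_right fun hN => ?_
    rw [Literal.Sat, ← P.congHolds_iff hN hz, Bool.not_eq_true]

/-- The point `(x^i, A_i(x^i))`, for a point that is congruent to the residues modulo `M`. -/
def point (i : Fin m) (z : Fin (n + m) → ℤ) (v : Fin (n + m)) : ℤ :=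
  if (v : ℕ) < n + i then z v
  else P.r v + P.N * (P.c i v +
    ∑ w : Fin (n + m), if (w : ℕ) < n + i then P.a i v w * ((z w - P.r w) / P.M) else 0)

theorem point_modEq {z : Fin (n + m) → ℤ} (hz : ∀ v, z v ≡ P.r v [ZMOD P.M]) (i : Fin m)
    (v : Fin (n + m)) : P.point i z v ≡ P.r v [ZMOD P.N] := by
  unfold point
  split_ifs
  · exact (hz v).of_dvd ⟨P.D, by rw [M]; push_cast; ring⟩
  · exact (Int.modEq_iff_dvd.2 ⟨-_, by rw [sub_add_cancel_left, mul_neg]⟩)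

/-- `M` times the point `(x^i, A_i(x^i))` is given by the integer coefficients that occur in the
building blocks. -/
theorem M_mul_point {z : Fin (n + m) → ℤ} (hz : ∀ v, z v ≡ P.r v [ZMOD P.M]) (i : Fin m)
    (v : Fin (n + m)) :
    P.M * P.point i z v = ∑ w : Fin (n + m), P.coef n i v w * z w + P.cst n i v := by
  unfold point
  split_ifs with hv
  · simp only [P.coef_head n hv, P.cst_head n hv, ← Fin.ext_iff, ite_mul, zero_mul, add_zero,
      Finset.sum_ite_eq, Finset.mem_univ, if_true]
  · have hM : (P.M : ℤ) = P.D * P.N := by rw [M]; push_cast; rfl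
    have h1 : ∀ w : Fin (n + m), (P.M : ℤ) * ((z w - P.r w) / P.M) = z w - P.r w := fun w =>
      Int.mul_ediv_cancel' (Int.modEq_iff_dvd.1 (hz w).symm)
    have h2 : (P.M : ℤ) * ∑ w : Fin (n + m),
        (if (w : ℕ) < n + i then P.a i v w * ((z w - P.r w) / P.M) else 0) =
        ∑ w : Fin (n + m), (if (w : ℕ) < n + i then P.a i v w * z w else 0) -
        ∑ w : Fin (n + m), (if (w : ℕ) < n + i then P.a i v w * P.r w else 0) := by
      rw [Finset.mul_sum, ← Finset.sum_sub_distrib]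
      refine Finset.sum_congr rfl fun w _ => ?_
      split_ifs
      · rw [mul_left_comm, h1]; ring
      · simp
    simp only [P.coef_tail n hv, P.cst_tail n hv]
    rw [sum_fin_eq_sum_ite (by omega : n + (i : ℕ) ≤ n + m) fun w => P.a i v w * (P.r w : ℤ)]
    have h3 : ∑ w : Fin (n + m), (if (w : ℕ) < n + i then P.N * P.a i v w else 0) * z w =
        P.N * ∑ w : Fin (n + m), (if (w : ℕ) < n + i then P.a i v w * z w else 0) := by
      rw [Finset.mul_sum]
      refine Finset.sum_congr rfl fun w _ => ?_
      split_ifs <;> ring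
    rw [h3, mul_add, mul_left_comm, mul_add, h2, hM]
    ring

/-- The affine maps of the building blocks have the values that `point` describes. -/
theorem eval_blockData {z : Fin (n + m) → ℤ} (hz : ∀ v, z v ≡ P.r v [ZMOD P.M]) (i : Fin m)
    (j : Fin (m - i)) : (P.point i z (tailVar i j) : ℚ) =
      ((P.blockData n m).A i).eval (fun w => z (headVar i w)) j := by
  have h : P.M * P.point i z (tailVar i j) =
      ∑ w : Fin (n + m), P.coef n i (n + i + j) w * z w + P.cst n i (n + i + j) :=
    P.M_mul_point hz i (tailVar i j)
  have hM := P.M_ne_zero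
  have hv : ¬ n + (i : ℕ) + j < n + i := by omega
  have h1 : ∑ w : Fin (n + m), P.coef n i (n + i + j) w * z w =
      ∑ w : Fin (n + i), P.coef n i (n + i + j) w * z (headVar i w) := by
    let f : ℕ → ℤ := fun w => P.coef n i (n + i + j) w * if h : w < n + m then z ⟨w, h⟩ else 0
    have h2 := sum_fin_eq_sum_ite (by omega : n + (i : ℕ) ≤ n + m) f
    have h3 : ∀ w : Fin (n + i), f w = P.coef n i (n + i + j) w * z (headVar i w) := fun w => by
      have : (w : ℕ) < n + m := (headVar i w).2
      simp only [f, dif_pos this]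
      rfl
    simp only [h3] at h2
    rw [h2]
    refine Finset.sum_congr rfl fun w _ => ?_
    split_ifs with hw
    · simp [f]
    · rw [P.coef_tail n hv, if_neg hw, zero_mul]
  rw [h1] at h
  have h' : (P.M : ℚ) * P.point i z (tailVar i j) =
      ∑ w : Fin (n + i), (P.coef n i (n + i + j) w : ℚ) * z (headVar i w) +
        P.cst n i (n + i + j) := by exact_mod_cast h
  change _ = ∑ w : Fin (n + i), (P.coef n i (n + i + j) w : ℚ) / P.M * (z (headVar i w) : ℚ) +
    (P.cst n i (n + i + j) : ℚ) / P.M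
  simp only [div_mul_eq_mul_div]
  rw [← Finset.sum_div, ← add_div, ← h', mul_div_cancel_left₀ _ hM]

theorem subst_sat {z : Fin (n + m) → ℤ} (hz : ∀ v, z v ≡ P.r v [ZMOD P.M]) (i : Fin m)
    (a : Fin (n + m) → ℤ) (b : ℤ) :
    ((P.blockData n m).subst i (.ge a b)).Sat z ↔ (Literal.ge a b).Sat (P.point i z) := by
  have hM : (0 : ℤ) < P.M := by exact_mod_cast P.M_pos
  have h : ∑ w : Fin (n + m), (∑ v : Fin (n + m), a v * P.coef n i v w) * z w +
      ((P.M : ℤ) * b + ∑ v, a v * P.cst n i v) =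
      P.M * (∑ v, a v * P.point i z v + b) := by
    rw [mul_add, Finset.mul_sum]
    simp only [mul_left_comm (P.M : ℤ), P.M_mul_point hz, mul_add, Finset.sum_add_distrib,
      Finset.mul_sum, Finset.sum_mul, mul_assoc]
    rw [Finset.sum_comm]
    ring
  simp only [BlockData.subst, Literal.Sat, substCoeff_blockData, substConst_blockData]
  change 0 ≤ ∑ w : Fin (n + m), (∑ v : Fin (n + m), a v * P.coef n i v w) * z w +
    ((P.M : ℤ) * b + ∑ v, a v * P.cst n i v) ↔ _
  rw [h]
  exact ⟨fun h => by by_contra h'; nlinarith, fun h => by positivity⟩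

theorem graph_sat {z : Fin (n + m) → ℤ} (hz : ∀ v, z v ≡ P.r v [ZMOD P.M]) (i : Fin m) :
    ((P.blockData n m).graph i).Sat z ↔ P.point i z = z := by
  have hM : (0 : ℤ) < P.M := by exact_mod_cast P.M_pos
  have h1 : ∀ j : Fin (m - i), ∑ w : Fin (n + m), ((if w = tailVar i j then (P.M : ℤ) else 0) -
      P.coef n i (tailVar i j) w) * z w + -P.cst n i (tailVar i j) =
      P.M * (z (tailVar i j) - P.point i z (tailVar i j)) := fun j => by
    rw [mul_sub, P.M_mul_point hz]
    simp only [sub_mul, Finset.sum_sub_distrib, ite_mul, zero_mul, Finset.sum_ite_eq',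
      Finset.mem_univ, if_true]
    ring
  have h2 : ∀ j : Fin (m - i), ∑ w : Fin (n + m), (P.coef n i (tailVar i j) w -
      (if w = tailVar i j then (P.M : ℤ) else 0)) * z w + P.cst n i (tailVar i j) =
      P.M * (P.point i z (tailVar i j) - z (tailVar i j)) := fun j => by
    have := h1 j
    rw [← neg_inj, ← mul_neg, neg_sub, ← this, neg_add, ← Finset.sum_neg_distrib]
    simp only [← neg_mul, neg_sub]
    rfl
  have h3 : ((P.blockData n m).graph i).Sat z ↔
      ∀ j : Fin (m - i), P.point i z (tailVar i j) = z (tailVar i j) := by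
    unfold BlockData.graph
    rw [bigAnd_sat]
    simp only [List.mem_append, List.mem_ofFn, or_imp, forall_and, forall_exists_index,
      forall_apply_eq_imp_iff, Formula.Sat, Literal.Sat, substCoeff_blockData,
      substConst_blockData]
    change (∀ j : Fin (m - i), 0 ≤ ∑ w : Fin (n + m), ((if w = tailVar i j then (P.M : ℤ) else 0) -
      P.coef n i (tailVar i j) w) * z w + -P.cst n i (tailVar i j)) ∧
      (∀ j : Fin (m - i), 0 ≤ ∑ w : Fin (n + m), (P.coef n i (tailVar i j) w -
      (if w = tailVar i j then (P.M : ℤ) else 0)) * z w + P.cst n i (tailVar i j)) ↔ _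
    simp only [h1, h2, ← forall_and]
    refine forall_congr' fun j => ⟨fun ⟨h, h'⟩ => ?_, fun h => by simp [h]⟩
    have := nonneg_of_mul_nonneg_right h hM
    have := nonneg_of_mul_nonneg_right h' hM
    omega
  rw [h3]
  refine ⟨fun h => funext fun v => ?_, fun h j => by rw [h]⟩
  by_cases hv : (v : ℕ) < n + i
  · rw [point, if_pos hv]
  · have : v = tailVar i ⟨v - (n + i), by omega⟩ := Fin.ext (by simp [tailVar]; omega)
    rw [this]
    exact h _

theorem block_sat {z : Fin (n + m) → ℤ} {a : Fin (n + m) → ℤ} {b : ℤ} :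
    ((P.blockData n m).block (.ge a b)).Sat z ↔ (∀ v, z v ≡ P.r v [ZMOD P.M]) ∧
      ((Literal.ge a b).Sat z ∨ ∃ i : Fin m, P.point i z = z) ∧
      ∀ i : Fin m, (Literal.ge a b).Sat (P.point i z) := by
  have h : ((P.blockData n m).block (.ge a b)).Sat z ↔
      ((Literal.ge a b).Sat z ∨ ∃ i : Fin m, ((P.blockData n m).graph i).Sat z) ∧
      (∀ i : Fin m, ((P.blockData n m).subst i (.ge a b)).Sat z) ∧
      ∀ v, z v ≡ P.r v [ZMOD P.M] := by
    unfold BlockData.block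
    rw [bigAnd_sat]
    simp only [List.mem_cons, List.mem_append, List.mem_ofFn, or_imp, forall_and,
      forall_exists_index, forall_apply_eq_imp_iff, forall_eq, bigOr_sat, exists_eq_or_imp,
      Formula.Sat]
    refine and_congr (or_congr Iff.rfl ?_) (and_congr Iff.rfl (forall_congr' fun v => ?_))
    · exact ⟨fun ⟨φ, ⟨i, hi⟩, h⟩ => ⟨i, hi ▸ h⟩, fun ⟨i, h⟩ => ⟨_, ⟨i, rfl⟩, h⟩⟩
    · simp only [Literal.Sat, Pi.single_apply, ite_mul, one_mul, zero_mul, Finset.sum_ite_eq',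
        Finset.mem_univ, if_true]
      rfl
  rw [h]
  constructor
  · rintro ⟨h1, h2, h3⟩
    exact ⟨h3, h1.imp id fun ⟨i, hi⟩ => ⟨i, (P.graph_sat h3 i).1 hi⟩,
      fun i => (P.subst_sat h3 i a b).1 (h2 i)⟩
  · rintro ⟨h3, h1, h2⟩
    exact ⟨h1.imp id fun ⟨i, hi⟩ => ⟨i, (P.graph_sat h3 i).2 hi⟩,
      fun i => (P.subst_sat h3 i a b).2 (h2 i), h3⟩

theorem modEq_of_conv_sat {φ : Formula (n + m)} {z : Fin (n + m) → ℤ}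
    (h : (P.conv n m φ).Sat z) : ∀ v, z v ≡ P.r v [ZMOD P.M] := by
  induction φ with
  | lit l => exact (P.block_sat.1 h).1
  | and φ ψ ih1 ih2 => exact ih1 h.1
  | or φ ψ ih1 ih2 => exact h.elim ih1 ih2

/-- Replacing the literals by building blocks yields a stronger formula, which ensures moreover that
the affine maps are solution maps. -/
theorem sat_of_conv_sat {φ : Formula (n + m)} {z : Fin (n + m) → ℤ} (h : (P.conv n m φ).Sat z) :
    φ.Sat z ∧ ∀ i : Fin m, φ.Sat (P.point i z) := by
  have hz := P.modEq_of_conv_sat h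
  have hz' : ∀ v, z v ≡ P.r v [ZMOD P.N] := fun v =>
    (hz v).of_dvd ⟨P.D, by rw [M]; push_cast; ring⟩
  induction φ with
  | lit l =>
    obtain ⟨_, h1, h2⟩ := P.block_sat.1 h
    have h3 : ∀ i, l.Sat (P.point i z) := fun i => ((P.norm_sat (P.point_modEq hz i) l).1 (h2 i)).2
    refine ⟨?_, h3⟩
    rcases h1 with h1 | ⟨i, hi⟩
    · exact ((P.norm_sat hz' l).1 h1).2
    · have := h3 i
      rwa [hi] at this
  | and φ ψ ih1 ih2 =>
    exact ⟨⟨(ih1 h.1).1, (ih2 h.2).1⟩, fun i => ⟨(ih1 h.1).2 i, (ih2 h.2).2 i⟩⟩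
  | or φ ψ ih1 ih2 =>
    rcases h with h | h
    · exact ⟨.inl (ih1 h).1, fun i => .inl ((ih1 h).2 i)⟩
    · exact ⟨.inr (ih2 h).1, fun i => .inr ((ih2 h).2 i)⟩

/-- A solution of `φ` survives the replacement of literals by building blocks if the affine maps
preserve all literals that it satisfies. -/
theorem conv_sat_of_sat {φ : Formula (n + m)} {z : Fin (n + m) → ℤ} (h : φ.Sat z)
    (hz : ∀ v, z v ≡ P.r v [ZMOD P.M]) (hN : ∀ l ∈ φ.literals, l.modulus ∣ P.N)
    (hl : ∀ l ∈ φ.literals, l.Sat z → ∀ i : Fin m, l.Sat (P.point i z)) :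
    (P.conv n m φ).Sat z := by
  have hz' : ∀ v, z v ≡ P.r v [ZMOD P.N] := fun v =>
    (hz v).of_dvd ⟨P.D, by rw [M]; push_cast; ring⟩
  induction φ with
  | lit l =>
    have hmem : l ∈ (Formula.lit l).literals := List.mem_singleton_self l
    exact P.block_sat.2 ⟨hz, .inl ((P.norm_sat hz' l).2 ⟨hN l hmem, h⟩), fun i =>
      (P.norm_sat (P.point_modEq hz i) l).2 ⟨hN l hmem, hl l hmem h i⟩⟩
  | and φ ψ ih1 ih2 =>
    simp only [Formula.literals, List.mem_append] at hN hl
    exact ⟨ih1 h.1 (fun l h => hN l (.inl h)) fun l h => hl l (.inl h),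
      ih2 h.2 (fun l h => hN l (.inr h)) fun l h => hl l (.inr h)⟩
  | or φ ψ ih1 ih2 =>
    simp only [Formula.literals, List.mem_append] at hN hl
    exact h.imp (fun h => ih1 h (fun l h => hN l (.inl h)) fun l h => hl l (.inl h))
      fun h => ih2 h (fun l h => hN l (.inr h)) fun l h => hl l (.inr h)

/-! ### The syntactic normal form -/

theorem isCombination_conv (φ : Formula (n + m)) :
    (P.blockData n m).IsCombination (P.conv n m φ) := by
  induction φ with
  | lit l => exact .block _
  | and φ ψ ih1 ih2 => exact .and _ _ ih1 ih2
  | or φ ψ ih1 ih2 => exact .or _ _ ih1 ih2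

end Choice

theorem maxConjunctive_block {n m : ℕ} (P : BlockData n m) (l : Literal (n + m)) :
    (P.block l).maxConjunctive = [P.block l] := by
  unfold BlockData.block
  cases m with
  | zero =>
    rw [List.ofFn_zero, List.ofFn_zero, List.nil_append]
    cases List.ofFn fun v : Fin (n + 0) => Formula.lit (.cong (Pi.single v 1) (P.res v) P.M
      (P.res_lt v)) <;> rfl
  | succ m => rw [List.ofFn_succ (f := fun i => Formula.lit (P.subst i l)), List.cons_append]; rfl

theorem isCombination_of_mem_maxConjunctive {n m : ℕ} {P : BlockData n m} {φ χ : Formula (n + m)}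
    (hφ : P.IsCombination φ) (h : χ ∈ φ.maxConjunctive) : P.IsCombination χ := by
  induction hφ with
  | block l =>
    rw [maxConjunctive_block, List.mem_singleton] at h
    rw [h]
    exact .block l
  | and φ ψ h1 h2 =>
    rw [List.mem_singleton.1 h]
    exact .and φ ψ h1 h2
  | or φ ψ h1 h2 ih1 ih2 => exact (List.mem_append.1 h).elim ih1 ih2

namespace Choice

variable (P : Choice) {n m : ℕ}

/-- The modulo constraints in the building blocks of inequalities. -/
theorem eq_of_mem_literals_conv {φ : Formula (n + m)} {l : Literal (n + m)}
    (h : l ∈ (P.conv n m φ).literals) : (∃ a b, l = .ge a b) ∨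
      ∃ v : Fin (n + m), l = .cong (Pi.single v 1) (P.r v) P.M (P.r_lt_M v) := by
  induction φ with
  | lit l' =>
    rcases mem_literals_bigAnd h with h | ⟨χ, hχ, h⟩
    · exact .inl ⟨_, _, List.mem_singleton.1 h⟩
    · rw [List.mem_cons, List.mem_append, List.mem_ofFn, List.mem_ofFn] at hχ
      rcases hχ with rfl | ⟨i, rfl⟩ | ⟨v, rfl⟩
      · rcases mem_literals_bigOr h with h | ⟨χ, hχ, h⟩
        · exact .inl ⟨_, _, List.mem_singleton.1 h⟩
        · rw [List.mem_cons, List.mem_ofFn] at hχ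
          rcases hχ with rfl | ⟨i, rfl⟩
          · exact .inl ⟨_, _, List.mem_singleton.1 h⟩
          · rcases mem_literals_bigAnd h with h | ⟨χ, hχ, h⟩
            · exact .inl ⟨_, _, List.mem_singleton.1 h⟩
            · rw [List.mem_append, List.mem_ofFn, List.mem_ofFn] at hχ
              rcases hχ with ⟨j, rfl⟩ | ⟨j, rfl⟩ <;> exact .inl ⟨_, _, List.mem_singleton.1 h⟩
      · exact .inl ⟨_, _, List.mem_singleton.1 h⟩
      · exact .inr ⟨v, List.mem_singleton.1 h⟩
  | and φ ψ ih1 ih2 => exact (List.mem_append.1 h).elim ih1 ih2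
  | or φ ψ ih1 ih2 => exact (List.mem_append.1 h).elim ih1 ih2

end Choice

theorem exists_choice_of_mem_maxConjunctive {n m Q R : ℕ} {φ χ : Formula (n + m)} (hR : 0 < R)
    (h : χ ∈ (normalForm n m Q R φ).maxConjunctive) :
    ∃ j, χ ∈ ((Choice.ofIndex (Q, j)).conv n m φ).maxConjunctive := by
  obtain ⟨ψ, h1, h2⟩ := mem_maxConjunctive_bigOr (by simp; omega) h
  obtain ⟨j, _, rfl⟩ := List.mem_map.1 h1
  exact ⟨j, h2⟩

theorem isPSySyNF_normalForm {n m Q R : ℕ} (φ : Formula (n + m)) (hR : 0 < R) :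
    IsPSySyNF n m (normalForm n m Q R φ) := by
  refine ⟨fun i χ hχ => ?_, fun χ hχ => ?_⟩
  · obtain ⟨j, hj⟩ := exists_choice_of_mem_maxConjunctive hR hχ
    refine ⟨(Choice.ofIndex (Q, j)).M, fun l hl hv => ?_⟩
    rcases Choice.eq_of_mem_literals_conv _ (literals_subset_of_mem_maxConjunctive hj hl) with
      ⟨a, b, rfl⟩ | ⟨v, rfl⟩
    · exact hv.elim
    · have : Fin.natAdd n i = v := by
        by_contra h
        exact hv (Pi.single_eq_of_ne h 1)
      rw [this]
      exact ⟨_, _, rfl⟩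
  · obtain ⟨j, hj⟩ := exists_choice_of_mem_maxConjunctive hR hχ
    exact ⟨_, isCombination_of_mem_maxConjunctive (Choice.isCombination_conv _ φ) hj⟩

theorem areSolutionMaps_of_mem_maxConjunctive {n m : ℕ} (P : Choice) {φ χ : Formula (n + m)}
    (h : χ ∈ (P.conv n m φ).maxConjunctive) : (P.blockData n m).AreSolutionMaps φ χ := by
  intro z hz i
  have h1 := maxConjunctive_sat h hz
  have h2 := P.modEq_of_conv_sat h1
  refine ⟨P.point i z, fun w => ?_, fun j => P.eval_blockData h2 i j, (P.sat_of_conv_sat h1).2 i⟩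
  have : ((headVar i w : Fin (n + m)) : ℕ) < n + i := w.2
  rw [Choice.point, if_pos this]

/-! ### Small affine solutions of systems of linear inequalities -/

attribute [local instance] Matrix.seminormedAddCommGroup in
/-- Siegel's lemma, with a bound that does not depend on the number of rows. -/
theorem exists_small_kernel_vector {s H : ℕ} {κ : Type} [Fintype κ] (A : Matrix (Fin s) κ ℤ)
    (hs : s < Fintype.card κ) (hH : 1 ≤ H) (hA : ∀ t j, |A t j| ≤ H) :
    ∃ d : κ → ℤ, d ≠ 0 ∧ (∀ t, ∑ j, A t j * d j = 0) ∧
      ∀ j, |d j| ≤ ((Fintype.card κ * H) ^ Fintype.card κ : ℕ) := by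
  classical
  set k := Fintype.card κ with hk
  have hkH : 1 ≤ k * H := Nat.mul_pos (by omega) hH
  rcases Nat.eq_zero_or_pos s with rfl | hs0
  · obtain ⟨j₀⟩ : Nonempty κ := Fintype.card_pos_iff.1 (by omega)
    refine ⟨Pi.single j₀ 1, by simp, fun t => t.elim0, fun j => ?_⟩
    have h1 : 1 ≤ (k * H) ^ k := Nat.one_le_pow _ _ hkH
    rw [Pi.single_apply]
    split_ifs
    · rw [abs_one]; exact_mod_cast h1
    · rw [abs_zero]; positivity
  · obtain ⟨d, hd0, hd, hn⟩ := Int.Matrix.exists_ne_zero_int_vec_norm_le A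
      (by simpa using hs) (by simpa using hs0)
    refine ⟨d, hd0, fun t => congrFun hd t, fun j => ?_⟩
    have h1 : max 1 ‖A‖ ≤ H := by
      refine max_le (by exact_mod_cast hH) ((Matrix.norm_le_iff (by positivity)).2 fun t j => ?_)
      rw [Int.norm_eq_abs]
      exact_mod_cast hA t j
    have h2 : (1 : ℝ) ≤ k * H := by exact_mod_cast hkH
    have h3 : (k : ℝ) * max 1 ‖A‖ ≤ k * H := by gcongr
    have hs1 : (s : ℝ) + 1 ≤ k := by exact_mod_cast hs
    have h4 : (s : ℝ) / (k - s) ≤ k :=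
      (div_le_self (by positivity) (by linarith)).trans (by linarith)
    have h5 : ‖d j‖ ≤ ((k : ℝ) * H) ^ (k : ℝ) := by
      refine (norm_le_pi_norm d j).trans (hn.trans ?_)
      rw [Fintype.card_fin, ← hk]
      refine (Real.rpow_le_rpow (by positivity) h3 (div_nonneg (by positivity) (by linarith))).trans ?_
      exact Real.rpow_le_rpow_of_exponent_le h2 h4
    rw [Int.norm_eq_abs, Real.rpow_natCast] at h5
    exact_mod_cast h5

/-- If the columns of `C` are linearly independent, then a solution of `h + C v ≥ 0` can be moved,
within its residue class modulo `N`, to a solution at which a given number `s ≤ card κ` of linearly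
independent inequalities are tight up to a small error. The next inequality is found by moving from
the current solution, as far as possible, along a small integer vector on which the inequalities
found so far are constant. -/
theorem exists_small_slack {ι κ : Type} [Fintype κ] {C : ι → κ → ℤ} {h : ι → ℤ} {y : κ → ℤ}
    {H N : ℕ} (hH : 1 ≤ H) (hN : 0 < N) (hC : ∀ r j, |C r j| ≤ H)
    (hinj : ∀ d : κ → ℤ, (∀ r, ∑ j, C r j * d j = 0) → d = 0)
    (hy : ∀ r, 0 ≤ h r + ∑ j, C r j * y j) {s : ℕ} (hs : s ≤ Fintype.card κ) :
    ∃ v : κ → ℤ, (∀ j, v j ≡ y j [ZMOD N]) ∧ (∀ r, 0 ≤ h r + ∑ j, C r j * v j) ∧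
      ∃ e : Fin s → ι, LinearIndependent ℚ (fun t j => (C (e t) j : ℚ)) ∧
        ∀ t, h (e t) + ∑ j, C (e t) j * v j ≤
          (N * (Fintype.card κ * (H * (Fintype.card κ * H) ^ Fintype.card κ)) : ℕ) := by
  induction s with
  | zero => exact ⟨y, fun _ => Int.ModEq.refl _, hy, Fin.elim0, linearIndependent_empty_type,
      fun t => t.elim0⟩
  | succ s ih =>
    obtain ⟨v, hvy, hv, e, he, hsm⟩ := ih (by omega)
    set k := Fintype.card κ with hk
    obtain ⟨d, hd0, hd, hdb, hneg⟩ : ∃ d : κ → ℤ, d ≠ 0 ∧ (∀ t, ∑ j, C (e t) j * d j = 0) ∧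
        (∀ j, |d j| ≤ ((k * H) ^ k : ℕ)) ∧ ∃ r, ∑ j, C r j * d j < 0 := by
      obtain ⟨d, hd0, hd, hdb⟩ := exists_small_kernel_vector (fun t j => C (e t) j)
        (by omega) hH (fun t j => hC (e t) j)
      have : ∃ r, ∑ j, C r j * d j ≠ 0 := by
        by_contra! h
        exact hd0 (hinj d h)
      obtain ⟨r, hr⟩ := this
      rcases lt_or_gt_of_ne hr with hr | hr
      · exact ⟨d, hd0, hd, hdb, r, hr⟩
      · refine ⟨-d, neg_ne_zero.2 hd0, fun t => ?_, fun j => ?_, r, ?_⟩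
        · simp [hd t]
        · simpa using hdb j
        · simpa using hr
    set f : ι → ℤ := fun r => ∑ j, C r j * d j with hf
    have hfb : ∀ r, |f r| ≤ (k * (H * (k * H) ^ k) : ℕ) := fun r => by
      refine (Finset.abs_sum_le_sum_abs _ _).trans ?_
      have : ∀ j ∈ Finset.univ, |C r j * d j| ≤ ((H * (k * H) ^ k : ℕ) : ℤ) := fun j _ => by
        rw [abs_mul]
        push_cast
        have h1 := hdb j
        push_cast at h1
        exact mul_le_mul (hC r j) h1 (abs_nonneg _) (by positivity)
      refine (Finset.sum_le_card_nsmul _ _ _ this).trans ?_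
      rw [Finset.card_univ, ← hk, nsmul_eq_mul]
      push_cast
      exact le_rfl
    have hmove : ∀ (t : ℤ) r, h r + ∑ j, C r j * (v j + t * (N * d j)) =
        h r + ∑ j, C r j * v j + t * (N * f r) := fun t r => by
      simp only [hf, mul_add, Finset.sum_add_distrib, Finset.mul_sum]
      rw [add_assoc]
      congr 2
      exact Finset.sum_congr rfl fun j _ => by ring
    have hN' : (1 : ℤ) ≤ N := by exact_mod_cast hN
    -- The last point on the ray through `d` that is still a solution.
    obtain ⟨t, ht1, r', ht2⟩ : ∃ t : ℕ, (∀ r, 0 ≤ h r + ∑ j, C r j * v j + t * (N * f r)) ∧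
        ∃ r, h r + ∑ j, C r j * v j + (t + 1) * (N * f r) < 0 := by
      let p : ℕ → Prop := fun t => ∃ r, h r + ∑ j, C r j * v j + t * (N * f r) < 0
      have hp : ∃ t, p t := by
        obtain ⟨r, hr⟩ := hneg
        refine ⟨(h r + ∑ j, C r j * v j).toNat + 1, r, ?_⟩
        have h1 := hv r
        have h2 : (N : ℤ) * f r ≤ -1 := by
          have : f r ≤ -1 := by change ∑ j, C r j * d j ≤ -1; omega
          nlinarith
        push_cast
        rw [Int.toNat_of_nonneg h1]
        nlinarith
      classical
      have h0 : Nat.find hp ≠ 0 := fun h0 => by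
        obtain ⟨r, hr⟩ := Nat.find_spec hp
        rw [h0] at hr
        have := hv r
        simp at hr
        omega
      obtain ⟨t, ht⟩ := Nat.exists_eq_succ_of_ne_zero h0
      refine ⟨t, fun r => ?_, ?_⟩
      · have := Nat.find_min hp (m := t) (by omega)
        by_contra h1
        exact this ⟨r, by omega⟩
      · have := Nat.find_spec hp
        rw [ht] at this
        obtain ⟨r, hr⟩ := this
        exact ⟨r, by push_cast at hr; exact hr⟩
    have h1 := ht1 r'
    have hfr' : f r' < 0 := by
      by_contra! h2
      nlinarith [mul_nonneg (by positivity : (0 : ℤ) ≤ N) h2]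
    refine ⟨fun j => v j + t * (N * d j), fun j => ?_, fun r => ?_, Fin.cons r' e, ?_, ?_⟩
    · refine (Int.modEq_iff_dvd.2 ⟨-(t * d j), by ring⟩ : v j + t * (N * d j) ≡ v j [ZMOD N]).trans
        (hvy j)
    · rw [hmove]
      exact ht1 r
    · have h2 : (fun t j => (C ((Fin.cons r' e : Fin (s + 1) → ι) t) j : ℚ)) =
          (Fin.cons (fun j => (C r' j : ℚ)) (fun t j => (C (e t) j : ℚ)) : Fin (s + 1) → κ → ℚ) := by
        funext t
        refine Fin.cases ?_ (fun t => ?_) t <;> rfl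
      rw [h2, linearIndependent_finCons]
      refine ⟨he, fun hmem => ?_⟩
      let φ : (κ → ℚ) →ₗ[ℚ] ℚ := ∑ j, (d j : ℚ) • LinearMap.proj j
      have hφ : ∀ r, φ (fun j => (C r j : ℚ)) = f r := fun r => by
        simp only [φ, hf, LinearMap.sum_apply, LinearMap.smul_apply, LinearMap.proj_apply,
          smul_eq_mul]
        push_cast
        exact Finset.sum_congr rfl fun j _ => mul_comm _ _
      have h3 : Submodule.span ℚ (Set.range fun t j => (C (e t) j : ℚ)) ≤ LinearMap.ker φ := by
        rw [Submodule.span_le]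
        rintro _ ⟨t, rfl⟩
        change φ _ = 0
        rw [hφ]
        exact_mod_cast hd t
      have h4 : φ _ = 0 := h3 hmem
      rw [hφ] at h4
      exact hfr'.ne (by exact_mod_cast h4)
    · intro t'
      rw [hmove]
      refine Fin.cases ?_ (fun t' => ?_) t'
      · have h5 := hfb r'
        rw [abs_of_neg hfr'] at h5
        push_cast at h5 ⊢
        rw [Fin.cons_zero]
        nlinarith
      · rw [Fin.cons_succ]
        have : f (e t') = 0 := hd t'
        rw [this, mul_zero, mul_zero, add_zero]
        exact hsm t'

/-- A system of linear inequalities `b + B x + C y ≥ 0` that has a solution `(x, y)` has, for the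
same `x`, a solution `(x, v)` with `v` in the residue class of `y`, such that `v` is given by an
affine function of `x` with small coefficients. -/
theorem exists_small_affine_solution {ι κ ω : Type} [Fintype κ] [Fintype ω] {C : ι → κ → ℤ}
    {B : ι → ω → ℤ} {b : ι → ℤ} {x : ω → ℤ} {y : κ → ℤ} {H N : ℕ} (hH : 1 ≤ H) (hN : 0 < N)
    (hC : ∀ r j, |C r j| ≤ H) (hB : ∀ r w, |B r w| ≤ H) (hb : ∀ r, |b r| ≤ H)
    (hy : ∀ r, 0 ≤ b r + ∑ w, B r w * x w + ∑ j, C r j * y j) :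
    ∃ (Δ : ℤ) (U : κ → ω → ℤ) (g v : κ → ℤ), Δ ≠ 0 ∧
      |Δ| ≤ ((Fintype.card κ).factorial * H ^ Fintype.card κ : ℕ) ∧
      (∀ j w, |U j w| ≤
        (Fintype.card κ * ((Fintype.card κ).factorial * H ^ Fintype.card κ * H) : ℕ)) ∧
      (∀ j, |g j| ≤ (Fintype.card κ * ((Fintype.card κ).factorial * H ^ Fintype.card κ *
        (N * (Fintype.card κ * (H * (Fintype.card κ * H) ^ Fintype.card κ)) + H)) : ℕ)) ∧
      (∀ j, v j ≡ y j [ZMOD N]) ∧ (∀ r, 0 ≤ b r + ∑ w, B r w * x w + ∑ j, C r j * v j) ∧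
      ∀ j, Δ * v j = ∑ w, U j w * x w + g j := by
  classical
  set k := Fintype.card κ with hk
  -- Sign conditions on the unknowns make the columns linearly independent.
  let σ : κ → ℤ := fun j => if 0 ≤ y j then 1 else -1
  have hσ : ∀ j, |σ j| = 1 := fun j => by dsimp only [σ]; split_ifs <;> simp
  let C' : ι ⊕ κ → κ → ℤ := Sum.elim C fun j => Pi.single j (σ j)
  let B' : ι ⊕ κ → ω → ℤ := Sum.elim B fun _ _ => 0
  let b' : ι ⊕ κ → ℤ := Sum.elim b fun _ => 0
  have hC' : ∀ r j, |C' r j| ≤ H := by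
    rintro (r | i) j
    · exact hC r j
    · change |(Pi.single i (σ i) : κ → ℤ) j| ≤ H
      rw [Pi.single_apply]
      split_ifs
      · rw [hσ]; exact_mod_cast hH
      · simp
  have hB' : ∀ r w, |B' r w| ≤ H := by
    rintro (r | i) w
    · exact hB r w
    · simp [B']
  have hb' : ∀ r, |b' r| ≤ H := by
    rintro (r | i)
    · exact hb r
    · simp [b']
  have hsingle : ∀ i (d : κ → ℤ), ∑ j, C' (.inr i) j * d j = σ i * d i := fun i d => by
    simp [C', Pi.single_apply]
  have hinj : ∀ d : κ → ℤ, (∀ r, ∑ j, C' r j * d j = 0) → d = 0 := fun d hd => by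
    funext i
    have h1 := hd (.inr i)
    rw [hsingle] at h1
    rcases mul_eq_zero.1 h1 with h1 | h1
    · have := hσ i
      rw [h1] at this
      simp at this
    · exact h1
  have hy' : ∀ r, 0 ≤ (b' r + ∑ w, B' r w * x w) + ∑ j, C' r j * y j := by
    rintro (r | i)
    · exact hy r
    · rw [hsingle]
      simp only [b', B', Sum.elim_inr, zero_mul, Finset.sum_const_zero, zero_add, σ]
      split_ifs with h <;> omega
  obtain ⟨v, hvy, hv, e, he, hsm⟩ :=
    exists_small_slack (h := fun r => b' r + ∑ w, B' r w * x w) hH hN hC' hinj hy' hk.le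
  let E := (Fintype.equivFin κ)
  let e' : κ → ι ⊕ κ := fun i => e (E i)
  let A : Matrix κ κ ℤ := fun i j => C' (e' i) j
  have hdet : A.det ≠ 0 := by
    have h1 : LinearIndependent ℚ (A.map (Int.castRingHom ℚ)).row :=
      (he.comp E E.injective : LinearIndependent ℚ fun i j => (C' (e (E i)) j : ℚ))
    have h2 := (Matrix.isUnit_iff_isUnit_det _).1 (Matrix.linearIndependent_rows_iff_isUnit.1 h1)
    rw [← RingHom.mapMatrix_apply, ← RingHom.map_det] at h2
    intro h3
    rw [h3, map_zero] at h2
    exact not_isUnit_zero h2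
  have hadj : ∀ i j, |A.adjugate i j| ≤ (k.factorial * H ^ k : ℕ) := fun i j => by
    rw [Matrix.adjugate_apply]
    have h1 := Matrix.det_le (A := A.updateRow j (Pi.single i 1)) (abv := AbsoluteValue.abs)
      (x := (H : ℤ)) fun r c => by
        rw [AbsoluteValue.abs_apply, Matrix.updateRow_apply]
        split_ifs
        · rw [Pi.single_apply]
          split_ifs
          · rw [abs_one]; exact_mod_cast hH
          · simp
        · exact hC' _ _
    rw [AbsoluteValue.abs_apply, ← hk, nsmul_eq_mul] at h1
    exact_mod_cast h1
  have hdetb : |A.det| ≤ (k.factorial * H ^ k : ℕ) := by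
    have h1 := Matrix.det_le (A := A) (abv := AbsoluteValue.abs) (x := (H : ℤ))
      fun r c => hC' _ _
    rw [AbsoluteValue.abs_apply, ← hk, nsmul_eq_mul] at h1
    exact_mod_cast h1
  let q : κ → ℤ := fun i => b' (e' i) + ∑ w, B' (e' i) w * x w + ∑ j, C' (e' i) j * v j
  have hq0 : ∀ i, 0 ≤ q i := fun i => hv _
  have hq1 : ∀ i, q i ≤ (N * (k * (H * (k * H) ^ k)) : ℕ) := fun i => hsm _
  -- By Cramer's rule, `det A * v` is an integral linear function of `x` and of the small slacks `q`.
  have hcramer : ∀ j, A.det * v j =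
      ∑ i, A.adjugate j i * (q i - b' (e' i) - ∑ w, B' (e' i) w * x w) := fun j => by
    have h1 : A.mulVec v = fun i => q i - b' (e' i) - ∑ w, B' (e' i) w * x w := by
      funext i
      change ∑ j, C' (e' i) j * v j = _
      dsimp only [q]
      ring
    have h2 : A.adjugate.mulVec (A.mulVec v) = A.det • v := by
      rw [Matrix.mulVec_mulVec, Matrix.adjugate_mul, Matrix.smul_mulVec, Matrix.one_mulVec]
    rw [h1] at h2
    exact (congrFun h2 j).symm
  have hsum : ∀ (F : κ → ℤ) (K : ℕ), (∀ i, |F i| ≤ K) → |∑ i, F i| ≤ (k * K : ℕ) := fun F K hF => by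
    refine (Finset.abs_sum_le_sum_abs _ _).trans
      ((Finset.sum_le_card_nsmul _ _ _ fun i _ => hF i).trans ?_)
    rw [Finset.card_univ, ← hk, nsmul_eq_mul]
    push_cast
    exact le_rfl
  refine ⟨A.det, fun j w => ∑ i, A.adjugate j i * -B' (e' i) w,
    fun j => ∑ i, A.adjugate j i * (q i - b' (e' i)), v, hdet, hdetb, fun j w => ?_, fun j => ?_,
    hvy, fun r => hv (.inl r), fun j => ?_⟩
  · refine hsum _ _ fun i => ?_
    rw [abs_mul, abs_neg]
    have h1 := hadj j i
    push_cast at h1 ⊢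
    exact mul_le_mul h1 (hB' _ _) (abs_nonneg _) (by positivity)
  · refine hsum _ _ fun i => ?_
    rw [abs_mul]
    have h1 := hadj j i
    have h2 : |q i - b' (e' i)| ≤ (N * (k * (H * (k * H) ^ k)) + H : ℕ) := by
      have h3 := abs_le.1 (hb' (e' i))
      have h4 := hq0 i
      have h5 := hq1 i
      rw [abs_le]
      push_cast at h5 ⊢
      constructor <;> linarith
    rw [Nat.cast_mul]
    exact mul_le_mul h1 h2 (abs_nonneg _) (by positivity)
  · rw [hcramer]
    simp only [Finset.sum_mul]
    rw [Finset.sum_comm, ← Finset.sum_add_distrib]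
    refine Finset.sum_congr rfl fun i _ => ?_
    simp only [mul_assoc]
    rw [← Finset.mul_sum]
    simp only [neg_mul, Finset.sum_neg_distrib]
    ring

/-- The bounds of `exists_small_affine_solution` in terms of powers of two. -/
theorem exists_affine_solution_two_pow {ι κ ω : Type} [Fintype κ] [Fintype ω] {C : ι → κ → ℤ}
    {B : ι → ω → ℤ} {b : ι → ℤ} {x : ω → ℤ} {y : κ → ℤ} {S N : ℕ} (hκ : Fintype.card κ ≤ S)
    (hN : 0 < N) (hNS : N ≤ 2 ^ S) (hC : ∀ r j, |C r j| ≤ (2 ^ S : ℕ))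
    (hB : ∀ r w, |B r w| ≤ (2 ^ S : ℕ)) (hb : ∀ r, |b r| ≤ (2 ^ S : ℕ))
    (hy : ∀ r, 0 ≤ b r + ∑ w, B r w * x w + ∑ j, C r j * y j) :
    ∃ (Δ : ℤ) (U : κ → ω → ℤ) (g v : κ → ℤ), Δ ≠ 0 ∧ |Δ| ≤ (2 ^ (2 * S ^ 2) : ℕ) ∧
      (∀ j w, |U j w| ≤ (2 ^ (2 * S ^ 2 + 2 * S) : ℕ)) ∧
      (∀ j, |g j| ≤ (2 ^ (4 * S ^ 2 + 4 * S + 1) : ℕ)) ∧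
      (∀ j, v j ≡ y j [ZMOD N]) ∧ (∀ r, 0 ≤ b r + ∑ w, B r w * x w + ∑ j, C r j * v j) ∧
      ∀ j, Δ * v j = ∑ w, U j w * x w + g j := by
  obtain ⟨Δ, U, g, v, h0, h1, h2, h3, h4⟩ :=
    exists_small_affine_solution Nat.one_le_two_pow hN hC hB hb hy
  set k := Fintype.card κ
  have hk : k ≤ 2 ^ S := hκ.trans Nat.lt_two_pow_self.le
  have hkS : ∀ x : ℕ, 0 < x → x ^ k ≤ x ^ S := fun x hx => Nat.pow_le_pow_right hx hκ
  have hE : k.factorial * (2 ^ S) ^ k ≤ 2 ^ (2 * S ^ 2) :=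
    calc k.factorial * (2 ^ S) ^ k ≤ (2 ^ S) ^ S * (2 ^ S) ^ S :=
          Nat.mul_le_mul ((Nat.factorial_le_pow k).trans
            ((Nat.pow_le_pow_left hk k).trans (hkS _ (by positivity)))) (hkS _ (by positivity))
      _ = 2 ^ (2 * S ^ 2) := by rw [← pow_mul, ← pow_add]; congr 1; ring
  have hK : N * (k * (2 ^ S * (k * 2 ^ S) ^ k)) + 2 ^ S ≤ 2 ^ (2 * S ^ 2 + 3 * S + 1) :=
    calc N * (k * (2 ^ S * (k * 2 ^ S) ^ k)) + 2 ^ S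
        ≤ 2 ^ S * (2 ^ S * (2 ^ S * (2 ^ S * 2 ^ S) ^ S)) + 2 ^ S := by
          refine Nat.add_le_add_right (Nat.mul_le_mul hNS (Nat.mul_le_mul hk
            (Nat.mul_le_mul_left _ ?_))) _
          exact (Nat.pow_le_pow_left (Nat.mul_le_mul_right _ hk) k).trans (hkS _ (by positivity))
      _ = 2 ^ (2 * S ^ 2 + 3 * S) + 2 ^ S := by
          congr 1; rw [← pow_add, ← pow_mul, ← pow_add, ← pow_add, ← pow_add]; congr 1; ring
      _ ≤ 2 ^ (2 * S ^ 2 + 3 * S) + 2 ^ (2 * S ^ 2 + 3 * S) :=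
          Nat.add_le_add_left (Nat.pow_le_pow_right (by omega) (by nlinarith [Nat.zero_le (S ^ 2)])) _
      _ = 2 ^ (2 * S ^ 2 + 3 * S + 1) := by rw [pow_succ]; ring
  refine ⟨Δ, U, g, v, h0, h1.trans (by exact_mod_cast hE), fun j w => (h2 j w).trans ?_,
    fun j => (h3 j).trans ?_, h4⟩
  · rw [Nat.cast_le]
    calc _ ≤ 2 ^ S * (2 ^ (2 * S ^ 2) * 2 ^ S) := Nat.mul_le_mul hk (Nat.mul_le_mul_right _ hE)
      _ = _ := by rw [← pow_add, ← pow_add]; congr 1; ring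
  · rw [Nat.cast_le]
    calc _ ≤ 2 ^ S * (2 ^ (2 * S ^ 2) * 2 ^ (2 * S ^ 2 + 3 * S + 1)) :=
          Nat.mul_le_mul hk (Nat.mul_le_mul hE hK)
      _ = _ := by rw [← pow_add, ← pow_add]; congr 1; ring

/-! ### Every family of small parameters is enumerated -/

/-- Every sequence of `L` digits occurs. -/
theorem exists_digits {Q : ℕ} (L : ℕ) (f : ℕ → ℕ) (hf : ∀ c < L, f c < Q) :
    ∃ j < Q ^ L, ∀ c < L, (fun s => s / Q)^[c] j % Q = f c := by
  induction L generalizing f with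
  | zero => exact ⟨0, by simp, fun c hc => absurd hc (by omega)⟩
  | succ L ih =>
    obtain ⟨j, hj, h⟩ := ih (fun c => f (c + 1)) fun c hc => hf (c + 1) (by omega)
    have h0 := hf 0 (by omega)
    refine ⟨f 0 + Q * j, ?_, fun c hc => ?_⟩
    · calc f 0 + Q * j < Q + Q * j := by omega
        _ = Q * (j + 1) := by ring
        _ ≤ Q * Q ^ L := Nat.mul_le_mul_left _ hj
        _ = Q ^ (L + 1) := by ring
    · cases c with
      | zero => rw [Function.iterate_zero_apply, Nat.add_mul_mod_self_left, Nat.mod_eq_of_lt h0]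
      | succ c =>
        rw [Function.iterate_succ_apply, Nat.add_mul_div_left _ _ (by omega), Nat.div_eq_of_lt h0,
          zero_add]
        exact h c (by omega)

/-- A family with keys of bounded size is given by the digits of a number. -/
theorem exists_digit_eq {Q : ℕ} (hQ : 0 < Q) (k : ℕ) (F : ℕ → ℕ → ℕ → ℕ → ℕ) :
    ∃ j < Q ^ (k + 7) ^ 4, ∀ t i v w, t ≤ 6 → i ≤ k → v ≤ k → w ≤ k → F t i v w < Q →
      digit (Q, j) t i v w = F t i v w := by
  obtain ⟨j, hj, h⟩ := exists_digits ((k + 7) ^ 4) (fun c => F c.unpair.1.unpair.1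
    c.unpair.1.unpair.2 c.unpair.2.unpair.1 c.unpair.2.unpair.2 % Q) fun c _ => Nat.mod_lt _ hQ
  refine ⟨j, hj, fun t i v w ht hi hv hw hF => ?_⟩
  have hlt : ∀ a b, a < k + 7 → b < k + 7 → Nat.pair a b < (k + 7) ^ 2 := fun a b ha hb =>
    (Nat.pair_lt_max_add_one_sq a b).trans_le (Nat.pow_le_pow_left (by omega) 2)
  have hlt2 : Nat.pair (Nat.pair t i) (Nat.pair v w) < (k + 7) ^ 4 := by
    refine (Nat.pair_lt_max_add_one_sq _ _).trans_le ?_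
    have h1 := hlt t i (by omega) (by omega)
    have h2 := hlt v w (by omega) (by omega)
    calc (max (Nat.pair t i) (Nat.pair v w) + 1) ^ 2 ≤ ((k + 7) ^ 2) ^ 2 :=
          Nat.pow_le_pow_left (by omega) 2
      _ = _ := by ring
  have := h _ hlt2
  simp only [Nat.unpair_pair] at this
  rw [Nat.mod_eq_of_lt hF] at this
  exact this

namespace Choice

/-- Families of parameters below `Q` occur in the enumeration. -/
theorem exists_ofIndex (P : Choice) {k Q : ℕ} (hN : P.N ≤ Q) (hD : P.D ≤ Q)
    (hr : ∀ v ≤ k, P.r v < Q) (ha : ∀ i v w, i ≤ k → v ≤ k → w ≤ k → |P.a i v w| < Q)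
    (hc : ∀ i v, i ≤ k → v ≤ k → |P.c i v| < Q) :
    ∃ j < Q ^ (k + 7) ^ 4, (ofIndex (Q, j)).N = P.N ∧ (ofIndex (Q, j)).D = P.D ∧
      (∀ v ≤ k, (ofIndex (Q, j)).r v = P.r v) ∧
      (∀ i v w, i ≤ k → v ≤ k → w ≤ k → (ofIndex (Q, j)).a i v w = P.a i v w) ∧
      ∀ i v, i ≤ k → v ≤ k → (ofIndex (Q, j)).c i v = P.c i v := by
  have hN0 := P.N_pos
  have hD0 := P.D_pos
  obtain ⟨j, hj, h⟩ := exists_digit_eq (Q := Q) (by omega) k fun t i v w =>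
    match t with
    | 0 => P.N - 1
    | 1 => P.D - 1
    | 2 => P.r v
    | 3 => (P.a i v w).toNat
    | 4 => (-P.a i v w).toNat
    | 5 => (P.c i v).toNat
    | _ => (-P.c i v).toNat
  have h0 : digit (Q, j) 0 0 0 0 = P.N - 1 :=
    h 0 0 0 0 (by omega) (by omega) (by omega) (by omega) (show P.N - 1 < Q by omega)
  have h1 : digit (Q, j) 1 0 0 0 = P.D - 1 :=
    h 1 0 0 0 (by omega) (by omega) (by omega) (by omega) (show P.D - 1 < Q by omega)
  refine ⟨j, hj, ?_, ?_, fun v hv => ?_, fun i v w hi hv hw => ?_, fun i v hi hv => ?_⟩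
  · simp only [ofIndex, h0]
    omega
  · simp only [ofIndex, h1]
    omega
  · have h2 : digit (Q, j) 2 0 v 0 = P.r v :=
      h 2 0 v 0 (by omega) (by omega) hv (by omega) (hr v hv)
    simp only [ofIndex, h0, h1, h2]
    rw [Nat.sub_add_cancel hN0, Nat.sub_add_cancel hD0]
    exact Nat.mod_eq_of_lt (P.r_lt v)
  · have hb := abs_lt.1 (ha i v w hi hv hw)
    have h3 : digit (Q, j) 3 i v w = (P.a i v w).toNat :=
      h 3 i v w (by omega) hi hv hw (show (P.a i v w).toNat < Q by omega)
    have h4 : digit (Q, j) 4 i v w = (-P.a i v w).toNat :=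
      h 4 i v w (by omega) hi hv hw (show (-P.a i v w).toNat < Q by omega)
    simp only [ofIndex, h3, h4]
    omega
  · have hb := abs_lt.1 (hc i v hi hv)
    have h5 : digit (Q, j) 5 i v 0 = (P.c i v).toNat :=
      h 5 i v 0 (by omega) hi hv (by omega) (show (P.c i v).toNat < Q by omega)
    have h6 : digit (Q, j) 6 i v 0 = (-P.c i v).toNat :=
      h 6 i v 0 (by omega) hi hv (by omega) (show (-P.c i v).toNat < Q by omega)
    simp only [ofIndex, h5, h6]
    omega

theorem point_congr {P P' : Choice} {n m : ℕ} (hN : P'.N = P.N) (hD : P'.D = P.D)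
    (hr : ∀ v ≤ n + m, P'.r v = P.r v)
    (ha : ∀ i v w, i ≤ n + m → v ≤ n + m → w ≤ n + m → P'.a i v w = P.a i v w)
    (hc : ∀ i v, i ≤ n + m → v ≤ n + m → P'.c i v = P.c i v) (i : Fin m) (z : Fin (n + m) → ℤ) :
    P'.point i z = P.point i z := by
  have hM : P'.M = P.M := by rw [M, M, hN, hD]
  funext v
  simp only [point, hN, hM, hr _ v.2.le, hc i v (by omega) v.2.le]
  congr 4
  refine Finset.sum_congr rfl fun w _ => ?_
  rw [hr _ w.2.le, ha i v w (by omega) v.2.le w.2.le]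

end Choice

/-! ### Completeness of the enumeration -/

theorem sum_eq_head_add_tail {n m : ℕ} (i : Fin m) (f : Fin (n + m) → ℤ) :
    ∑ v, f v = ∑ w : Fin (n + i), f (headVar i w) + ∑ j : Fin (m - i), f (tailVar i j) := by
  have h : n + (i : ℕ) + (m - i) = n + m := by omega
  rw [← Equiv.sum_comp (finCongr h) f, Fin.sum_univ_add]
  rfl

theorem Choice.M_mul_point_tail (P : Choice) {n m : ℕ} {z : Fin (n + m) → ℤ}
    (hz : ∀ v, z v ≡ P.r v [ZMOD P.M]) (i : Fin m) (j : Fin (m - i)) :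
    P.M * P.point i z (tailVar i j) =
      P.N * (∑ w : Fin (n + i), P.a i (n + i + j) w * z (headVar i w) +
        (P.D * (P.r (n + i + j) + P.N * P.c i (n + i + j)) -
          ∑ w : Fin (n + i), P.a i (n + i + j) w * P.r w)) := by
  have hv : ¬ n + (i : ℕ) + j < n + i := by omega
  have h1 := P.M_mul_point hz i (tailVar i j)
  have h2 : ∀ v, ((tailVar i j : Fin (n + m)) : ℕ) = v → P.M * P.point i z (tailVar i j) =
      ∑ w : Fin (n + m), P.coef n i v w * z w + P.cst n i v := fun v hv => by rw [← hv, h1]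
  rw [h2 _ rfl, sum_eq_head_add_tail i]
  change ∑ w : Fin (n + i), P.coef n i (n + i + j) w * z (headVar i w) +
    ∑ w : Fin (m - i), P.coef n i (n + i + j) (n + i + w) * z (tailVar i w) +
      P.cst n i (n + i + j) = _
  have h3 : ∀ w : Fin (m - i), P.coef n i (n + i + j) (n + i + w) = 0 := fun w => by
    rw [P.coef_tail n hv, if_neg (by omega)]
  simp only [h3, zero_mul, Finset.sum_const_zero, P.cst_tail n hv, P.coef_tail n hv, Fin.is_lt,
    if_true]
  simp only [mul_assoc, ← Finset.mul_sum]
  ring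

/-- The coefficients and the constant term of an inequality, and zero for modulo constraints. -/
def Literal.row {k : ℕ} : Literal k → (Fin k → ℤ) × ℤ
  | .ge a b => (a, b)
  | _ => (0, 0)

theorem Literal.row_nonneg {k : ℕ} {l : Literal k} {z : Fin k → ℤ} (h : l.Sat z) :
    0 ≤ ∑ v, l.row.1 v * z v + l.row.2 := by
  cases l with
  | ge a b => exact h
  | cong a r N _ => simp [Literal.row]
  | ncong a r N _ => simp [Literal.row]

theorem Literal.sat_of_row {k N : ℕ} {l : Literal k} {z z' : Fin k → ℤ} (h : l.Sat z)
    (hN : l.modulus ∣ N) (hz : ∀ v, z' v ≡ z v [ZMOD N])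
    (hrow : 0 ≤ ∑ v, l.row.1 v * z' v + l.row.2) : l.Sat z' := by
  have hsum : ∀ a : Fin k → ℤ, ∑ v, a v * z' v ≡ ∑ v, a v * z v [ZMOD l.modulus] := fun a =>
    Int.ModEq.of_dvd (Int.natCast_dvd_natCast.2 hN)
      (Int.ModEq.sum fun v _ => (hz v).mul_left (a v))
  cases l with
  | ge a b => exact hrow
  | cong a r N' _ => exact (hsum a).trans h
  | ncong a r N' _ => exact fun h' => h ((hsum a).symm.trans h')

/-- The exponent of the bound for the parameters. -/
def paramExp (S : ℕ) : ℕ := 4 * S ^ 3 + 4 * S ^ 2 + 4 * S + 5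

/-- Small parameters such that the affine maps preserve all literals that hold at a given point. For
each `i`, these literals are regarded as a system in `y^i` with parameters `x^i`; the given point
yields a solution with small coefficients, and the denominators are multiplied. -/
theorem exists_choice {n m S N : ℕ} {L : List (Literal (n + m))} {z : Fin (n + m) → ℤ}
    (hS : n + m ≤ S) (hN : 0 < N) (hNS : N ≤ 2 ^ S) (hmod : ∀ l ∈ L, l.modulus ∣ N)
    (hrow : ∀ l ∈ L, (∀ v, |l.row.1 v| ≤ (2 ^ S : ℕ)) ∧ |l.row.2| ≤ (2 ^ S : ℕ)) :
    ∃ P : Choice, P.N = N ∧ P.D ≤ 2 ^ paramExp S ∧ (∀ v, P.r v < 2 ^ paramExp S) ∧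
      (∀ i v w, |P.a i v w| < (2 ^ paramExp S : ℕ)) ∧ (∀ i v, |P.c i v| < (2 ^ paramExp S : ℕ)) ∧
      (∀ v, z v ≡ P.r v [ZMOD P.M]) ∧ ∀ l ∈ L, l.Sat z → ∀ i : Fin m, l.Sat (P.point i z) := by
  let ι := {l : Literal (n + m) // l ∈ L ∧ l.Sat z}
  have hsol : ∀ i : Fin m, ∃ (Δ : ℤ) (U : Fin (m - i) → Fin (n + i) → ℤ) (g v : Fin (m - i) → ℤ),
      Δ ≠ 0 ∧ |Δ| ≤ (2 ^ (2 * S ^ 2) : ℕ) ∧ (∀ j w, |U j w| ≤ (2 ^ (2 * S ^ 2 + 2 * S) : ℕ)) ∧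
      (∀ j, |g j| ≤ (2 ^ (4 * S ^ 2 + 4 * S + 1) : ℕ)) ∧
      (∀ j, v j ≡ z (tailVar i j) [ZMOD N]) ∧
      (∀ r : ι, 0 ≤ r.1.row.2 + ∑ w, r.1.row.1 (headVar i w) * z (headVar i w) +
        ∑ j, r.1.row.1 (tailVar i j) * v j) ∧
      ∀ j, Δ * v j = ∑ w, U j w * z (headVar i w) + g j := fun i =>
    exists_affine_solution_two_pow (by rw [Fintype.card_fin]; omega) hN hNS
      (fun r j => (hrow r.1 r.2.1).1 _) (fun r w => (hrow r.1 r.2.1).1 _)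
      (fun r => (hrow r.1 r.2.1).2) fun r => by
        have := Literal.row_nonneg r.2.2
        rw [sum_eq_head_add_tail i] at this
        linarith
  choose Δ U g y hΔ0 hΔ hU hg hyz hy hUy using hsol
  -- A common denominator.
  let D : ℕ := ∏ i, (Δ i).natAbs
  have hD0 : 0 < D := Finset.prod_pos fun i _ => Int.natAbs_pos.2 (hΔ0 i)
  have hDb : D ≤ 2 ^ (2 * S ^ 3) := by
    calc D ≤ ∏ _i : Fin m, 2 ^ (2 * S ^ 2) := Finset.prod_le_prod' fun i _ => by
          have := hΔ i
          rw [Int.abs_eq_natAbs] at this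
          exact_mod_cast this
      _ = 2 ^ (2 * S ^ 2 * m) := by
          rw [Finset.prod_const, Finset.card_univ, Fintype.card_fin]
          exact (pow_mul _ _ _).symm
      _ ≤ 2 ^ (2 * S ^ 3) := Nat.pow_le_pow_right (by omega) (by
          calc 2 * S ^ 2 * m ≤ 2 * S ^ 2 * S := Nat.mul_le_mul_left _ (by omega)
            _ = 2 * S ^ 3 := by ring)
  have hdvd : ∀ i, ∃ δ : ℤ, (D : ℤ) = Δ i * δ := fun i => by
    have h1 : (Δ i).natAbs ∣ D := Finset.dvd_prod_of_mem (fun i => (Δ i).natAbs) (Finset.mem_univ i)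
    exact Int.natAbs_dvd.1 (Int.natCast_dvd_natCast.2 h1)
  choose δ hδ using hdvd
  have hδb : ∀ i, |δ i| ≤ (2 ^ (2 * S ^ 3) : ℕ) := fun i => by
    have h1 : |δ i| ≤ |Δ i * δ i| := by
      rw [abs_mul]
      exact le_mul_of_one_le_left (abs_nonneg _) (Int.one_le_abs (hΔ0 i))
    rw [← hδ i, Nat.abs_cast] at h1
    exact h1.trans (by exact_mod_cast hDb)
  have hM0 : (0 : ℤ) < (D * N : ℕ) := by exact_mod_cast Nat.mul_pos hD0 hN
  let r : ℕ → ℕ := fun v => if h : v < n + m then (z ⟨v, h⟩ % (D * N : ℕ)).toNat else 0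
  have hr : ∀ v, r v < D * N := fun v => by
    dsimp only [r]
    split_ifs with h
    · have := Int.emod_lt_of_pos (z ⟨v, h⟩) hM0
      have := Int.emod_nonneg (z ⟨v, h⟩) hM0.ne'
      omega
    · exact Nat.mul_pos hD0 hN
  have hrz : ∀ v : Fin (n + m), z v ≡ r v [ZMOD (D * N : ℕ)] := fun v => by
    have h1 : (r v : ℤ) = z v % (D * N : ℕ) := by
      dsimp only [r]
      rw [dif_pos v.2, Int.toNat_of_nonneg (Int.emod_nonneg _ hM0.ne')]
    rw [h1]
    exact (Int.mod_modEq _ _).symm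
  have hrb : ∀ v, r v < 2 ^ (2 * S ^ 3 + S) := fun v => by
    rw [pow_add]
    exact (hr v).trans_le (Nat.mul_le_mul hDb hNS)
  let a : ℕ → ℕ → ℕ → ℤ := fun i v w =>
    if h : i < m ∧ v < n + m ∧ w < n + i then
      δ ⟨i, h.1⟩ * U ⟨i, h.1⟩ ⟨v - (n + i), by dsimp only; omega⟩ ⟨w, h.2.2⟩ else 0
  have ha : ∀ (i : Fin m) (j : Fin (m - i)) (w : Fin (n + i)),
      a i (n + i + j) w = δ i * U i j w := fun i j w => by
    dsimp only [a]
    rw [dif_pos ⟨i.2, by omega, w.2⟩]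
    rw [show (⟨n + i + j - (n + i), by omega⟩ : Fin (m - i)) = j from
      Fin.ext (Nat.add_sub_cancel_left ..)]
  have hab : ∀ i v w, |a i v w| ≤ (2 ^ (2 * S ^ 3 + 2 * S ^ 2 + 2 * S) : ℕ) := fun i v w => by
    dsimp only [a]
    split_ifs with h
    · rw [abs_mul, add_assoc, pow_add, Nat.cast_mul]
      exact mul_le_mul (hδb _) (hU _ _ _) (abs_nonneg _) (by positivity)
    · rw [abs_zero]; positivity
  -- `D * N * c i v` for the parameters `c` below; it is divisible by `D * N` because the solutions
  -- `y i` are congruent to the residues modulo `N`.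
  let X : ℕ → ℕ → ℤ := fun i v =>
    if h : i < m ∧ v < n + m then
      δ ⟨i, h.1⟩ * g ⟨i, h.1⟩ ⟨v - (n + i), by dsimp only; omega⟩ - D * r v +
        ∑ w : Fin (n + i), a i v w * r w else 0
  have hX : ∀ (i : Fin m) (j : Fin (m - i)), X i (n + i + j) =
      δ i * g i j - D * r (n + i + j) + ∑ w : Fin (n + i), a i (n + i + j) w * r w := fun i j => by
    dsimp only [X]
    rw [dif_pos ⟨i.2, by omega⟩]
    congr 4
    exact Fin.ext (by dsimp only; omega)
  have hXb : ∀ i v, |X i v| < (2 ^ paramExp S : ℕ) := fun i v => by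
    have hpos : (0 : ℤ) < (2 ^ paramExp S : ℕ) := by positivity
    dsimp only [X]
    split_ifs with h
    · have h1 : |δ ⟨i, h.1⟩ * g ⟨i, h.1⟩ ⟨v - (n + i), by dsimp only; omega⟩| ≤
          (2 ^ (4 * S ^ 3 + 4 * S ^ 2 + 4 * S + 1) : ℕ) := by
        refine le_trans (b := ((2 ^ (2 * S ^ 3) * 2 ^ (4 * S ^ 2 + 4 * S + 1) : ℕ) : ℤ)) ?_ ?_
        · rw [abs_mul, Nat.cast_mul]
          exact mul_le_mul (hδb _) (hg _ _) (abs_nonneg _) (by positivity)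
        · rw [← pow_add, Nat.cast_le]
          exact Nat.pow_le_pow_right (by omega) (by omega)
      have h2 : |(D : ℤ) * r v| ≤ (2 ^ (4 * S ^ 3 + 4 * S ^ 2 + 4 * S + 1) : ℕ) := by
        rw [← Nat.cast_mul, Nat.abs_cast, Nat.cast_le]
        refine (Nat.mul_le_mul hDb (hrb v).le).trans ?_
        rw [← pow_add]
        exact Nat.pow_le_pow_right (by omega) (by omega)
      have h3 : |∑ w : Fin (n + i), a i v w * (r w : ℤ)| ≤
          (2 ^ (4 * S ^ 3 + 4 * S ^ 2 + 4 * S + 1) : ℕ) := by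
        refine (Finset.abs_sum_le_sum_abs _ _).trans ((Finset.sum_le_card_nsmul _ _
          ((2 ^ (2 * S ^ 3 + 2 * S ^ 2 + 2 * S) * 2 ^ (2 * S ^ 3 + S) : ℕ) : ℤ)
          fun w _ => ?_).trans ?_)
        · rw [abs_mul, Nat.abs_cast, Nat.cast_mul]
          exact mul_le_mul (hab _ _ _) (by exact_mod_cast (hrb w).le) (by positivity)
            (by positivity)
        · rw [Finset.card_univ, Fintype.card_fin, nsmul_eq_mul, ← Nat.cast_mul, Nat.cast_le]
          have h4 : n + i ≤ 2 ^ S := (by omega : n + i ≤ S).trans Nat.lt_two_pow_self.le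
          refine (Nat.mul_le_mul_right _ h4).trans ?_
          rw [← pow_add, ← pow_add]
          exact Nat.pow_le_pow_right (by omega) (by nlinarith [Nat.zero_le (S ^ 2)])
      have h5 : ((2 ^ paramExp S : ℕ) : ℤ) = 16 * (2 ^ (4 * S ^ 3 + 4 * S ^ 2 + 4 * S + 1) : ℕ) := by
        rw [paramExp]
        push_cast
        ring
      have h6 : (0 : ℤ) < (2 ^ (4 * S ^ 3 + 4 * S ^ 2 + 4 * S + 1) : ℕ) := by positivity
      have h7 := abs_add_le (δ ⟨i, h.1⟩ * g ⟨i, h.1⟩ ⟨v - (n + i), by dsimp only; omega⟩ - D * r v)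
        (∑ w : Fin (n + i), a i v w * (r w : ℤ))
      have h8 := abs_sub (δ ⟨i, h.1⟩ * g ⟨i, h.1⟩ ⟨v - (n + i), by dsimp only; omega⟩)
        ((D : ℤ) * r v)
      linarith
    · rwa [abs_zero]
  have hDy : ∀ (i : Fin m) (j : Fin (m - i)), (D : ℤ) * y i j =
      ∑ w : Fin (n + i), a i (n + i + j) w * z (headVar i w) + δ i * g i j := fun i j => by
    simp only [ha]
    rw [hδ i, mul_comm (Δ i), mul_assoc, hUy, mul_add, Finset.mul_sum]
    simp only [mul_assoc]
  have hdvdX : ∀ (i : Fin m) (j : Fin (m - i)), ((D * N : ℕ) : ℤ) ∣ X i (n + i + j) := fun i j => by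
    have h1 : X i (n + i + j) = D * (y i j - r (n + i + j)) -
        ∑ w : Fin (n + i), a i (n + i + j) w * (z (headVar i w) - r w) := by
      rw [hX, mul_sub, hDy]
      simp only [mul_sub, Finset.sum_sub_distrib]
      ring
    rw [h1]
    refine dvd_sub ?_ (Finset.dvd_sum fun w _ => Dvd.dvd.mul_left ?_ _)
    · rw [Nat.cast_mul]
      refine mul_dvd_mul_left _ ?_
      have h2 : z (tailVar i j) ≡ r (n + i + j) [ZMOD N] :=
        (hrz (tailVar i j)).of_dvd ⟨D, by push_cast; ring⟩
      exact ((hyz i j).trans h2).symm.dvd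
    · exact (hrz (headVar i w)).symm.dvd
  let P : Choice :=
    { N := N, D := D, N_pos := hN, D_pos := hD0, r := r, r_lt := hr, a := a,
      c := fun i v => X i v / (D * N : ℕ) }
  have hzP : ∀ v, z v ≡ P.r v [ZMOD P.M] := hrz
  have hpoint : ∀ (i : Fin m) (j : Fin (m - i)), P.point i z (tailVar i j) = y i j := fun i j => by
    have h1 := P.M_mul_point_tail hzP i j
    have h2 : (D * N : ℕ) * (X i (n + i + j) / (D * N : ℕ)) = X i (n + i + j) :=
      Int.mul_ediv_cancel' (hdvdX i j)
    have h3 := hX i j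
    have h4 := hDy i j
    refine mul_left_cancel₀ hM0.ne' (h1.trans ?_)
    change (N : ℤ) * (∑ w : Fin (n + i), a i (n + i + j) w * z (headVar i w) +
      (D * (r (n + i + j) + N * (X i (n + i + j) / (D * N : ℕ))) -
        ∑ w : Fin (n + i), a i (n + i + j) w * (r w : ℤ))) = (D * N : ℕ) * y i j
    push_cast at h2 ⊢
    linear_combination (N : ℤ) * h2 + (N : ℤ) * h3 - (N : ℤ) * h4
  have hle : ∀ e, e ≤ 4 * S ^ 3 + 4 * S ^ 2 + 4 * S → 2 ^ e < 2 ^ paramExp S := fun e he =>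
    Nat.pow_lt_pow_right (by omega) (by rw [paramExp]; omega)
  refine ⟨P, rfl, hDb.trans (hle _ (by omega)).le, fun v => (hrb v).trans (hle _ (by nlinarith)),
    fun i v w => (hab i v w).trans_lt (by exact_mod_cast hle _ (by omega)), fun i v => ?_, hzP,
    fun l hl hlz i => ?_⟩
  · refine lt_of_le_of_lt ?_ (hXb i v)
    change |X i v / (D * N : ℕ)| ≤ _
    have := Int.natAbs_ediv_le_natAbs (X i v) (D * N : ℕ)
    rw [Int.abs_eq_natAbs, Int.abs_eq_natAbs]
    exact_mod_cast this
  · have hhead : ∀ w : Fin (n + i), P.point i z (headVar i w) = z (headVar i w) := fun w =>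
      if_pos w.2
    refine Literal.sat_of_row hlz (hmod l hl) (fun v => ?_) ?_
    · exact (P.point_modEq hzP i v).trans
        ((hzP v).of_dvd ⟨D, by rw [Choice.M]; push_cast; ring⟩ : z v ≡ P.r v [ZMOD N]).symm
    · rw [sum_eq_head_add_tail i]
      simp only [hhead, hpoint]
      have := hy i ⟨l, hl, hlz⟩
      linarith

/-! ### Sizes of constants and encodings -/

theorem Literal.modulus_pos {k : ℕ} (l : Literal k) : 0 < l.modulus := by
  cases l with
  | ge a b => exact Nat.one_pos
  | cong a r N h => exact Nat.zero_lt_of_lt h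
  | ncong a r N h => exact Nat.zero_lt_of_lt h

theorem Literal.modulus_le {k : ℕ} (l : Literal k) : l.modulus ≤ 2 ^ l.bits := by
  cases l with
  | ge a b => exact Nat.one_le_two_pow
  | cong a r N h => exact (lt_two_pow_of_bitLength_le (a := N) (Nat.le_add_left _ _)).le
  | ncong a r N h => exact (lt_two_pow_of_bitLength_le (a := N) (Nat.le_add_left _ _)).le

theorem Literal.abs_row_le {k S : ℕ} (l : Literal k) (h : l.bits ≤ S) :
    (∀ v, |l.row.1 v| ≤ (2 ^ S : ℕ)) ∧ |l.row.2| ≤ (2 ^ S : ℕ) := by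
  cases l with
  | ge a b =>
    rw [Literal.bits] at h
    have key : ∀ c : ℤ, bitLength c ≤ S → |c| ≤ (2 ^ S : ℕ) := fun c hc => by
      rw [Int.abs_eq_natAbs, Nat.cast_le]
      exact (lt_two_pow_of_bitLength_le hc).le
    exact ⟨fun v => key (a v) ((Finset.single_le_sum (f := fun v => bitLength (a v))
      (fun _ _ => Nat.zero_le _) (Finset.mem_univ v)).trans ((Nat.le_add_right _ _).trans h)),
      key b ((Nat.le_add_left _ _).trans h)⟩
  | cong a r N _ => simp [Literal.row]
  | ncong a r N _ => simp [Literal.row]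

/-- A common multiple of the moduli of all literals. -/
def Formula.modulus {k : ℕ} (φ : Formula k) : ℕ := (φ.literals.map Literal.modulus).prod

theorem Formula.modulus_pos {k : ℕ} (φ : Formula k) : 0 < φ.modulus :=
  List.prod_pos fun _ h => by
    obtain ⟨l, _, rfl⟩ := List.mem_map.1 h
    exact l.modulus_pos

theorem Formula.dvd_modulus {k : ℕ} (φ : Formula k) {l : Literal k} (h : l ∈ φ.literals) :
    l.modulus ∣ φ.modulus :=
  List.dvd_prod (List.mem_map_of_mem h)

theorem Formula.modulus_le {k : ℕ} (φ : Formula k) : φ.modulus ≤ 2 ^ φ.nodesAndBits := by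
  have key : ∀ a b c d : ℕ, a ≤ 2 ^ c → b ≤ 2 ^ d → a * b ≤ 2 ^ (1 + c + d) := fun a b c d h1 h2 => by
    refine (Nat.mul_le_mul h1 h2).trans ?_
    rw [← pow_add]
    exact Nat.pow_le_pow_right (by omega) (by omega)
  induction φ with
  | lit l =>
    rw [modulus, literals, List.map_singleton, List.prod_singleton]
    exact l.modulus_le.trans (Nat.pow_le_pow_right (by omega) (Nat.le_add_left _ _))
  | and φ ψ ih1 ih2 =>
    rw [modulus, literals, List.map_append, List.prod_append]
    exact key _ _ _ _ ih1 ih2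
  | or φ ψ ih1 ih2 =>
    rw [modulus, literals, List.map_append, List.prod_append]
    exact key _ _ _ _ ih1 ih2

theorem size_encodeNat (n : ℕ) :
    2 * n.size + 1 ≤ (encodeNat n).size ∧ (encodeNat n).size ≤ 4 * n.size + 1 := by
  rw [encodeNat, ← Nat.size_eq_bits_len]
  induction n.bits with
  | nil => exact ⟨le_rfl, le_rfl⟩
  | cons b l ih =>
    have hb : 1 ≤ (encodeBool b).size ∧ (encodeBool b).size ≤ 3 := by
      cases b <;> exact ⟨by decide, by decide⟩
    simp only [List.map_cons, encodeList, BinTree.size, List.length_cons]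
    omega

theorem size_encodeInt (a : ℤ) :
    bitLength a ≤ (encodeInt a).size ∧ (encodeInt a).size ≤ 5 * bitLength a := by
  have hb : ∀ b, 1 ≤ (encodeBool b).size ∧ (encodeBool b).size ≤ 3 := by
    intro b
    cases b <;> exact ⟨by decide, by decide⟩
  have h1 := hb (decide (a < 0))
  have h2 := size_encodeNat a.natAbs
  simp only [encodeInt, BinTree.size, bitLength]
  omega

theorem size_encodeCoeffs {k : ℕ} (a : Fin k → ℤ) : ∑ v, bitLength (a v) ≤ (encodeCoeffs a).size ∧
    (encodeCoeffs a).size ≤ 6 * ∑ v, bitLength (a v) + 1 := by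
  have h1 : ∑ v, bitLength (a v) ≤ ∑ v, (encodeInt (a v)).size :=
    Finset.sum_le_sum fun v _ => (size_encodeInt (a v)).1
  have h2 : ∑ v, (encodeInt (a v)).size ≤ 5 * ∑ v, bitLength (a v) := by
    rw [Finset.mul_sum]
    exact Finset.sum_le_sum fun v _ => (size_encodeInt (a v)).2
  have h3 : k ≤ ∑ v, bitLength (a v) := by
    refine le_trans (by simp) (Finset.sum_le_sum (f := fun _ => 1) fun v _ => ?_)
    exact Nat.le_add_right _ _
  rw [encodeCoeffs, size_encodeList, List.map_ofFn, List.sum_ofFn, List.length_ofFn]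
  simp only [Function.comp_apply]
  omega

theorem size_encodeFormula {k : ℕ} (φ : Formula k) : φ.nodesAndBits ≤ (encodeFormula φ).size ∧
    (encodeFormula φ).size ≤ 11 * φ.nodesAndBits := by
  have hn : ∀ r : ℕ, bitLength r ≤ (encodeNat r).size ∧ (encodeNat r).size ≤ 4 * bitLength r :=
    fun r => by
      have := size_encodeNat r
      simp only [bitLength, Int.natAbs_natCast]
      omega
  induction φ with
  | lit l =>
    cases l with
    | ge a b =>
      have h1 := size_encodeCoeffs a
      have h2 := size_encodeInt b
      simp only [encodeFormula, encodeLiteral, BinTree.size, encodeUnary_size,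
        Formula.nodesAndBits, Literal.bits]
      omega
    | cong a r N h =>
      have h1 := size_encodeCoeffs a
      have h2 := hn r
      have h3 := hn N
      simp only [encodeFormula, encodeLiteral, BinTree.size, encodeUnary_size,
        Formula.nodesAndBits, Literal.bits]
      omega
    | ncong a r N h =>
      have h1 := size_encodeCoeffs a
      have h2 := hn r
      have h3 := hn N
      simp only [encodeFormula, encodeLiteral, BinTree.size, encodeUnary_size,
        Formula.nodesAndBits, Literal.bits]
      omega
  | and φ ψ ih1 ih2 =>
    simp only [encodeFormula, BinTree.size, encodeUnary_size, Formula.nodesAndBits]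
    omega
  | or φ ψ ih1 ih2 =>
    simp only [encodeFormula, BinTree.size, encodeUnary_size, Formula.nodesAndBits]
    omega

theorem size_encodeSpec {n m : ℕ} (φ : Formula (n + m)) : n + m ≤ (encodeSpec n m φ).size ∧
    φ.nodesAndBits ≤ (encodeSpec n m φ).size ∧ (encodeSpec n m φ).size ≤ 11 * φ.size + 4 := by
  have := size_encodeFormula φ
  simp only [encodeSpec, BinTree.size, encodeUnary_size, Formula.size]
  omega

theorem digit_lt {Q : ℕ} (hQ : 0 < Q) (j t i v w : ℕ) : digit (Q, j) t i v w < Q :=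
  Nat.mod_lt _ hQ

namespace Choice

theorem bitLength_num_den_le (P : Choice) {z : ℤ} {e : ℕ} (hM : P.M < 2 ^ e)
    (hz : z.natAbs < 2 ^ e) : bitLength ((z : ℚ) / P.M).num ≤ e + 1 ∧
      bitLength ((z : ℚ) / P.M).den ≤ e + 1 := by
  have h1 : ((z : ℚ) / P.M).num.natAbs ≤ z.natAbs := by
    rcases eq_or_ne z 0 with rfl | h0
    · simp
    · have h := Rat.num_dvd z (b := P.M) (by exact_mod_cast P.M_pos.ne')
      rw [Rat.divInt_eq_div, Int.cast_natCast] at h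
      exact Nat.le_of_dvd (Int.natAbs_pos.2 h0) (Int.natAbs_dvd_natAbs.2 h)
  have h2 : ((z : ℚ) / P.M).den ≤ P.M := Nat.le_of_dvd P.M_pos (P.den_dvd z)
  have h3 := Nat.size_le.2 (h1.trans_lt hz)
  have h4 := Nat.size_le.2 (h2.trans_lt hM)
  simp only [bitLength, Int.natAbs_natCast]
  omega

/-- The coefficients of the affine maps are small, since they are computed from digits in base
`2 ^ q`. -/
theorem coeffBitsLE_ofIndex (n m q j : ℕ) :
    ((ofIndex (2 ^ q, j)).blockData n m).CoeffBitsLE (4 * q + (n + m) + 3) := by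
  set P := ofIndex (2 ^ q, j) with hP
  have hQ : 0 < 2 ^ q := by positivity
  have hN : P.N ≤ 2 ^ q := digit_lt hQ j 0 0 0 0
  have hD : P.D ≤ 2 ^ q := digit_lt hQ j 1 0 0 0
  have hM : P.M ≤ 2 ^ q * 2 ^ q := Nat.mul_le_mul hD hN
  have ha : ∀ i v w, |P.a i v w| ≤ (2 ^ q : ℕ) := fun i v w => by
    have h3 := digit_lt hQ j 3 i v w
    have h4 := digit_lt hQ j 4 i v w
    simp only [hP, ofIndex]
    rw [abs_le]
    omega
  have hc : ∀ i v, |P.c i v| ≤ (2 ^ q : ℕ) := fun i v => by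
    have h5 := digit_lt hQ j 5 i v 0
    have h6 := digit_lt hQ j 6 i v 0
    simp only [hP, ofIndex]
    rw [abs_le]
    omega
  have hr : ∀ v, P.r v ≤ 2 ^ q * 2 ^ q := fun v => (P.r_lt_M v).le.trans hM
  have hle : 2 ^ q * 2 ^ q < 2 ^ (4 * q + (n + m) + 2) := by
    rw [← pow_add]
    exact Nat.pow_lt_pow_right (by omega) (by omega)
  have hcst : ∀ (i : Fin m) (v : ℕ), (P.cst n i v).natAbs < 2 ^ (4 * q + (n + m) + 2) := fun i v => by
    by_cases h : v < n + i
    · rw [P.cst_head n h, Int.natAbs_zero]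
      positivity
    rw [P.cst_tail n h]
    have h1 : (∑ w : Fin (n + i), P.a i v w * P.r w).natAbs ≤
        (n + m) * (2 ^ q * (2 ^ q * 2 ^ q)) := by
      refine (Int.natAbs_sum_le _ _).trans ((Finset.sum_le_card_nsmul _ _
        (2 ^ q * (2 ^ q * 2 ^ q)) fun w _ => ?_).trans ?_)
      · rw [Int.natAbs_mul, Int.natAbs_natCast]
        refine Nat.mul_le_mul ?_ (hr _)
        have := ha i v w
        rwa [Int.abs_eq_natAbs, Nat.cast_le] at this
      · rw [Finset.card_univ, Fintype.card_fin, nsmul_eq_mul]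
        exact Nat.mul_le_mul_right _ (by simp)
    have h2 : (P.N * P.c i v : ℤ).natAbs ≤ 2 ^ q * 2 ^ q := by
      rw [Int.natAbs_mul, Int.natAbs_natCast]
      refine Nat.mul_le_mul hN ?_
      have := hc i v
      rwa [Int.abs_eq_natAbs, Nat.cast_le] at this
    have h3 : (P.D * (P.r v + P.N * P.c i v) : ℤ).natAbs ≤
        2 ^ q * (2 ^ q * 2 ^ q + 2 ^ q * 2 ^ q) := by
      rw [Int.natAbs_mul, Int.natAbs_natCast]
      exact Nat.mul_le_mul hD ((Int.natAbs_add_le _ _).trans (Nat.add_le_add (hr v) h2))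
    rw [Int.natAbs_mul, Int.natAbs_natCast]
    have h4 : n + m + 2 ≤ 2 ^ (n + m + 1) := Nat.lt_two_pow_self (n := n + m + 1)
    calc _ ≤ 2 ^ q * (2 ^ q * (2 ^ q * 2 ^ q + 2 ^ q * 2 ^ q) +
          (n + m) * (2 ^ q * (2 ^ q * 2 ^ q))) :=
          Nat.mul_le_mul hN ((Int.natAbs_sub_le _ _).trans (Nat.add_le_add h3 h1))
      _ = 2 ^ (4 * q) * (n + m + 2) := by rw [mul_comm 4, pow_mul]; ring
      _ ≤ 2 ^ (4 * q) * 2 ^ (n + m + 1) := Nat.mul_le_mul_left _ h4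
      _ < 2 ^ (4 * q + (n + m) + 2) := by
          rw [← pow_add]
          exact Nat.pow_lt_pow_right (by omega) (by omega)
  have hcoef : ∀ (i : Fin m) (l : Fin (m - i)) (w : ℕ),
      (P.coef n i (n + i + l) w).natAbs < 2 ^ (4 * q + (n + m) + 2) := fun i l w => by
    refine lt_of_le_of_lt ?_ hle
    rw [P.coef_tail n (by omega)]
    split_ifs
    · rw [Int.natAbs_mul, Int.natAbs_natCast]
      refine Nat.mul_le_mul hN ?_
      have := ha i (n + i + l) w
      rwa [Int.abs_eq_natAbs, Nat.cast_le] at this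
    · exact Nat.zero_le _
  intro i l
  exact ⟨fun w => P.bitLength_num_den_le (hM.trans_lt hle) (hcoef i l w),
    P.bitLength_num_den_le (hM.trans_lt hle) (hcst i _)⟩

end Choice


/-! ### The conversion is correct -/

/-- Each disjunct implies `φ`; and at each solution of `φ`, the small parameters of `exists_choice`
occur in the enumeration and yield a disjunct that holds there. -/
theorem normalForm_sat {n m S : ℕ} {φ : Formula (n + m)} (hk : n + m ≤ S)
    (hφ : φ.nodesAndBits ≤ S) (z : Fin (n + m) → ℤ) :
    (normalForm n m (2 ^ paramExp S) (2 ^ (paramExp S * (S + 7) ^ 4)) φ).Sat z ↔ φ.Sat z := by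
  rw [normalForm, bigOr_sat]
  constructor
  · rintro ⟨ψ, hψ, h⟩
    obtain ⟨j, _, rfl⟩ := List.mem_map.1 hψ
    exact (Choice.sat_of_conv_sat _ h).1
  intro h
  have hNS : φ.modulus ≤ 2 ^ S := φ.modulus_le.trans (Nat.pow_le_pow_right (by omega) hφ)
  obtain ⟨P, hN, hD, hr, ha, hc, hz, hP⟩ := exists_choice hk φ.modulus_pos hNS (z := z)
    (fun l hl => φ.dvd_modulus hl) fun l hl => l.abs_row_le ((Formula.bits_le hl).trans hφ)
  have hSq : S ≤ paramExp S := by rw [paramExp]; omega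
  obtain ⟨j, hj, hN', hD', hr', ha', hc'⟩ := P.exists_ofIndex (k := n + m)
    (hN.trans_le (hNS.trans (Nat.pow_le_pow_right (by omega) hSq))) hD (fun v _ => hr v)
    (fun i v w _ _ _ => ha i v w) fun i v _ _ => hc i v
  refine ⟨_, List.mem_map.2 ⟨j, List.mem_range.2 (hj.trans_le ?_), rfl⟩,
    Choice.conv_sat_of_sat _ h (fun v => ?_) (fun l hl => ?_) fun l hl hlz i => ?_⟩
  · rw [← pow_mul]
    exact Nat.pow_le_pow_right (by omega)
      (Nat.mul_le_mul_left _ (Nat.pow_le_pow_left (by omega) 4))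
  · rw [Choice.M, hN', hD', hr' v v.2.le]
    exact hz v
  · rw [hN', hN]
    exact φ.dvd_modulus hl
  · rw [Choice.point_congr hN' hD' hr' ha' hc']
    exact hP l hl hlz i

end PresburgerSynthesis

theorem mainTheorem10 :
    ∃ (conv : Program) (p : Polynomial ℕ),
      ∀ (n m : ℕ) (φ : Formula (n + m)),
        ∃ (ψ : Formula (n + m)) (t : ℕ),
          Runs conv (encodeSpec n m φ) (encodeFormula ψ) t ∧
          t ≤ 2 ^ p.eval φ.size ∧
          (∀ z : Fin (n + m) → ℤ, ψ.Sat z ↔ φ.Sat z) ∧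
          IsPSySyNF n m ψ ∧
          ∀ χ ∈ ψ.maxConjunctive, ∃ P : BlockData n m,
            P.IsCombination χ ∧ P.CoeffBitsLE (p.eval φ.size) ∧ P.AreSolutionMaps φ χ := by
  have hq : PolyTime fun x : BinTree => paramExp x.size := by
    have h := polyTime_size
    exact ((((PolyTime.const 4).natMul (h.natPow 3)).natAdd
      ((PolyTime.const 4).natMul (h.natPow 2))).natAdd ((PolyTime.const 4).natMul h)).natAdd
        (.const 5)
  obtain ⟨conv, B, ⟨k, hk⟩, hconv⟩ := exists_padded_program hq
    (hq.natMul ((polyTime_size.natAdd (.const 7)).natPow 4)) polyTime_specTree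
  -- The encoding of `φ` has size `S ≤ 11 * φ.size + 4`, so that `33 * φ.size + 15 ≥ 3 * S + 3`. The
  -- power `k` serves the running time, the cube the number of bits of the coefficients.
  refine ⟨conv, (33 * Polynomial.X + 15) ^ (k + 3), fun n m φ => ?_⟩
  obtain ⟨h1, h2, h3⟩ := size_encodeSpec φ
  have hp : ((33 * Polynomial.X + 15) ^ (k + 3) : Polynomial ℕ).eval φ.size =
      (33 * φ.size + 15) ^ (k + 3) := by simp
  obtain ⟨t, ht, htB⟩ := hconv (encodeSpec n m φ)
  set S := (encodeSpec n m φ).size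
  have hR : 2 ^ φ.nodesAndBits ≤ 2 ^ (paramExp S * (S + 7) ^ 4) := by
    refine Nat.pow_le_pow_right (by omega) (h2.trans (le_trans ?_
      (Nat.le_mul_of_pos_right _ (by positivity))))
    rw [paramExp]
    omega
  rw [specTree_encodeSpec hR] at ht
  have hR0 : 0 < 2 ^ (paramExp S * (S + 7) ^ 4) := by positivity
  refine ⟨_, t, ht, (htB.trans (hk S)).trans ?_, normalForm_sat h1 h2,
    isPSySyNF_normalForm φ hR0, fun χ hχ => ?_⟩
  · rw [hp]
    refine Nat.pow_le_pow_right (by omega) ((Nat.pow_le_pow_left (by omega) k).trans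
      (Nat.pow_le_pow_right (by omega) (by omega)))
  · obtain ⟨j, hj⟩ := exists_choice_of_mem_maxConjunctive hR0 hχ
    refine ⟨_, isCombination_of_mem_maxConjunctive (Choice.isCombination_conv _ φ) hj,
      fun i l => ?_, areSolutionMaps_of_mem_maxConjunctive _ hj⟩
    have hb : 4 * paramExp S + (n + m) + 3 ≤
        ((33 * Polynomial.X + 15) ^ (k + 3) : Polynomial ℕ).eval φ.size := by
      rw [hp]
      calc 4 * paramExp S + (n + m) + 3 ≤ 4 * paramExp S + S + 3 := by omega
        _ ≤ (3 * S + 3) ^ 3 := by rw [paramExp]; ring_nf; nlinarith [Nat.zero_le S]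
        _ ≤ (33 * φ.size + 15) ^ 3 := Nat.pow_le_pow_left (by omega) 3
        _ ≤ (33 * φ.size + 15) ^ (k + 3) := Nat.pow_le_pow_right (by omega) (by omega)
    have h := Choice.coeffBitsLE_ofIndex n m (paramExp S) j i l
    exact ⟨fun w => ⟨(h.1 w).1.trans hb, (h.1 w).2.trans hb⟩, h.2.1.trans hb, h.2.2.trans hb⟩
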